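/- Let $p>2$ be a prime, let $\mathbb{Z}_{p^2}$ be the ring of integers of the unramified quadratic extension of $\mathbb{Q}_p$, and let $\sigma$ be its nontrivial automorphism over $\mathbb{Z}_p$. Let $\mathrm{Herm}_n(\mathbb{Z}_{p^2})$ be the set of $n\times n$ matrices $T$ over $\mathbb{Z}_{p^2}$ with ${}^tT=\sigma(T)$. Call $T,T'\in \mathrm{Herm}_n(\mathbb{Z}_{p^2})$ $GL_n(\mathbb{Z}_{p^2})$-equivalent if $T'={}^tg\,T\,\sigma(g)$ for some $g\in GL_n(\mathbb{Z}_{p^2})$. For non-singular hermitian matrices $S$ of size $m$ and $T$ of size $n$ over $\mathbb{Z}_{p^2}$, $m\ge n$, the representation density is $$\alpha_p(S,T)=\lim_{l\to\infty}p^{-ln(2m-n)}\,\bigl|\{x\in M_{m,n}(\mathbb{Z}_{p^2}/p^l\mathbb{Z}_{p^2})\;:\; {}^tx\,S\,\sigma(x)\equiv T \bmod p^l\}\bigr|.$$ Let $1_s$ be the $s\times s$ unit matrix. Let $n\ge 1$ and suppose that $T\in \mathrm{Herm}_n(\mathbb{Z}_{p^2})$ is $GL_n(\mathbb{Z}_{p^2})$-equivalent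 to $\mathrm{diag}(p^{a_1},\dots,p^{a_n})$ with integers $0\le a_1\le\dots\le a_n$. Then the densities $\alpha_p(1_s,T)$, $s\ge n$, exist and there is a unique polynomial $F_p(X;T)\in\mathbb{Q}[X]$ such that $\alpha_p(1_s,T)=F_p((-p)^{-s};T)$ for all $s\ge n$. Moreover: 1. If $n=1$, then $F_p(X;T)=(1-X)\sum_{l=0}^{a_1}(pX)^l$. 2. If $n\ge 2$, let $T^-=\mathrm{diag}(p^{a_1},\dots,p^{a_{n-1}})$, let $H_p(X)=(1-X)(1+pX)$, and let $$A_p(X;T)=(1-(-p)^{n-1}X)(1-(-p)^{-n}X^{-1})(-p)^{a_1+\dots+a_{n-1}}(-1)^{(n+1)a_n}(p^nX)^{a_n+2}.$$ Then, in $\mathbb{Q}(X)$, $$F_p(X;T)=\frac{H_p(X)\,F_p(p^2X;T^-)-A_p(X;T)\,F_p(X;T^-)}{1-p^{2n}X^2}.$$ -/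

import Mathlib

open Filter Topology Polynomial

noncomputable section

/-- `ℤ_{p²}`, the ring of integers of the unramified quadratic extension of `ℚ_p`, realised as
the ring of `p`-typical Witt vectors of the field with `p²` elements. -/
abbrev Zp2 (p : ℕ) [Fact p.Prime] : Type := WittVector p (GaloisField p 2)

namespace Zp2

variable (p : ℕ) [Fact p.Prime]

/-- The nontrivial Galois automorphism `σ` of `ℤ_{p²}` over `ℤ_p`: the Witt vector Frobenius. -/
def conj : Zp2 p →+* Zp2 p := WittVector.frobenius

theorem conj_conj (x : Zp2 p) : conj p (conj p x) = x := by
  let _ : Fintype (GaloisField p 2) := Fintype.ofFinite _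
  have hcard : Fintype.card (GaloisField p 2) = p ^ 2 := by
    rw [Fintype.card_eq_nat_card, GaloisField.card p 2 two_ne_zero]
  ext i
  rw [conj, WittVector.coeff_frobenius_charP, WittVector.coeff_frobenius_charP, ← pow_mul,
    ← pow_two, ← hcard, FiniteField.pow_card]

theorem conj_ne_id : conj p ≠ RingHom.id _ := by
  intro h
  have key : ∀ x : GaloisField p 2, x ^ p = x := fun x => by
    have h1 : conj p (WittVector.teichmuller p x) = WittVector.teichmuller p x := by rw [h]; rfl
    have h2 := congrArg (fun w => WittVector.coeff w 0) h1
    simpa [conj, WittVector.coeff_frobenius_charP, WittVector.teichmuller_coeff_zero] using h2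
  have hp : 1 < p := (Fact.out : p.Prime).one_lt
  let _ : Fintype (GaloisField p 2) := Fintype.ofFinite _
  have hcard : Fintype.card (GaloisField p 2) = p ^ 2 := by
    rw [Fintype.card_eq_nat_card, GaloisField.card p 2 two_ne_zero]
  have hne : (X ^ p - X : (GaloisField p 2)[X]) ≠ 0 := FiniteField.X_pow_card_sub_X_ne_zero _ hp
  have hle := Polynomial.card_le_degree_of_subset_roots
    (p := (X ^ p - X : (GaloisField p 2)[X])) (Z := Finset.univ) (by
      intro x _
      rw [Polynomial.mem_roots hne]
      simp [Polynomial.IsRoot, key x])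
  rw [FiniteField.X_pow_card_sub_X_natDegree_eq _ hp, Finset.card_univ, hcard] at hle
  nlinarith

/-- The ideal `p^l ℤ_{p²}`. -/
def powIdeal (l : ℕ) : Ideal (Zp2 p) := Ideal.span {(p : Zp2 p) ^ l}

theorem powIdeal_le_comap (l : ℕ) : powIdeal p l ≤ (powIdeal p l).comap (conj p) := by
  rw [powIdeal, Ideal.span_le, Set.singleton_subset_iff, SetLike.mem_coe, Ideal.mem_comap,
    map_pow, map_natCast]
  exact Ideal.mem_span_singleton_self _

/-- The automorphism of `ℤ_{p²} / p^l ℤ_{p²}` induced by `σ`. -/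
def conjMod (l : ℕ) : Zp2 p ⧸ powIdeal p l →+* Zp2 p ⧸ powIdeal p l :=
  Ideal.quotientMap (powIdeal p l) (conj p) (powIdeal_le_comap p l)

end Zp2

section Hermitian

variable {p : ℕ} [Fact p.Prime]

/-- `T ∈ Herm_n(ℤ_{p²})`, that is `ᵗT = σ(T)`. -/
def IsHermitianZp2 {n : ℕ} (T : Matrix (Fin n) (Fin n) (Zp2 p)) : Prop :=
  T.transpose = T.map (Zp2.conj p)

/-- `T` and `T'` are `GL_n(ℤ_{p²})`-equivalent: `T' = ᵗg T σ(g)` for some `g ∈ GL_n(ℤ_{p²})`. -/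
def IsEquivalentZp2 {n : ℕ} (T T' : Matrix (Fin n) (Fin n) (Zp2 p)) : Prop :=
  ∃ g : GL (Fin n) (Zp2 p),
    T' = (g : Matrix (Fin n) (Fin n) (Zp2 p)).transpose * T *
      (g : Matrix (Fin n) (Fin n) (Zp2 p)).map (Zp2.conj p)

variable (p) in
/-- The diagonal matrix `diag(p^{a_1}, …, p^{a_n})` over `ℤ_{p²}`. -/
def diagPow {n : ℕ} (a : Fin n → ℕ) : Matrix (Fin n) (Fin n) (Zp2 p) :=
  Matrix.diagonal fun i => (p : Zp2 p) ^ a i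

/-- The number of `x ∈ M_{m,n}(ℤ_{p²} / p^l)` with `S[x] = ᵗx S σ(x) ≡ T mod p^l`. -/
def repCount {m n : ℕ} (S : Matrix (Fin m) (Fin m) (Zp2 p)) (T : Matrix (Fin n) (Fin n) (Zp2 p))
    (l : ℕ) : ℕ :=
  Nat.card {x : Matrix (Fin m) (Fin n) (Zp2 p ⧸ Zp2.powIdeal p l) //
    x.transpose * S.map (Ideal.Quotient.mk (Zp2.powIdeal p l)) * x.map (Zp2.conjMod p l) =
      T.map (Ideal.Quotient.mk (Zp2.powIdeal p l))}

/-- The limit defining the hermitian representation density `α_p(S,T)` exists and equals `α`: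
`α = lim_{l → ∞} p^{-l n (2m - n)} |{x ∈ M_{m,n}(ℤ_{p²} / p^l) ; S[x] ≡ T mod p^l}|`. -/
def HasRepDensity {m n : ℕ} (S : Matrix (Fin m) (Fin m) (Zp2 p))
    (T : Matrix (Fin n) (Fin n) (Zp2 p)) (α : ℝ) : Prop :=
  Tendsto (fun l : ℕ => (p : ℝ) ^ (-((l : ℤ) * n * (2 * m - n))) * (repCount S T l : ℝ))
    atTop (𝓝 α)

/-- `F ∈ ℚ[X]` satisfies `α_p(1_s, T) = F((-p)^{-s})` for all `s ≥ n`, `n` the size of `T`. -/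
def IsDensityPolynomial {n : ℕ} (T : Matrix (Fin n) (Fin n) (Zp2 p)) (F : ℚ[X]) : Prop :=
  ∀ s : ℕ, n ≤ s →
    HasRepDensity (1 : Matrix (Fin s) (Fin s) (Zp2 p)) T (aeval ((-(p : ℝ)) ^ (-(s : ℤ))) F)

open Classical in
/-- `F_p(X;T)`: the polynomial with `α_p(1_s, T) = F_p((-p)^{-s}; T)` (and `0` if there is none;
existence and uniqueness are part of the theorem). -/
def densityPolynomial {n : ℕ} (T : Matrix (Fin n) (Fin n) (Zp2 p)) : ℚ[X] :=
  if h : ∃ F : ℚ[X], IsDensityPolynomial T F then h.choose else 0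

end Hermitian

/-- `(a_1, …, a_n) ↦ (a_1, …, a_{n-1})`. -/
def dropLastExp {n : ℕ} (a : Fin n → ℕ) : Fin (n - 1) → ℕ :=
  fun i => a (Fin.castLE (Nat.sub_le n 1) i)

/-- `H_p(X) = (1 - X)(1 + pX)`, as an element of `ℚ(X)`. -/
def HFactor (p : ℕ) : RatFunc ℚ :=
  (1 - RatFunc.X) * (1 + (p : RatFunc ℚ) * RatFunc.X)

/-- `(1-(-p)^{n-1}X)(1-(-p)^{-n}X⁻¹)(-p)^{a_1+…+a_{n-1}}(-1)^{(n+1)a_n}(p^n X)^{a_n+2}`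
in `ℚ(X)`, for `n ≥ 1`. -/
def AFactor (p : ℕ) {n : ℕ} (hn : 1 ≤ n) (a : Fin n → ℕ) : RatFunc ℚ :=
  (1 - (-(p : RatFunc ℚ)) ^ (n - 1) * RatFunc.X) *
    (1 - (-(p : RatFunc ℚ)) ^ (-(n : ℤ)) * RatFunc.X⁻¹) *
    (-(p : RatFunc ℚ)) ^ (∑ i, dropLastExp a i) *
    (-1) ^ ((n + 1) * a ⟨n - 1, Nat.sub_lt hn one_pos⟩) *
    ((p : RatFunc ℚ) ^ n * RatFunc.X) ^ (a ⟨n - 1, Nat.sub_lt hn one_pos⟩ + 2)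

end

/-!
The densities are computed inside the finite rings `R = ℤ_{p²} / p^l`, of which only the few
properties collected in `UnramifiedQuotient` are used. Write `N_s(T)` for the number of
`x ∈ M_{s,n}(R)` with `xᴴ x = T`, and `q = -p`.

*Polynomiality.* Expanding the condition `xᴴ x = T` in additive characters turns `N_s(T)` into a
sum over hermitian matrices `Y` of multiples of the `s`-th powers of the Gauss sums
`∑_y Ψ(ᵗy Y ȳ)`. Each Gauss sum is a power of `q`: its square is a power of `p`, and it is congruent
to `1` modulo `p + 1`, since a group of `p + 1` roots of unity of norm `1` acts freely on the
nonzero `y` without changing the terms (`exists_hermGauss_eq`). So the normalised `N_s(T)` is a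
polynomial in `q^{-s}` (`exists_polynomial_repNum`). For `T = diag(p^{a_i})` it does not
depend on `l` once `l` exceeds all `a_i`, because a hermitian matrix close to `T` is equivalent to
`T` (`repNum_eq_of_close`, `repNum_succ`).

*Recursion.* Let `T⁻ = diag(p^{a_1}, …, p^{a_r})` with all `a_i ≤ b`, and let `F_b` and `F⁻` be the
polynomials of `diag(p^{a_1}, …, p^{a_r}, p^b)` and of `T⁻`. Two relations hold.

* `F_{b+1} - F_b = q^{a_1+…+a_r} (1 - q^r X) (p q^r X)^{b+1} F⁻`. Here the first `r` vectors, a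
  solution `x` of `xᴴ x = T⁻`, are chosen first. The number of possible last vectors is again a
  character sum over `t`; the sums for `t` divisible by `p²` cancel in the difference, and the
  remaining ones are Gauss sums over the orthogonal complement of `x` that do not depend on `x`
  (`repNum_adjoin_succ_sub`).
* `F_{b+2} - p^{2(r+1)} X² F_b = (1 - X) (1 + p X) F⁻(p² X)`. Here the last vector `v` is chosen
  first. The `v` divisible by `p` give the term with `F_b`. For a primitive `v`, the orthogonal
  complement of `v` behaves in all Gauss sums like a unit form of rank `s - 2`, up to a change of
  `T⁻` by a multiple of `p^{b+2}`, which has no effect; lowering `s` by `2` multiplies `X` by `p²`.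
  The number of primitive `v` gives `(1 - X) (1 + p X)` (`repNum_adjoin_add_two`).

Adding the first relation for `b` and `b + 1` and comparing with the second one expresses `F_b`
through `F⁻` (`densityPolynomial_snoc`). The formula for `n = 1` is the case `r = 0`, where
`F⁻ = 1`.
-/

noncomputable section

namespace HermDensity

open scoped Classical

/-! ### Finite quotients of the unramified quadratic extension -/

/-- The finite rings `ℤ_{p²} / p^l` with their involution, described by the properties that the
counting arguments use. The element `exists_root` stands for the Teichmüller lift of a generator
of the multiplicative group of the residue field. -/
structure UnramifiedQuotient (R : Type*) [CommRing R] [StarRing R] (p l : ℕ) : Prop where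
  prime : p.Prime
  two_lt : 2 < p
  pos : 0 < l
  card_eq : Nat.card R = p ^ (2 * l)
  pow_mul_eq_zero_iff : ∀ j ≤ l, ∀ x : R, (p : R) ^ j * x = 0 ↔ (p : R) ^ (l - j) ∣ x
  isUnit_or_dvd : ∀ x : R, IsUnit x ∨ (p : R) ∣ x
  exists_root : ∃ ζ : R, star ζ = ζ ^ p ∧ ζ ^ ((p ^ 2 - 1) / 2) = -1 ∧
    ∀ i, 0 < i → i < p ^ 2 - 1 → IsUnit (ζ ^ i - 1)

namespace UnramifiedQuotient

variable {R : Type*} [CommRing R] [StarRing R] {p l : ℕ}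

theorem pow_eq_zero (h : UnramifiedQuotient R p l) : (p : R) ^ l = 0 := by
  have := (h.pow_mul_eq_zero_iff l le_rfl 1).2 (by simp)
  simpa using this

theorem pow_eq_zero_of_le (h : UnramifiedQuotient R p l) {k : ℕ} (hk : l ≤ k) :
    (p : R) ^ k = 0 := _root_.pow_eq_zero_of_le hk h.pow_eq_zero

theorem nontrivial (h : UnramifiedQuotient R p l) : Nontrivial R := by
  by_contra hn
  rw [not_nontrivial_iff_subsingleton] at hn
  have h1 : Nat.card R = 1 := Nat.card_unique
  have h2 : 1 < p ^ (2 * l) := Nat.one_lt_pow (by have := h.pos; omega) h.prime.one_lt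
  rw [h.card_eq] at h1
  omega

theorem isNilpotent (h : UnramifiedQuotient R p l) : IsNilpotent (p : R) := ⟨l, h.pow_eq_zero⟩

theorem not_isUnit (h : UnramifiedQuotient R p l) : ¬ IsUnit (p : R) := by
  have := h.nontrivial
  exact h.isNilpotent.not_isUnit

theorem not_isUnit_of_dvd (h : UnramifiedQuotient R p l) {x : R} (hx : (p : R) ∣ x) :
    ¬ IsUnit x := fun hu => h.not_isUnit (isUnit_of_dvd_unit hx hu)

theorem isUnit_two (h : UnramifiedQuotient R p l) : IsUnit (2 : R) := by
  obtain ⟨k, hk⟩ := h.prime.odd_of_ne_two (by have := h.two_lt; omega)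
  have h1 : IsUnit ((p : R) + 1) := h.isNilpotent.isUnit_add_one
  have h2 : (p : R) + 1 = 2 * (k + 1) := by
    have := congrArg (Nat.cast : ℕ → R) hk
    push_cast at this
    linear_combination this
  rw [h2] at h1
  exact isUnit_of_mul_isUnit_left h1

/-- A half that is fixed by the involution. -/
theorem exists_half (h : UnramifiedQuotient R p l) :
    ∃ c : R, star c = c ∧ 2 * c = 1 := by
  obtain ⟨c, hc⟩ := h.isUnit_two.exists_right_inv
  refine ⟨c, ?_, hc⟩
  have h1 : 2 * star c = 1 := by
    have := congrArg star hc
    simpa [mul_comm] using this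
  exact h.isUnit_two.mul_left_cancel (h1.trans hc.symm)

/-- A unit on which the involution acts as `-1`, namely `ζ^((p+1)/2)`. -/
theorem exists_skew_unit (h : UnramifiedQuotient R p l) :
    ∃ δ : R, star δ = -δ ∧ IsUnit δ := by
  obtain ⟨ζ, h1, h2, -⟩ := h.exists_root
  obtain ⟨k, hk⟩ := h.prime.odd_of_ne_two (by have := h.two_lt; omega)
  have e : (p ^ 2 - 1) / 2 = 2 * k * (k + 1) := by
    have : p ^ 2 - 1 = 2 * (2 * k * (k + 1)) := by
      rw [Nat.sub_eq_iff_eq_add (Nat.one_le_pow _ _ h.prime.pos), hk]; ring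
    rw [this]; simp
  rw [e] at h2
  refine ⟨ζ ^ (k + 1), ?_, ?_⟩
  · rw [star_pow, h1, ← pow_mul, hk]
    have : ζ ^ ((2 * k + 1) * (k + 1)) = ζ ^ (2 * k * (k + 1)) * ζ ^ (k + 1) := by ring
    rw [this, h2]; ring
  · have h3 : IsUnit (ζ ^ (2 * k * (k + 1))) := by rw [h2]; exact isUnit_one.neg
    have hk0 : 2 * k * (k + 1) ≠ 0 := by
      have := h.two_lt
      have : 0 < k := by omega
      positivity
    exact ((isUnit_pow_iff hk0).1 h3).pow _

/-- `-1` is a norm, namely that of `ζ^((p-1)/2)`. -/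
theorem exists_norm_eq_neg_one (h : UnramifiedQuotient R p l) :
    ∃ ε : R, ε * star ε = -1 := by
  obtain ⟨ζ, h1, h2, -⟩ := h.exists_root
  obtain ⟨k, hk⟩ := h.prime.odd_of_ne_two (by have := h.two_lt; omega)
  have e : (p ^ 2 - 1) / 2 = 2 * k * (k + 1) := by
    have : p ^ 2 - 1 = 2 * (2 * k * (k + 1)) := by
      rw [Nat.sub_eq_iff_eq_add (Nat.one_le_pow _ _ h.prime.pos), hk]; ring
    rw [this]; simp
  rw [e] at h2
  refine ⟨ζ ^ k, ?_⟩
  rw [star_pow, h1, ← h2, hk]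
  ring

/-- A root of unity of order `p + 1` and norm `1` whose powers are incongruent modulo `p`, namely
`ζ^(p-1)`. -/
theorem exists_norm_one_root (h : UnramifiedQuotient R p l) :
    ∃ ξ : R, ξ * star ξ = 1 ∧ ξ ^ (p + 1) = 1 ∧
      ∀ i, 0 < i → i < p + 1 → IsUnit (ξ ^ i - 1) := by
  obtain ⟨ζ, h1, h2, h3⟩ := h.exists_root
  obtain ⟨k, hk⟩ := h.prime.odd_of_ne_two (by have := h.two_lt; omega)
  have hk0 : 0 < k := by have := h.two_lt; omega
  have e0 : p ^ 2 - 1 = 2 * (2 * k * (k + 1)) := by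
    rw [Nat.sub_eq_iff_eq_add (Nat.one_le_pow _ _ h.prime.pos), hk]; ring
  have e : (p ^ 2 - 1) / 2 = 2 * k * (k + 1) := by
    rw [e0]; simp
  rw [e] at h2
  have h4 : (ζ ^ (2 * k)) ^ (p + 1) = 1 := by
    have : (ζ ^ (2 * k)) ^ (p + 1) = (ζ ^ (2 * k * (k + 1))) ^ 2 := by rw [hk]; ring
    rw [this, h2]; ring
  refine ⟨ζ ^ (2 * k), ?_, h4, fun i hi hip => ?_⟩
  · rw [star_pow, h1, ← h4]; ring
  · rw [← pow_mul]
    refine h3 _ (by positivity) ?_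
    rw [e0]
    have : i < 2 * (k + 1) := by omega
    calc 2 * k * i < 2 * k * (2 * (k + 1)) := by
          apply Nat.mul_lt_mul_of_pos_left this; positivity
      _ = _ := by ring

theorem exists_eq_pow_mul (h : UnramifiedQuotient R p l) (x : R) :
    ∃ j ≤ l, ∃ u : R, IsUnit u ∧ x = (p : R) ^ j * u := by
  have key : ∀ k : ℕ, (p : R) ^ k ∣ x ∨ ∃ j < k, ∃ u : R, IsUnit u ∧ x = (p : R) ^ j * u := by
    intro k
    induction k with
    | zero => simp
    | succ k ih =>
      rcases ih with ⟨z, hz⟩ | ⟨j, hj, u, hu⟩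
      · rcases h.isUnit_or_dvd z with hu | ⟨w, rfl⟩
        · exact Or.inr ⟨k, by omega, z, hu, hz⟩
        · exact Or.inl ⟨w, by rw [hz]; ring⟩
      · exact Or.inr ⟨j, by omega, u, hu⟩
  rcases key l with ⟨z, hz⟩ | ⟨j, hj, u, hu⟩
  · exact ⟨l, le_rfl, 1, isUnit_one, by rw [hz, h.pow_eq_zero]; ring⟩
  · exact ⟨j, hj.le, u, hu⟩

theorem finite (h : UnramifiedQuotient R p l) : Finite R := by
  apply Nat.finite_of_card_ne_zero
  rw [h.card_eq]
  exact pow_ne_zero _ h.prime.ne_zero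

theorem card_pow_mul_eq_zero (h : UnramifiedQuotient R p l) {j : ℕ} (hj : j ≤ l) :
    Nat.card {x : R // (p : R) ^ j * x = 0} = p ^ (2 * j) := by
  have := h.finite
  set c : ℕ → ℕ := fun j => Nat.card {x : R // (p : R) ^ j * x = 0} with hc
  have step : ∀ k < l, c (k + 1) = c k * c 1 := by
    intro k hk
    let f : R →+ R := AddMonoidHom.mulLeft ((p : R) ^ (k + 1))
    let g : R →+ R := AddMonoidHom.mulLeft ((p : R) ^ k)
    -- multiplication by `p` maps the annihilator of `p^(k+1)` onto the annihilator of `p^k`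
    let φ : f.ker →+ g.ker := ((AddMonoidHom.mulLeft (p : R)).comp f.ker.subtype).codRestrict g.ker
      (fun x => by
        have hx : (p : R) ^ (k + 1) * x.1 = 0 := x.2
        change (p : R) ^ k * ((p : R) * x.1) = 0
        rw [← hx]; ring)
    have hsurj : Function.Surjective φ := by
      rintro ⟨y, hy⟩
      have hy' : (p : R) ^ k * y = 0 := hy
      obtain ⟨z, hz⟩ := (h.pow_mul_eq_zero_iff k hk.le y).1 hy'
      obtain ⟨d, hd⟩ : ∃ d, l - k = d + 1 := ⟨l - k - 1, by omega⟩
      rw [hd, pow_succ'] at hz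
      refine ⟨⟨(p : R) ^ d * z, ?_⟩, ?_⟩
      · change (p : R) ^ (k + 1) * ((p : R) ^ d * z) = 0
        rw [← hy', hz]; ring
      · apply Subtype.ext
        change (p : R) * ((p : R) ^ d * z) = y
        rw [hz]; ring
    have h1 : Nat.card f.ker = Nat.card φ.ker * Nat.card g.ker := by
      rw [AddSubgroup.card_eq_card_quotient_mul_card_addSubgroup φ.ker,
        Nat.card_congr (QuotientAddGroup.quotientKerEquivOfSurjective φ hsurj).toEquiv, mul_comm]
    have h2 : Nat.card φ.ker = c 1 := by
      refine Nat.card_congr ⟨fun x => ⟨x.1.1, ?_⟩, fun x => ⟨⟨x.1, ?_⟩, ?_⟩, fun x => rfl,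
        fun x => rfl⟩
      · have : (p : R) * x.1.1 = 0 := congrArg Subtype.val x.2
        rw [pow_one, this]
      · have := x.2
        change (p : R) ^ (k + 1) * x.1 = 0
        rw [pow_succ, mul_assoc]
        simp only [pow_one] at this
        rw [this, mul_zero]
      · apply Subtype.ext
        exact (congrArg (· * x.1) (pow_one (p : R))).symm.trans x.2
    have h3 : Nat.card f.ker = c (k + 1) := rfl
    have h4 : Nat.card g.ker = c k := rfl
    rw [← h3, h1, h2, h4, mul_comm]
  have hpow : ∀ k ≤ l, c k = c 1 ^ k := by
    intro k
    induction k with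
    | zero =>
      intro _
      simp [hc]
    | succ k ih => intro hk; rw [step k (by omega), ih (by omega), pow_succ]
  have hl : c l = p ^ (2 * l) := by
    rw [← h.card_eq]
    exact Nat.card_congr (Equiv.subtypeUnivEquiv fun x => by rw [h.pow_eq_zero, zero_mul])
  have h1 : c 1 = p ^ 2 := by
    rw [hpow l le_rfl, pow_mul] at hl
    exact Nat.pow_left_injective h.pos.ne' hl
  rw [show Nat.card {x : R // (p : R) ^ j * x = 0} = c j from rfl, hpow j hj, h1, pow_mul]

/-- Half of a module with a compatible involution is self-adjoint: the other half is obtained by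
multiplication with a skew unit. -/
theorem card_selfAdjoint_sq (h : UnramifiedQuotient R p l) {M : Type*} [AddCommGroup M]
    [StarAddMonoid M] [Module R M] [StarModule R M] :
    Nat.card (selfAdjoint M) ^ 2 = Nat.card M := by
  obtain ⟨δ, hδ, hδu⟩ := h.exists_skew_unit
  obtain ⟨c, hc, hc2⟩ := h.exists_half
  obtain ⟨γ, hγ⟩ := hδu.exists_right_inv
  have hγs : star γ = -γ := by
    have h1 := congrArg star hγ
    rw [star_mul, hδ, star_one] at h1
    refine hδu.mul_left_cancel ?_
    linear_combination -h1 + hγ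
  rw [pow_two, ← Nat.card_prod]
  refine Nat.card_congr (Equiv.ofBijective (fun x => (x.1 : M) + δ • (x.2 : M)) ⟨?_, ?_⟩)
  · rintro ⟨⟨a, ha⟩, ⟨b, hb⟩⟩ ⟨⟨a', ha'⟩, ⟨b', hb'⟩⟩ hab
    simp only at hab
    have ha1 : star a = a := ha
    have hb1 : star b = b := hb
    have ha1' : star a' = a' := ha'
    have hb1' : star b' = b' := hb'
    have hs := congrArg star hab
    simp only [star_add, star_smul, ha1, hb1, ha1', hb1', hδ, neg_smul] at hs
    have e1 : (2 : R) • a = (2 : R) • a' := by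
      rw [two_smul, two_smul]
      have := congrArg₂ HAdd.hAdd hab hs
      calc a + a = a + δ • b + (a + -(δ • b)) := by abel
        _ = _ := this
        _ = a' + a' := by abel
    have e2 : a = a' := by
      have := congrArg (fun z => c • z) e1
      simpa [smul_smul, mul_comm c 2, hc2] using this
    subst e2
    have e3 : b = b' := by
      have := congrArg (fun z => γ • z) (add_left_cancel hab)
      simpa [smul_smul, mul_comm γ δ, hγ] using this
    subst e3
    rfl
  · intro x
    refine ⟨⟨⟨c • (x + star x), ?_⟩, ⟨(γ * c) • (x - star x), ?_⟩⟩, ?_⟩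
    · change star (c • (x + star x)) = c • (x + star x)
      rw [star_smul, hc, star_add, star_star, add_comm]
    · change star ((γ * c) • (x - star x)) = (γ * c) • (x - star x)
      rw [star_smul, star_mul, hc, hγs, star_sub, star_star, ← neg_sub x, smul_neg, ← neg_smul]
      congr 1; ring
    · change c • (x + star x) + δ • (γ * c) • (x - star x) = x
      rw [smul_smul, ← mul_assoc, hγ, one_mul, ← smul_add]
      have : x + star x + (x - star x) = (2 : R) • x := by rw [two_smul]; abel
      rw [this, smul_smul, mul_comm, hc2, one_smul]

theorem card_selfAdjoint (h : UnramifiedQuotient R p l) :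
    Nat.card (selfAdjoint R) = p ^ l := by
  have := h.card_selfAdjoint_sq (M := R)
  rw [h.card_eq, mul_comm, pow_mul] at this
  exact Nat.pow_left_injective two_ne_zero this

theorem card_selfAdjoint_matrix (h : UnramifiedQuotient R p l) (ι : Type*) [Fintype ι] :
    Nat.card (selfAdjoint (Matrix ι ι R)) = p ^ (l * Fintype.card ι ^ 2) := by
  have h1 := h.card_selfAdjoint_sq (M := Matrix ι ι R)
  have h2 : Nat.card (Matrix ι ι R) = (p ^ (l * Fintype.card ι ^ 2)) ^ 2 := by
    change Nat.card (ι → ι → R) = _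
    rw [Nat.card_fun, Nat.card_fun, h.card_eq, Nat.card_eq_fintype_card]
    ring
  rw [h2] at h1
  exact Nat.pow_left_injective two_ne_zero h1

/-- An additive character whose restriction to no nonzero ideal is trivial and which is
invariant under the involution. -/
theorem exists_character (h : UnramifiedQuotient R p l) :
    ∃ Ψ : AddChar R ℂ, (∀ x, Ψ (star x) = Ψ x) ∧ Ψ.IsPrimitive := by
  have := h.finite
  have hne : (p : R) ^ (l - 1) ≠ 0 := by
    intro h0
    have h1 := (h.pow_mul_eq_zero_iff (l - 1) (by omega) 1).1 (by rw [h0, zero_mul])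
    rw [show l - (l - 1) = 1 by have := h.pos; omega, pow_one] at h1
    exact h.not_isUnit (isUnit_of_dvd_one h1)
  obtain ⟨Ψ₀, hΨ₀⟩ := AddChar.exists_apply_ne_zero.2 hne
  obtain ⟨c, hc, hc2⟩ := h.exists_half
  refine ⟨Ψ₀ * Ψ₀.compAddMonoidHom (starAddEquiv : R ≃+ R).toAddMonoidHom, fun x => ?_, ?_⟩
  · simp [mul_comm]
  · intro x hx h1
    obtain ⟨j, hj, u, hu, rfl⟩ := h.exists_eq_pow_mul x
    have hjl : j < l := by
      rcases hj.lt_or_eq with h2 | rfl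
      · exact h2
      · exact absurd (by rw [h.pow_eq_zero, zero_mul]) hx
    obtain ⟨v, hv⟩ := hu.exists_right_inv
    have h2 := DFunLike.congr_fun h1 (v * c * (p : R) ^ (l - 1 - j))
    have e : (p : R) ^ j * u * (v * c * (p : R) ^ (l - 1 - j)) = c * (p : R) ^ (l - 1) := by
      rw [show l - 1 = j + (l - 1 - j) by omega, pow_add, show j + (l - 1 - j) - j = l - 1 - j by
        omega]
      linear_combination (p : R) ^ j * c * (p : R) ^ (l - 1 - j) * hv
    rw [AddChar.mulShift_apply, e] at h2
    have e2 : c * (p : R) ^ (l - 1) + c * (p : R) ^ (l - 1) = (p : R) ^ (l - 1) := by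
      linear_combination (p : R) ^ (l - 1) * hc2
    simp only [AddChar.mul_apply, AddChar.compAddMonoidHom_apply, AddEquiv.coe_toAddMonoidHom,
      starAddEquiv_apply, star_mul', star_pow, star_natCast, hc, AddChar.one_apply] at h2
    rw [← AddChar.map_add_eq_mul, e2] at h2
    exact hΨ₀ h2

end UnramifiedQuotient

/-! ### Hermitian Gauss sums -/

open Matrix

section CharacterSums

variable {R : Type*} [CommRing R] {Ψ : AddChar R ℂ} {ι : Type*} [Fintype ι]

theorem map_sum_eq_prod {κ : Type*} (s : Finset κ) (f : κ → R) :
    Ψ (∑ i ∈ s, f i) = ∏ i ∈ s, Ψ (f i) := by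
  induction s using Finset.induction_on with
  | empty => simp
  | insert a s ha ih => rw [Finset.sum_insert ha, Finset.prod_insert ha, AddChar.map_add_eq_mul, ih]

theorem sum_char_dotProduct [Fintype R] (hΨ : Ψ.IsPrimitive) (c : ι → R) :
    ∑ w : ι → R, Ψ (w ⬝ᵥ c) = if c = 0 then (Nat.card R : ℂ) ^ Fintype.card ι else 0 := by
  have h1 : ∀ w : ι → R, Ψ (w ⬝ᵥ c) = ∏ i, Ψ (w i * c i) := fun w => map_sum_eq_prod _ _
  simp_rw [h1]
  rw [← Fintype.piFinset_univ, ← Finset.prod_univ_sum (fun _ : ι => (Finset.univ : Finset R))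
    (fun i x => Ψ (x * c i))]
  simp_rw [AddChar.sum_mulShift _ hΨ, Nat.card_eq_fintype_card]
  split_ifs with hc
  · subst hc; simp
  · obtain ⟨i, hi⟩ := Function.ne_iff.1 hc
    exact Finset.prod_eq_zero (Finset.mem_univ i) (by simpa using hi)

/-- Orthogonality for a character of a finite group that is given by composition. -/
theorem sum_char_comp {A : Type*} [AddCommGroup A] [Fintype A] (f : A →+ R) :
    ∑ a, Ψ (f a) = if ∀ a, Ψ (f a) = 1 then (Nat.card A : ℂ) else 0 := by
  have h1 := AddChar.sum_eq_ite (Ψ.compAddMonoidHom f)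
  simp only [AddChar.compAddMonoidHom_apply] at h1
  rw [h1, Nat.card_eq_fintype_card]
  congr 1
  simp [AddChar.eq_zero_iff]

theorem isIntegral_char [Fintype R] (x : R) : IsIntegral ℤ (Ψ x) := by
  refine IsIntegral.of_pow (n := Fintype.card R) Fintype.card_pos ?_
  rw [← AddChar.map_nsmul_eq_pow, card_nsmul_eq_zero, AddChar.map_zero_eq_one]
  exact isIntegral_one

end CharacterSums

/-- The quadratic Gauss sum `∑ Ψ(ᵗy Y ȳ)` of a square matrix `Y`, which is of interest for
hermitian `Y`. -/
def hermGauss {R : Type*} [CommRing R] [StarRing R] [Fintype R] (Ψ : AddChar R ℂ)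
    {ι : Type*} [Fintype ι] (Y : Matrix ι ι R) : ℂ :=
  ∑ y : ι → R, Ψ (y ⬝ᵥ Y *ᵥ star y)

/-- Divisibility of rational integers may be tested in the ring of algebraic integers. -/
theorem int_dvd_of_eq_mul_isIntegral {a b : ℤ} (hb : b ≠ 0) {z : ℂ} (hz : IsIntegral ℤ z)
    (h : (a : ℂ) = b * z) : b ∣ a := by
  have hb' : (b : ℂ) ≠ 0 := Int.cast_ne_zero.2 hb
  have h1 : z = algebraMap ℚ ℂ ((a : ℚ) / b) := by
    rw [eq_ratCast]
    push_cast
    rw [h, mul_div_cancel_left₀ _ hb']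
  rw [h1, isIntegral_algebraMap_iff (algebraMap ℚ ℂ).injective,
    IsIntegrallyClosed.isIntegral_iff] at hz
  obtain ⟨y, hy⟩ := hz
  refine ⟨y, ?_⟩
  have hbq : (b : ℚ) ≠ 0 := Int.cast_ne_zero.2 hb
  have : (y : ℚ) = a / b := hy
  rw [eq_div_iff hbq] at this
  have h2 : ((b * y : ℤ) : ℚ) = a := by push_cast; rw [← this]; ring
  exact_mod_cast h2.symm

section HermGauss

variable {R : Type*} [CommRing R] [StarRing R] {p l : ℕ} {Ψ : AddChar R ℂ}
  {ι : Type*} [Fintype ι]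

theorem star_dotProduct_mulVec {Y : Matrix ι ι R} (hY : Yᴴ = Y) (w z : ι → R) :
    star (w ⬝ᵥ Y *ᵥ star z) = z ⬝ᵥ Y *ᵥ star w := by
  simp only [dotProduct, mulVec, Finset.mul_sum, star_sum, star_mul', Pi.star_apply, star_star]
  rw [Finset.sum_comm]
  refine Finset.sum_congr rfl fun j _ => Finset.sum_congr rfl fun i _ => ?_
  rw [← congrFun (congrFun hY j) i, conjTranspose_apply]
  ring

theorem char_dotProduct_swap (hs : ∀ x, Ψ (star x) = Ψ x) {Y : Matrix ι ι R} (hY : Yᴴ = Y)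
    (w z : ι → R) : Ψ (w ⬝ᵥ Y *ᵥ star z) = Ψ (z ⬝ᵥ Y *ᵥ star w) := by
  rw [← star_dotProduct_mulVec hY, hs]

theorem natCard_ker_eq_pow (h : UnramifiedQuotient R p l) (Y : Matrix ι ι R) :
    ∃ d ≤ 2 * l * Fintype.card ι, Nat.card {y : ι → R // Y *ᵥ y = 0} = p ^ d := by
  have h1 : Nat.card (ι → R) = p ^ (2 * l * Fintype.card ι) := by
    rw [Nat.card_fun, h.card_eq, Nat.card_eq_fintype_card, ← pow_mul]
  have h2 := AddSubgroup.card_addSubgroup_dvd_card (Matrix.mulVecLin Y).toAddMonoidHom.ker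
  rw [h1] at h2
  exact (Nat.dvd_prime_pow h.prime).1 h2

variable [Fintype R]

theorem hermGauss_eq_sum_neg (h : UnramifiedQuotient R p l) (Y : Matrix ι ι R) :
    hermGauss Ψ Y = ∑ y : ι → R, Ψ (-(y ⬝ᵥ Y *ᵥ star y)) := by
  obtain ⟨ε, hε⟩ := h.exists_norm_eq_neg_one
  have hu : IsUnit ε := by
    refine IsUnit.of_mul_eq_one (-star ε) ?_
    rw [mul_neg, hε, neg_neg]
  refine (Fintype.sum_bijective (fun y : ι → R => ε • y) ?_ _ _ fun y => ?_).symm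
  · exact (MulAction.bijective hu.unit)
  · rw [star_smul, mulVec_smul, smul_dotProduct, dotProduct_smul, smul_smul, hε]
    simp

/-- The square of a Gauss sum. As `-1` is a norm, one factor may be replaced by its complex
conjugate, and then the double sum collapses to a sum over the kernel of `Y`. -/
theorem hermGauss_sq (h : UnramifiedQuotient R p l) (hs : ∀ x, Ψ (star x) = Ψ x)
    (hΨ : Ψ.IsPrimitive) {Y : Matrix ι ι R} (hY : Yᴴ = Y) :
    hermGauss Ψ Y ^ 2 =
      (p : ℂ) ^ (2 * l * Fintype.card ι) * (Nat.card {y : ι → R // Y *ᵥ y = 0} : ℂ) := by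
  have h1 : hermGauss Ψ Y ^ 2 =
      ∑ z : ι → R, ∑ w : ι → R, Ψ (w ⬝ᵥ Y *ᵥ star w) * Ψ (z ⬝ᵥ (2 : R) • Y *ᵥ star w) := by
    rw [pow_two]
    nth_rw 2 [hermGauss_eq_sum_neg h]
    rw [hermGauss, Finset.sum_mul_sum, Finset.sum_comm]
    refine Finset.sum_congr rfl fun z _ => ?_
    refine (Fintype.sum_equiv (Equiv.addLeft z) _ _ fun w => ?_).symm
    rw [← AddChar.map_add_eq_mul]
    change _ = Ψ ((z + w) ⬝ᵥ Y *ᵥ star (z + w)) * Ψ (-(z ⬝ᵥ Y *ᵥ star z))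
    have e : (z + w) ⬝ᵥ Y *ᵥ star (z + w) + -(z ⬝ᵥ Y *ᵥ star z) =
        w ⬝ᵥ Y *ᵥ star w + z ⬝ᵥ Y *ᵥ star w + w ⬝ᵥ Y *ᵥ star z := by
      rw [star_add, mulVec_add, add_dotProduct, dotProduct_add, dotProduct_add]
      ring
    rw [← AddChar.map_add_eq_mul Ψ ((z + w) ⬝ᵥ _), e, AddChar.map_add_eq_mul _ (_ + _),
      char_dotProduct_swap hs hY w z, ← AddChar.map_add_eq_mul, dotProduct_smul, smul_eq_mul]
    congr 1; ring
  rw [h1, Finset.sum_comm]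
  simp_rw [← Finset.mul_sum, sum_char_dotProduct hΨ]
  have h2 : ∀ w : ι → R, (Ψ (w ⬝ᵥ Y *ᵥ star w) *
      if (2 : R) • Y *ᵥ star w = 0 then (Nat.card R : ℂ) ^ Fintype.card ι else 0) =
      if Y *ᵥ star w = 0 then (p : ℂ) ^ (2 * l * Fintype.card ι) else 0 := by
    intro w
    have e : (2 : R) • Y *ᵥ star w = 0 ↔ Y *ᵥ star w = 0 := by
      obtain ⟨c, -, hc⟩ := h.exists_half
      constructor
      · intro h0
        have := congrArg (fun v => c • v) h0
        simpa [smul_smul, mul_comm c 2, hc] using this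
      · intro h0; rw [h0, smul_zero]
    rw [if_congr e rfl rfl, h.card_eq]
    split_ifs with h0
    · rw [h0]; simp [pow_mul]
    · simp
  simp_rw [h2]
  rw [← Finset.sum_filter, Finset.sum_const, nsmul_eq_mul, mul_comm]
  congr 2
  rw [← Fintype.card_subtype, ← Nat.card_eq_fintype_card]
  refine Nat.card_congr ⟨fun y => ⟨star y.1, y.2⟩, fun y => ⟨star y.1, ?_⟩, fun y => ?_,
    fun y => ?_⟩
  · rw [star_star]; exact y.2
  · simp
  · simp

/-- A Gauss sum is congruent to `1` modulo `p + 1`: the norm one roots of unity of order `p + 1`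
act freely on the nonzero vectors and preserve the summand. -/
theorem hermGauss_eq_one_add (h : UnramifiedQuotient R p l) (Y : Matrix ι ι R) :
    ∃ z : ℂ, IsIntegral ℤ z ∧ hermGauss Ψ Y = 1 + (p + 1) * z := by
  obtain ⟨ξ, hξ, hξp, hξi⟩ := h.exists_norm_one_root
  have := h.nontrivial
  let u : Rˣ := ⟨ξ, star ξ, hξ, by rw [mul_comm]; exact hξ⟩
  have hup : u ^ (p + 1) = 1 := Units.ext (by simpa using hξp)
  let G : Subgroup Rˣ := Subgroup.zpowers u
  have hord : orderOf u = p + 1 := by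
    refine (orderOf_eq_iff (Nat.succ_pos p)).2 ⟨hup, fun m hm hm0 h1 => ?_⟩
    have h2 := hξi m hm0 hm
    have h3 : ξ ^ m = 1 := by simpa using congrArg Units.val h1
    rw [h3, sub_self] at h2
    exact not_isUnit_zero h2
  have hG : Nat.card G = p + 1 := by rw [Nat.card_zpowers, hord]
  have hmem : ∀ g : G, ∃ m < p + 1, (g : Rˣ) = u ^ m := by
    rintro ⟨g, hg⟩
    obtain ⟨m, hm⟩ := (mem_powers_iff_mem_zpowers (x := u)).2 hg
    refine ⟨m % (p + 1), Nat.mod_lt _ (Nat.succ_pos p), ?_⟩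
    rw [← hord, pow_mod_orderOf]
    exact hm.symm
  set f : (ι → R) → ℂ := fun y => Ψ (y ⬝ᵥ Y *ᵥ star y) with hf
  have hfinv : ∀ (g : G) (y : ι → R), f (g • y) = f y := by
    intro g y
    obtain ⟨m, -, hm⟩ := hmem g
    have e : g • y = (ξ ^ m) • y := by
      rw [Subgroup.smul_def, hm]
      change ((u ^ m : Rˣ) : R) • y = _
      simp [u]
    have hn : ξ ^ m * star (ξ ^ m) = 1 := by rw [star_pow, ← mul_pow, hξ, one_pow]
    rw [hf]
    simp only [e]
    rw [star_smul, mulVec_smul, smul_dotProduct, dotProduct_smul, smul_smul, hn, one_smul]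
  have hstab : ∀ y : ι → R, y ≠ 0 → Nat.card (MulAction.stabilizer G y) = 1 := by
    intro y hy
    rw [Subgroup.card_eq_one, Subgroup.eq_bot_iff_forall]
    intro g hg
    obtain ⟨m, hmp, hm⟩ := hmem g
    have e : g • y = (ξ ^ m) • y := by
      rw [Subgroup.smul_def, hm]
      change ((u ^ m : Rˣ) : R) • y = _
      simp [u]
    have hg' : g • y = y := hg
    rw [e] at hg'
    rcases Nat.eq_zero_or_pos m with rfl | hm0
    · exact Subtype.ext (by simpa using hm)
    · exfalso
      apply hy
      have h2 := hξi m hm0 hmp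
      have h3 : (ξ ^ m - 1) • y = (ξ ^ m - 1) • (0 : ι → R) := by
        rw [sub_smul, one_smul, hg', sub_self, smul_zero]
      exact h2.smul_left_cancel.1 h3
  let Q := Quotient (MulAction.orbitRel G (ι → R))
  have hfib : ∀ q : Q, ∃ z : ℂ, IsIntegral ℤ z ∧
      ∑ y : ι → R with Quotient.mk (MulAction.orbitRel G (ι → R)) y = q, f y =
        (if q = Quotient.mk _ 0 then 1 else 0) + (p + 1) * z := by
    intro q
    induction q using Quotient.inductionOn with
    | h y₀ =>
      have hset : ∀ y : ι → R, Quotient.mk (MulAction.orbitRel G (ι → R)) y =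
          Quotient.mk _ y₀ ↔ y ∈ MulAction.orbit G y₀ := fun y => by
        rw [Quotient.eq, MulAction.orbitRel_apply]
      have hconst : ∑ y : ι → R with Quotient.mk (MulAction.orbitRel G (ι → R)) y =
          Quotient.mk _ y₀, f y = (Nat.card (MulAction.orbit G y₀) : ℂ) * f y₀ := by
        rw [Finset.sum_congr rfl (g := fun _ => f y₀), Finset.sum_const, nsmul_eq_mul]
        · congr 2
          rw [← Fintype.card_subtype, ← Nat.card_eq_fintype_card]
          exact Nat.card_congr (Equiv.subtypeEquivRight hset)
        · intro y hy
          rw [Finset.mem_filter] at hy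
          obtain ⟨g, rfl⟩ := (hset y).1 hy.2
          exact hfinv g y₀
      rw [hconst]
      by_cases hy : y₀ = 0
      · subst hy
        refine ⟨0, isIntegral_zero, ?_⟩
        have : MulAction.orbit G (0 : ι → R) = {0} := by
          ext y; simp [MulAction.mem_orbit_iff, eq_comm]
        rw [this]
        simp [hf]
      · refine ⟨f y₀, isIntegral_char _, ?_⟩
        have h1 : Nat.card (MulAction.orbit G y₀) = p + 1 := by
          have := MulAction.card_orbit_mul_card_stabilizer_eq_card_group G y₀
          rw [← Nat.card_eq_fintype_card, ← Nat.card_eq_fintype_card,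
            ← Nat.card_eq_fintype_card, hstab y₀ hy, hG, mul_one] at this
          exact this
        have h2 : ¬ (Quotient.mk (MulAction.orbitRel G (ι → R)) y₀ = Quotient.mk _ 0) := by
          intro h3
          rw [Quotient.eq, MulAction.orbitRel_apply] at h3
          obtain ⟨g, hg⟩ := h3
          exact hy (by rw [← hg]; simp)
        rw [h1, if_neg h2]
        push_cast
        ring
  choose z hz hz' using hfib
  refine ⟨∑ q, z q, IsIntegral.sum _ fun q _ => hz q, ?_⟩
  rw [hermGauss, ← Finset.sum_fiberwise Finset.univ
    (Quotient.mk (MulAction.orbitRel G (ι → R)))]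
  rw [Finset.sum_congr rfl fun q _ => hz' q, Finset.sum_add_distrib, ← Finset.mul_sum]
  congr 1
  exact (Finset.sum_ite_eq' Finset.univ _ _).trans (if_pos (Finset.mem_univ _))

/-- The hermitian Gauss sum is a power of `-p`: its square is a power of `p`, and as `p` is `-1`
modulo `p + 1`, the congruence to `1` forces this power to be even and determines the sign. -/
theorem exists_hermGauss_eq (h : UnramifiedQuotient R p l) (hs : ∀ x, Ψ (star x) = Ψ x)
    (hΨ : Ψ.IsPrimitive) {Y : Matrix ι ι R} (hY : Yᴴ = Y) :
    ∃ c : ℕ, c ≤ 2 * l * Fintype.card ι ∧ hermGauss Ψ Y = (-(p : ℂ)) ^ c ∧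
      p ^ (2 * c) = p ^ (2 * l * Fintype.card ι) * Nat.card {y : ι → R // Y *ᵥ y = 0} := by
  obtain ⟨d, hd, hker⟩ := natCard_ker_eq_pow h Y
  have hsq := hermGauss_sq h hs hΨ hY
  obtain ⟨z, hz, hg⟩ := hermGauss_eq_one_add (Ψ := Ψ) h Y
  have hp2 := h.two_lt
  rw [hker] at hsq
  rw [hker, ← pow_add]
  set N := 2 * l * Fintype.card ι + d with hN
  have hsq' : hermGauss Ψ Y ^ 2 = (p : ℂ) ^ N := by rw [hsq, hN]; push_cast; ring
  have hp0 : ((p : ℤ) + 1) ≠ 0 := by positivity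
  have hmod : ∀ k : ℕ, ((p : ℤ) + 1) ∣ (p : ℤ) ^ k - (-1) ^ k := fun k => by
    have := sub_dvd_pow_sub_pow (p : ℤ) (-1) k
    rwa [sub_neg_eq_add] at this
  have hnot : ¬ ((p : ℤ) + 1) ∣ 2 := by
    intro h2
    have := Int.le_of_dvd two_pos h2
    omega
  have hNeven : Even N := by
    have h1 : ((p : ℤ) + 1) ∣ (p : ℤ) ^ N - 1 := by
      refine int_dvd_of_eq_mul_isIntegral hp0 (z := z * (2 + (p + 1) * z)) ?_ ?_
      · have hi : ∀ n : ℕ, IsIntegral ℤ (n : ℂ) := fun n => isIntegral_algebraMap (x := (n : ℤ))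
        refine hz.mul ?_
        have := (hi 2).add ((hi (p + 1)).mul hz)
        simpa using this
      · push_cast
        rw [← hsq', hg]; ring
    by_contra hodd
    rw [Nat.not_even_iff_odd] at hodd
    have h2 := dvd_sub h1 (hmod N)
    rw [hodd.neg_one_pow] at h2
    apply hnot
    have e : ((p : ℤ) ^ N - 1 - (p ^ N - -1)) = -2 := by ring
    rw [e, dvd_neg] at h2
    exact h2
  obtain ⟨c, hc⟩ := hNeven
  refine ⟨c, by omega, ?_, by congr 1; omega⟩
  have h3 : hermGauss Ψ Y ^ 2 = ((p : ℂ) ^ c) ^ 2 := by rw [hsq', hc]; ring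
  rw [neg_pow]
  rcases sq_eq_sq_iff_eq_or_eq_neg.1 h3 with h4 | h4
  · rw [h4]
    have h1 : ((p : ℤ) + 1) ∣ (p : ℤ) ^ c - 1 := by
      refine int_dvd_of_eq_mul_isIntegral hp0 hz ?_
      push_cast
      rw [← h4, hg]; ring
    rcases Nat.even_or_odd c with he | ho
    · rw [he.neg_one_pow, one_mul]
    · exfalso
      have h2 := dvd_sub h1 (hmod c)
      rw [ho.neg_one_pow, show ((p : ℤ) ^ c - 1 - (p ^ c - -1)) = -2 by ring, dvd_neg] at h2
      exact hnot h2
  · rw [h4]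
    have h1 : ((p : ℤ) + 1) ∣ -(p : ℤ) ^ c - 1 := by
      refine int_dvd_of_eq_mul_isIntegral hp0 hz ?_
      push_cast
      rw [← h4, hg]; ring
    rcases Nat.even_or_odd c with he | ho
    · exfalso
      have h2 := dvd_add h1 (hmod c)
      rw [he.neg_one_pow, show (-(p : ℤ) ^ c - 1 + (p ^ c - 1)) = -2 by ring, dvd_neg] at h2
      exact hnot h2
    · rw [ho.neg_one_pow]; ring

theorem hermGauss_eq_of_card_ker (h : UnramifiedQuotient R p l) (hs : ∀ x, Ψ (star x) = Ψ x)
    (hΨ : Ψ.IsPrimitive) {Y : Matrix ι ι R} (hY : Yᴴ = Y) {d : ℕ}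
    (hd : Nat.card {y : ι → R // Y *ᵥ y = 0} = p ^ (2 * d)) :
    hermGauss Ψ Y = (-(p : ℂ)) ^ (l * Fintype.card ι + d) := by
  obtain ⟨c, -, hc, hc2⟩ := exists_hermGauss_eq h hs hΨ hY
  rw [hd, ← pow_add] at hc2
  have := Nat.pow_right_injective h.prime.two_le hc2
  rw [hc]
  congr 1
  have e : 2 * l * Fintype.card ι = 2 * (l * Fintype.card ι) := by ring
  omega

theorem hermGauss_diagonal (h : UnramifiedQuotient R p l) (hs : ∀ x, Ψ (star x) = Ψ x)
    (hΨ : Ψ.IsPrimitive) {d : ι → R} (hd : ∀ i, star (d i) = d i) {b : ι → ℕ}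
    (hb : ∀ i, b i ≤ l) (hdb : ∀ i, ∃ u, IsUnit u ∧ d i = (p : R) ^ b i * u) :
    hermGauss Ψ (diagonal d) = (-(p : ℂ)) ^ (l * Fintype.card ι + ∑ i, b i) := by
  refine hermGauss_eq_of_card_ker h hs hΨ ?_ ?_
  · rw [diagonal_conjTranspose]
    congr 1
    exact funext hd
  · have e : {y : ι → R // diagonal d *ᵥ y = 0} ≃ ∀ i, {x : R // (p : R) ^ b i * x = 0} := by
      refine (Equiv.subtypeEquivRight fun y => ?_).trans Equiv.subtypePiEquivPi
      rw [funext_iff]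
      refine forall_congr' fun i => ?_
      obtain ⟨u, hu, hdu⟩ := hdb i
      rw [mulVec_diagonal, hdu, Pi.zero_apply, mul_right_comm, hu.mul_left_eq_zero]
    rw [Nat.card_congr e, Nat.card_pi]
    simp_rw [fun i => h.card_pow_mul_eq_zero (hb i)]
    rw [Finset.prod_pow_eq_pow_sum, Finset.mul_sum]

end HermGauss

/-! ### Representation numbers and their Fourier expansion -/

/-- The number of matrices `x` with rows indexed by `σ` such that `x̄ᵗ x = T`. -/
def repNum {R : Type*} [CommRing R] [StarRing R] (σ : Type*) [Fintype σ] {ι : Type*}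
    (T : Matrix ι ι R) : ℕ :=
  Nat.card {x : Matrix σ ι R // xᴴ * x = T}

section Congruence

variable {R : Type*} [CommRing R] [StarRing R] {p l : ℕ} {σ : Type*} [Fintype σ]
  {ι : Type*} [Fintype ι]

theorem repNum_congr [DecidableEq ι] {T h : Matrix ι ι R} (hh : IsUnit h) :
    repNum σ (hᴴ * T * h) = repNum σ T := by
  obtain ⟨u, rfl⟩ := hh
  have hu : (u : Matrix ι ι R) * (↑u⁻¹ : Matrix ι ι R) = 1 := u.mul_inv
  have hu' : (↑u⁻¹ : Matrix ι ι R) * (u : Matrix ι ι R) = 1 := u.inv_mul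
  refine Nat.card_congr ⟨fun x => ⟨x.1 * (↑u⁻¹ : Matrix ι ι R), ?_⟩,
    fun x => ⟨x.1 * (u : Matrix ι ι R), ?_⟩, fun x => Subtype.ext ?_, fun x => Subtype.ext ?_⟩
  · have hc : (↑u⁻¹ : Matrix ι ι R)ᴴ * (u : Matrix ι ι R)ᴴ = 1 := by
      rw [← conjTranspose_mul, hu, conjTranspose_one]
    rw [conjTranspose_mul, Matrix.mul_assoc, ← Matrix.mul_assoc _ x.1, x.2]
    rw [Matrix.mul_assoc (_ * T), hu, Matrix.mul_one, ← Matrix.mul_assoc, hc, Matrix.one_mul]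
  · rw [conjTranspose_mul, Matrix.mul_assoc, ← Matrix.mul_assoc _ x.1, x.2, Matrix.mul_assoc]
  · change x.1 * _ * _ = x.1
    rw [Matrix.mul_assoc, hu', Matrix.mul_one]
  · change x.1 * _ * _ = x.1
    rw [Matrix.mul_assoc, hu, Matrix.mul_one]

/-- A hermitian matrix sufficiently close to `diag(p^{a_i})` is equivalent to it; the equivalence
is found by successive approximation, each step gaining one power of `p`. -/
theorem exists_congruence [DecidableEq ι] (h : UnramifiedQuotient R p l) {a : ι → ℕ} {k : ℕ}
    (ha : ∀ i, a i < k) {B : Matrix ι ι R}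
    (hB : (diagonal (fun i => (p : R) ^ a i) + (p : R) ^ k • B).IsHermitian) :
    ∃ g : Matrix ι ι R, IsUnit g ∧ gᴴ * diagonal (fun i => (p : R) ^ a i) * g =
      diagonal (fun i => (p : R) ^ a i) + (p : R) ^ k • B := by
  obtain ⟨d, hd⟩ : ∃ d, l ≤ k + d := ⟨l, by omega⟩
  induction d generalizing k B with
  | zero =>
    refine ⟨1, isUnit_one, ?_⟩
    rw [h.pow_eq_zero_of_le (k := k) (by simpa using hd)]
    simp
  | succ d ih =>
    obtain ⟨c, hc, hc2⟩ := h.exists_half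
    set T : Matrix ι ι R := diagonal fun i => (p : R) ^ a i with hT
    have hTs : Tᴴ = T := by
      rw [hT, diagonal_conjTranspose]
      congr 1
      ext i; simp
    have hps : ∀ j : ℕ, star ((p : R) ^ j) = (p : R) ^ j := fun j => by simp
    have hBs : (p : R) ^ k • Bᴴ = (p : R) ^ k • B := by
      have h1 := hB.eq
      rw [conjTranspose_add, hTs, conjTranspose_smul, hps] at h1
      exact add_left_cancel h1
    -- replace `B` by its hermitian part
    obtain ⟨A, hA, hAB⟩ : ∃ A : Matrix ι ι R, Aᴴ = A ∧ (p : R) ^ k • A = (p : R) ^ k • B := by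
      refine ⟨c • (B + Bᴴ), ?_, ?_⟩
      · rw [conjTranspose_smul, hc, conjTranspose_add, conjTranspose_conjTranspose, add_comm]
      · rw [smul_comm, smul_add, hBs, ← two_smul R, smul_smul, mul_comm, hc2, one_smul]
    rw [← hAB] at hB ⊢
    -- `D = p^k T⁻¹`, and `g = 1 + D A / 2` is the first approximation
    set D' : Matrix ι ι R := diagonal fun i => (p : R) ^ (k - a i - 1) with hD'
    set D : Matrix ι ι R := diagonal fun i => (p : R) ^ (k - a i) with hD
    have hDD' : D = (p : R) • D' := by
      rw [hD, hD', ← diagonal_smul]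
      congr 1; ext i
      simp only [Pi.smul_apply, smul_eq_mul]
      rw [← pow_succ']
      congr 1
      have := ha i
      omega
    have hDs : Dᴴ = D := by
      rw [hD, diagonal_conjTranspose]
      congr 1
      ext i; simp
    have hTD : T * D = (p : R) ^ k • (1 : Matrix ι ι R) := by
      rw [hT, hD, diagonal_mul_diagonal, smul_one_eq_diagonal]
      congr 1; ext i
      rw [← pow_add, Nat.add_sub_cancel' (ha i).le]
    have hDT : D * T = (p : R) ^ k • (1 : Matrix ι ι R) := by
      rw [← hTD, hT, hD, diagonal_mul_diagonal, diagonal_mul_diagonal]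
      congr 1; ext i; ring
    set g : Matrix ι ι R := 1 + c • (D * A) with hg
    have hgs : gᴴ = 1 + c • (A * D) := by
      rw [hg, conjTranspose_add, conjTranspose_one, conjTranspose_smul, hc, conjTranspose_mul,
        hA, hDs]
    have hgu : IsUnit g := by
      refine IsNilpotent.isUnit_one_add ⟨l, ?_⟩
      rw [hDD', smul_mul_assoc, smul_comm, _root_.smul_pow, h.pow_eq_zero, zero_smul]
    set E : Matrix ι ι R := (c * c) • (A * D' * A) with hE
    have key : gᴴ * T * g = T + (p : R) ^ k • A + (p : R) ^ (k + 1) • E := by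
      have e1 : gᴴ * T * g = T + c • (A * (D * T)) + c • (T * D * A) +
          (c * c) • (A * (D * T) * D * A) := by
        rw [hgs, hg]
        simp only [Matrix.add_mul, Matrix.mul_add, Matrix.one_mul, Matrix.mul_one,
          Matrix.smul_mul, Matrix.mul_smul, Matrix.mul_assoc, smul_add, smul_smul]
        abel
      rw [e1, hDT, hTD, hDD', hE]
      simp only [Matrix.smul_mul, Matrix.mul_smul, Matrix.one_mul, Matrix.mul_one, smul_smul]
      have e2 : T + (c * (p : R) ^ k) • A + (c * (p : R) ^ k) • A = T + (p : R) ^ k • A := by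
        rw [add_assoc, ← add_smul]
        congr 2
        linear_combination (p : R) ^ k * hc2
      rw [e2, ← pow_succ']
      congr 2
      ring
    obtain ⟨u, hu⟩ := hgu
    set v : Matrix ι ι R := (↑u⁻¹ : Matrix ι ι R) with hv
    have hgv : g * v = 1 := by rw [← hu]; exact u.mul_inv
    have hvg : v * g = 1 := by rw [← hu]; exact u.inv_mul
    have hvg' : vᴴ * gᴴ = 1 := by rw [← conjTranspose_mul, hgv, conjTranspose_one]
    have hgv' : gᴴ * vᴴ = 1 := by rw [← conjTranspose_mul, hvg, conjTranspose_one]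
    have hback : vᴴ * (T + (p : R) ^ k • A) * v = T + (p : R) ^ (k + 1) • -(vᴴ * E * v) := by
      have e3 : T + (p : R) ^ k • A = gᴴ * T * g - (p : R) ^ (k + 1) • E := by rw [key]; abel
      rw [e3, Matrix.mul_sub, Matrix.sub_mul, Matrix.mul_smul, Matrix.smul_mul, smul_neg,
        ← sub_eq_add_neg]
      congr 1
      rw [Matrix.mul_assoc, Matrix.mul_assoc, hgv, Matrix.mul_one, ← Matrix.mul_assoc, hvg',
        Matrix.one_mul]
    obtain ⟨w, hw, hwT⟩ := ih (k := k + 1) (B := -(vᴴ * E * v))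
      (fun i => (ha i).trans (Nat.lt_succ_self k)) (by
        rw [← hback]
        exact isHermitian_conjTranspose_mul_mul _ hB) (by omega)
    refine ⟨w * g, hw.mul ⟨u, hu⟩, ?_⟩
    rw [← hback] at hwT
    calc (w * g)ᴴ * T * (w * g) = gᴴ * (wᴴ * T * w) * g := by
          rw [conjTranspose_mul]; simp only [Matrix.mul_assoc]
      _ = (gᴴ * vᴴ) * (T + (p : R) ^ k • A) * (v * g) := by
          rw [hwT]; simp only [Matrix.mul_assoc]
      _ = T + (p : R) ^ k • A := by rw [hgv', hvg, Matrix.one_mul, Matrix.mul_one]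

/-- The number of representations is locally constant near `diag(p^{a_i})`. -/
theorem repNum_eq_of_close [DecidableEq ι] (h : UnramifiedQuotient R p l) {a : ι → ℕ} {k : ℕ}
    (ha : ∀ i, a i < k) {T : Matrix ι ι R} (hT : T.IsHermitian)
    (hTa : ∀ i j, (p : R) ^ k ∣ (T - diagonal (fun i => (p : R) ^ a i)) i j) :
    repNum σ T = repNum σ (diagonal (fun i => (p : R) ^ a i)) := by
  choose B hB using hTa
  have e : T = diagonal (fun i => (p : R) ^ a i) + (p : R) ^ k • (of B) := by
    ext i j
    have := hB i j
    rw [Matrix.sub_apply] at this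
    rw [Matrix.add_apply, Matrix.smul_apply, of_apply, smul_eq_mul]
    linear_combination this
  rw [e] at hT
  obtain ⟨g, hg, hgT⟩ := exists_congruence h ha hT
  rw [e, ← hgT, repNum_congr hg]

theorem trace_mul_conjTranspose_mul (Y : Matrix ι ι R) (x : Matrix σ ι R) :
    (Y * (xᴴ * x)).trace = ∑ i, x i ⬝ᵥ Y *ᵥ star (x i) := by
  rw [← Matrix.mul_assoc, trace_mul_comm, ← Matrix.mul_assoc]
  refine Finset.sum_congr rfl fun i _ => ?_
  rw [diag_apply, Matrix.mul_assoc, mul_apply_eq_vecMul, dotProduct]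
  rfl

end Congruence

section Fourier

variable {R : Type*} [CommRing R] [StarRing R] [Fintype R] {p l : ℕ} {Ψ : AddChar R ℂ}
  {σ : Type*} [Fintype σ] {ι : Type*} [Fintype ι]

theorem sum_char_trace_mul (h : UnramifiedQuotient R p l) (hs : ∀ x, Ψ (star x) = Ψ x)
    (hΨ : Ψ.IsPrimitive) {Z : Matrix ι ι R} (hZ : Zᴴ = Z) :
    ∑ Y : selfAdjoint (Matrix ι ι R), Ψ ((Y : Matrix ι ι R) * Z).trace =
      if Z = 0 then (p : ℂ) ^ (l * Fintype.card ι ^ 2) else 0 := by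
  let f : selfAdjoint (Matrix ι ι R) →+ R :=
    { toFun := fun Y => ((Y : Matrix ι ι R) * Z).trace
      map_zero' := by simp
      map_add' := fun Y Y' => by simp [Matrix.add_mul] }
  have h1 := sum_char_comp (Ψ := Ψ) f
  rw [h.card_selfAdjoint_matrix ι] at h1
  push_cast at h1
  refine h1.trans (if_congr ⟨fun h2 => ?_, fun h2 Y => ?_⟩ rfl rfl)
  · obtain ⟨c, hc, hc2⟩ := h.exists_half
    by_contra hne
    obtain ⟨i, j, hij⟩ : ∃ i j, Z i j ≠ 0 := by
      by_contra hcon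
      push Not at hcon
      exact hne (by ext i j; exact hcon i j)
    refine hΨ hij ?_
    ext r
    rw [AddChar.mulShift_apply, AddChar.one_apply]
    -- the hermitian matrix supported at the places `(i, j)` and `(j, i)`
    have hY : (single j i (c * r) + (single j i (c * r))ᴴ : Matrix ι ι R) ∈
        selfAdjoint (Matrix ι ι R) := by
      change star _ = _
      rw [star_eq_conjTranspose, conjTranspose_add, conjTranspose_conjTranspose, add_comm]
    have h3 := h2 ⟨_, hY⟩
    have e : f ⟨_, hY⟩ = c * (Z i j * r) + star (c * (Z i j * r)) := by
      change ((single j i (c * r) + (single j i (c * r))ᴴ) * Z).trace = _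
      rw [Matrix.add_mul, trace_add, conjTranspose_single, trace_single_mul, trace_single_mul,
        ← congrFun (congrFun hZ j) i, conjTranspose_apply]
      simp only [smul_eq_mul, star_mul', hc]
      ring
    rw [e, AddChar.map_add_eq_mul, hs, ← AddChar.map_add_eq_mul] at h3
    rw [← h3]
    congr 1
    linear_combination -(Z i j * r) * hc2
  · change Ψ ((Y : Matrix ι ι R) * Z).trace = 1
    rw [h2]; simp

theorem sum_char_mul_selfAdjoint (h : UnramifiedQuotient R p l) (hs : ∀ x, Ψ (star x) = Ψ x)
    (hΨ : Ψ.IsPrimitive) {z : R} (hz : star z = z) :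
    ∑ t : selfAdjoint R, Ψ (t * z) = if z = 0 then (p : ℂ) ^ l else 0 := by
  have h1 := sum_char_comp (Ψ := Ψ) ((AddMonoidHom.mulRight z).comp (selfAdjoint R).subtype)
  rw [h.card_selfAdjoint] at h1
  push_cast at h1
  refine h1.trans (if_congr ⟨fun h2 => ?_, fun h2 t => ?_⟩ rfl rfl)
  · obtain ⟨c, hc, hc2⟩ := h.exists_half
    by_contra hne
    refine hΨ hne ?_
    ext r
    rw [AddChar.mulShift_apply, AddChar.one_apply]
    have h3 := h2 ⟨c * r + star (c * r), by
      change star _ = _; rw [star_add, star_star, add_comm]⟩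
    have e : (c * r + star (c * r)) * z = c * (z * r) + star (c * (z * r)) := by
      simp only [star_mul', hc, hz]; ring
    change Ψ ((c * r + star (c * r)) * z) = 1 at h3
    rw [e, AddChar.map_add_eq_mul, hs, ← AddChar.map_add_eq_mul] at h3
    rw [← h3]
    congr 1
    linear_combination -(z * r) * hc2
  · change Ψ (t * z) = 1
    rw [h2]; simp

theorem sum_char_trace_eq_pow (Y : Matrix ι ι R) :
    ∑ x : Matrix σ ι R, Ψ (Y * (xᴴ * x)).trace = hermGauss Ψ Y ^ Fintype.card σ := by
  have h1 : ∀ x : Matrix σ ι R, Ψ (Y * (xᴴ * x)).trace =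
      ∏ i, Ψ (x i ⬝ᵥ Y *ᵥ star (x i)) := fun x => by
    rw [trace_mul_conjTranspose_mul, map_sum_eq_prod]
  simp_rw [h1]
  have h2 := Finset.prod_univ_sum (fun _ : σ => (Finset.univ : Finset (ι → R)))
    (fun _ y => Ψ (y ⬝ᵥ Y *ᵥ star y))
  rw [Fintype.piFinset_univ, Finset.prod_const, Finset.card_univ] at h2
  exact h2.symm

/-- Detection of the equation `x̄ᵗ x = T` by characters, for `x` in any given set. -/
theorem card_filter_conjTranspose_mul (h : UnramifiedQuotient R p l)
    (hs : ∀ x, Ψ (star x) = Ψ x) (hΨ : Ψ.IsPrimitive) {T : Matrix ι ι R} (hT : Tᴴ = T)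
    (S : Finset (Matrix σ ι R)) :
    (p : ℂ) ^ (l * Fintype.card ι ^ 2) * ((S.filter fun x => xᴴ * x = T).card : ℂ) =
      ∑ Y : selfAdjoint (Matrix ι ι R), Ψ (-((Y : Matrix ι ι R) * T).trace) *
        ∑ x ∈ S, Ψ ((Y : Matrix ι ι R) * (xᴴ * x)).trace := by
  simp_rw [Finset.mul_sum]
  rw [Finset.sum_comm, Finset.card_filter]
  push_cast
  rw [Finset.mul_sum]
  refine Finset.sum_congr rfl fun x _ => ?_
  have h1 := sum_char_trace_mul h hs hΨ (Z := xᴴ * x - T) (by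
    rw [conjTranspose_sub, hT, conjTranspose_mul, conjTranspose_conjTranspose])
  rw [mul_ite, mul_one, mul_zero, if_congr (sub_eq_zero (a := xᴴ * x) (b := T)).symm rfl rfl, ← h1]
  refine Finset.sum_congr rfl fun Y _ => ?_
  rw [← AddChar.map_add_eq_mul, Matrix.mul_sub, trace_sub]
  congr 1; ring

theorem repNum_eq_card_filter (T : Matrix ι ι R) :
    repNum σ T = (Finset.univ.filter fun x : Matrix σ ι R => xᴴ * x = T).card := by
  rw [repNum, Nat.card_eq_fintype_card, Fintype.card_subtype]

theorem repNum_fourier (h : UnramifiedQuotient R p l) (hs : ∀ x, Ψ (star x) = Ψ x)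
    (hΨ : Ψ.IsPrimitive) {T : Matrix ι ι R} (hT : Tᴴ = T) :
    (p : ℂ) ^ (l * Fintype.card ι ^ 2) * (repNum σ T : ℂ) =
      ∑ Y : selfAdjoint (Matrix ι ι R), Ψ (-((Y : Matrix ι ι R) * T).trace) *
        hermGauss Ψ (Y : Matrix ι ι R) ^ Fintype.card σ := by
  rw [repNum_eq_card_filter, card_filter_conjTranspose_mul h hs hΨ hT]
  simp_rw [sum_char_trace_eq_pow]

/-- The normalised number of representations by the unit form of rank `s` is a polynomial in
`(-p)^{-s}`, because every Gauss sum is a power of `-p`. -/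
theorem exists_polynomial_repNum (h : UnramifiedQuotient R p l) {T : Matrix ι ι R}
    (hT : Tᴴ = T) : ∃ P : ℂ[X], ∀ s : ℕ,
    (p : ℂ) ^ (l * Fintype.card ι ^ 2) * (repNum (Fin s) T : ℂ) =
      (p : ℂ) ^ (2 * l * Fintype.card ι * s) * P.eval ((-(p : ℂ))⁻¹ ^ s) := by
  obtain ⟨Ψ, hs, hΨ⟩ := h.exists_character
  choose c hc hg _ using fun Y : selfAdjoint (Matrix ι ι R) =>
    exists_hermGauss_eq h hs hΨ (Y := (Y : Matrix ι ι R)) Y.2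
  refine ⟨∑ Y : selfAdjoint (Matrix ι ι R), C (Ψ (-((Y : Matrix ι ι R) * T).trace)) *
    Polynomial.X ^ (2 * l * Fintype.card ι - c Y), fun s => ?_⟩
  rw [repNum_fourier h hs hΨ hT, eval_finsetSum, Finset.mul_sum]
  refine Finset.sum_congr rfl fun Y _ => ?_
  rw [hg, Fintype.card_fin, eval_mul, eval_C, eval_pow, eval_X]
  have hp0 : (-(p : ℂ)) ≠ 0 := neg_ne_zero.2 (Nat.cast_ne_zero.2 h.prime.ne_zero)
  have e : (-(p : ℂ)) ^ c Y = (p : ℂ) ^ (2 * l * Fintype.card ι) *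
      (-(p : ℂ))⁻¹ ^ (2 * l * Fintype.card ι - c Y) := by
    have e1 : (p : ℂ) ^ (2 * l * Fintype.card ι) = (-(p : ℂ)) ^ (2 * l * Fintype.card ι) := by
      rw [mul_assoc, pow_mul, pow_mul (-(p : ℂ)), neg_sq]
    rw [e1, inv_pow, pow_sub₀ _ hp0 (hc Y)]
    field_simp
  rw [e, mul_pow, ← pow_mul, ← pow_mul, ← pow_mul, mul_comm s]
  ring

end Fourier

/-! ### Adjoining one vector -/

section Adjoin

variable {R : Type*} [CommRing R] [StarRing R] {p l : ℕ} {σ : Type*} [Fintype σ] {ι : Type*}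

/-- The Gram matrix of a system of vectors with Gram matrix `T` together with one more vector,
where `y` holds the products with the old vectors and `τ` is the norm of the new one. -/
def adjoinGram (T : Matrix ι ι R) (y : ι → R) (τ : R) : Matrix (Option ι) (Option ι) R :=
  of fun i j => match i, j with
    | some i, some j => T i j
    | some i, none => y i
    | none, some j => star (y j)
    | none, none => τ

theorem adjoinGram_diagonal [DecidableEq ι] [DecidableEq (Option ι)] (d : Option ι → R) :
    adjoinGram (diagonal fun i => d (some i)) 0 (d none) = diagonal d := by
  ext i j
  rcases i with _ | i <;> rcases j with _ | j <;> simp [adjoinGram, diagonal_apply]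

theorem adjoinGram_isHermitian {T : Matrix ι ι R} (hT : T.IsHermitian) {τ : R}
    (hτ : star τ = τ) (y : ι → R) : (adjoinGram T y τ).IsHermitian := by
  ext i j
  rcases i with _ | i <;> rcases j with _ | j <;> simp [adjoinGram, hτ, hT.apply]

/-- Splitting off the last vector of a system. -/
def splitLast (σ ι R : Type*) : Matrix σ (Option ι) R ≃ Matrix σ ι R × (σ → R) where
  toFun x := (of fun i j => x i (some j), fun i => x i none)
  invFun q := of fun i j => j.elim (q.2 i) (q.1 i)
  left_inv x := by
    ext i j
    rcases j with _ | j <;> rfl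
  right_inv q := rfl

theorem conjTranspose_mul_eq_adjoinGram_iff (x : Matrix σ (Option ι) R) (T : Matrix ι ι R)
    (y : ι → R) (τ : R) :
    xᴴ * x = adjoinGram T y τ ↔ ((splitLast σ ι R x).1ᴴ * (splitLast σ ι R x).1 = T ∧
      (splitLast σ ι R x).1ᴴ *ᵥ (splitLast σ ι R x).2 = y ∧
      star (splitLast σ ι R x).2 ⬝ᵥ (splitLast σ ι R x).2 = τ) := by
  constructor
  · intro h
    refine ⟨?_, ?_, ?_⟩
    · ext i j
      exact congrFun (congrFun h (some i)) (some j)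
    · ext i
      exact congrFun (congrFun h (some i)) none
    · exact congrFun (congrFun h none) none
  · rintro ⟨h1, h2, h3⟩
    ext i j
    rcases i with _ | i <;> rcases j with _ | j
    · exact h3
    · change _ = star (y j)
      rw [← h2]
      simp only [mul_apply, mulVec, dotProduct, conjTranspose_apply, star_sum, star_mul', star_star]
      exact Finset.sum_congr rfl fun _ _ => mul_comm _ _
    · exact congrFun h2 i
    · exact congrFun (congrFun h1 i) j

variable [Fintype R] [Fintype ι]

theorem repNum_adjoinGram_eq_card (T : Matrix ι ι R) (y : ι → R) (τ : R) :
    repNum σ (adjoinGram T y τ) = ∑ q : Matrix σ ι R × (σ → R),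
      if q.1ᴴ * q.1 = T ∧ q.1ᴴ *ᵥ q.2 = y ∧ star q.2 ⬝ᵥ q.2 = τ then 1 else 0 := by
  rw [repNum, Nat.card_congr ((splitLast σ ι R).subtypeEquiv (q := fun q =>
    q.1ᴴ * q.1 = T ∧ q.1ᴴ *ᵥ q.2 = y ∧ star q.2 ⬝ᵥ q.2 = τ) fun x =>
    conjTranspose_mul_eq_adjoinGram_iff x T y τ), Nat.card_eq_fintype_card, Fintype.card_subtype,
    Finset.card_filter]

/-- Systems of vectors counted by first choosing all but the last one. -/
theorem repNum_adjoinGram (T : Matrix ι ι R) (y : ι → R) (τ : R) :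
    repNum σ (adjoinGram T y τ) = ∑ x : Matrix σ ι R with xᴴ * x = T,
      (Finset.univ.filter fun v : σ → R => xᴴ *ᵥ v = y ∧ star v ⬝ᵥ v = τ).card := by
  rw [repNum_adjoinGram_eq_card, Fintype.sum_prod_type, Finset.sum_filter]
  refine Finset.sum_congr rfl fun x _ => ?_
  rw [Finset.card_filter]
  split_ifs with h
  · simp only [h, true_and]
  · simp only [h, false_and, if_false, Finset.sum_const_zero]

/-- Systems of vectors counted by first choosing the last one. -/
theorem repNum_adjoinGram' (T : Matrix ι ι R) (y : ι → R) (τ : R) :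
    repNum σ (adjoinGram T y τ) = ∑ v : σ → R with star v ⬝ᵥ v = τ,
      (Finset.univ.filter fun x : Matrix σ ι R => xᴴ *ᵥ v = y ∧ xᴴ * x = T).card := by
  rw [repNum_adjoinGram_eq_card, Fintype.sum_prod_type_right, Finset.sum_filter]
  refine Finset.sum_congr rfl fun v _ => ?_
  rw [Finset.card_filter]
  split_ifs with h
  · refine Finset.sum_congr rfl fun x _ => if_congr ?_ rfl rfl
    tauto
  · simp only [h, and_false, if_false, Finset.sum_const_zero]

end Adjoin

section Fibers

/-- Summation over the image of a homomorphism. -/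
theorem sum_comp_eq_card_ker_mul {A B : Type*} [AddCommGroup A] [AddCommGroup B] [Fintype A]
    [Fintype B] {K : Type*} [CommSemiring K] (f : A →+ B) (G : B → K) :
    ∑ x, G (f x) = (Nat.card {x : A // f x = 0} : K) * ∑ b with b ∈ f.range, G b := by
  rw [← Finset.sum_fiberwise Finset.univ f, Finset.sum_filter, Finset.mul_sum]
  refine Finset.sum_congr rfl fun b _ => ?_
  rw [Finset.sum_congr rfl (g := fun _ => G b) (fun x hx => by rw [(Finset.mem_filter.1 hx).2]),
    Finset.sum_const, nsmul_eq_mul]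
  split_ifs with hb
  · congr 2
    obtain ⟨x₀, hx₀⟩ := hb
    rw [← Fintype.card_subtype, ← Nat.card_eq_fintype_card]
    refine Nat.card_congr ⟨fun x => ⟨x.1 - x₀, by rw [map_sub, hx₀, x.2, sub_self]⟩,
      fun x => ⟨x.1 + x₀, by rw [map_add, hx₀, x.2, zero_add]⟩, fun x => ?_, fun x => ?_⟩
    · simp
    · simp
  · rw [Finset.filter_eq_empty_iff.2 (fun x _ hx => hb ⟨x, hx⟩)]
    simp

variable {R : Type*} [CommRing R] [StarRing R] {p l : ℕ}

theorem UnramifiedQuotient.card_vec_pow_mul_eq_zero (h : UnramifiedQuotient R p l) {j : ℕ}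
    (hj : j ≤ l) (κ : Type*) [Fintype κ] :
    Nat.card {v : κ → R // (p : R) ^ j • v = 0} = p ^ (2 * j * Fintype.card κ) := by
  have := h.finite
  have e : {v : κ → R // (p : R) ^ j • v = 0} ≃ (κ → {x : R // (p : R) ^ j * x = 0}) :=
    (Equiv.subtypeEquivRight fun v => by rw [funext_iff]; rfl).trans Equiv.subtypePiEquivPi
  rw [Nat.card_congr e, Nat.card_fun, h.card_pow_mul_eq_zero hj, Nat.card_eq_fintype_card,
    ← pow_mul]

/-- Summation over the multiples of `t = p^j u`, which are the vectors annihilated by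
`p^(l-j)`. -/
theorem sum_comp_smul (h : UnramifiedQuotient R p l) [Fintype R] {j : ℕ} (hj : j ≤ l) {u t : R}
    (hu : IsUnit u) (ht : t = (p : R) ^ j * u) {κ : Type*} [Fintype κ] (G : (κ → R) → ℂ) :
    ∑ w : κ → R, G (t • w) =
      (p : ℂ) ^ (2 * j * Fintype.card κ) * ∑ v with (p : R) ^ (l - j) • v = 0, G v := by
  have h1 := sum_comp_eq_card_ker_mul (AddMonoidHom.mk' (fun w : κ → R => t • w)
    (fun a b => smul_add t a b)) G
  obtain ⟨u', hu'⟩ := hu.exists_left_inv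
  have h2 : Nat.card {x : κ → R // AddMonoidHom.mk' (fun w : κ → R => t • w)
      (fun a b => smul_add t a b) x = 0} = p ^ (2 * j * Fintype.card κ) := by
    rw [← h.card_vec_pow_mul_eq_zero hj κ]
    refine Nat.card_congr (Equiv.subtypeEquivRight fun v => ?_)
    change t • v = 0 ↔ _
    rw [ht, mul_comm, mul_smul]
    constructor
    · intro h0
      have := congrArg (fun w => u' • w) h0
      simpa only [smul_smul u', hu', one_smul, smul_zero] using this
    · intro h0; rw [h0, smul_zero]
  rw [h2] at h1
  push_cast at h1
  refine h1.trans ?_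
  congr 2
  ext v
  simp only [Finset.mem_filter, Finset.mem_univ, true_and]
  constructor
  · rintro ⟨w, rfl⟩
    change (p : R) ^ (l - j) • t • w = 0
    rw [ht, smul_smul, ← mul_assoc, ← pow_add, Nat.sub_add_cancel hj, h.pow_eq_zero, zero_mul,
      zero_smul]
  · intro h0
    have h3 : ∀ i, ∃ z, v i = (p : R) ^ j * z := fun i => by
      have h4 : (p : R) ^ (l - j) * v i = 0 := congrFun h0 i
      rw [h.pow_mul_eq_zero_iff _ (Nat.sub_le l j), Nat.sub_sub_self hj] at h4
      exact h4
    choose z hz using h3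
    refine ⟨u' • z, ?_⟩
    change t • u' • z = v
    ext i
    rw [ht, hz i]
    simp only [Pi.smul_apply, smul_eq_mul]
    linear_combination (p : R) ^ j * z i * hu'

theorem UnramifiedQuotient.card_selfAdjoint_pow_smul_eq_zero_sq (h : UnramifiedQuotient R p l)
    {M : Type*} [AddCommGroup M] [StarAddMonoid M] [Module R M] [StarModule R M] (j : ℕ) :
    Nat.card {t : selfAdjoint M // (p : R) ^ j • (t : M) = 0} ^ 2 =
      Nat.card {x : M // (p : R) ^ j • x = 0} := by
  let N : Submodule R M := LinearMap.ker (LinearMap.lsmul R M ((p : R) ^ j))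
  have hN : ∀ x : N, star (x : M) ∈ N := fun x => by
    have hx : (p : R) ^ j • x.1 = 0 := x.2
    have h1 := congrArg star hx
    change (p : R) ^ j • star x.1 = 0
    simpa using h1
  let _ : StarAddMonoid N :=
    { star := fun x => ⟨star x.1, hN x⟩
      star_involutive := fun x => Subtype.ext (star_star _)
      star_add := fun x y => Subtype.ext (star_add _ _) }
  have : StarModule R N := ⟨fun r x => Subtype.ext (star_smul r x.1)⟩
  have h1 := h.card_selfAdjoint_sq (M := N)
  have h2 : Nat.card {x : M // (p : R) ^ j • x = 0} = Nat.card N := rfl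
  rw [h2, ← h1]
  congr 1
  exact Nat.card_congr ⟨fun t => ⟨⟨t.1.1, t.2⟩, Subtype.ext t.1.2⟩,
    fun t => ⟨⟨t.1.1, congrArg Subtype.val t.2⟩, t.1.2⟩, fun t => rfl, fun t => rfl⟩

/-- The number of self-adjoint elements annihilated by `p^j`. -/
theorem UnramifiedQuotient.card_selfAdjoint_pow_mul_eq_zero (h : UnramifiedQuotient R p l)
    {j : ℕ} (hj : j ≤ l) :
    Nat.card {t : selfAdjoint R // (p : R) ^ j * (t : R) = 0} = p ^ j := by
  have h1 := h.card_selfAdjoint_pow_smul_eq_zero_sq (M := R) j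
  simp only [smul_eq_mul] at h1
  rw [h.card_pow_mul_eq_zero hj, mul_comm 2, pow_mul] at h1
  exact Nat.pow_left_injective two_ne_zero h1

theorem UnramifiedQuotient.card_matrix_pow_smul_eq_zero (h : UnramifiedQuotient R p l)
    {j : ℕ} (hj : j ≤ l) (σ ι : Type*) [Fintype σ] [Fintype ι] :
    Nat.card {x : Matrix σ ι R // (p : R) ^ j • x = 0} =
      p ^ (2 * j * (Fintype.card σ * Fintype.card ι)) := by
  have := h.finite
  have e : {x : Matrix σ ι R // (p : R) ^ j • x = 0} ≃
      (σ → {v : ι → R // (p : R) ^ j • v = 0}) :=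
    (Equiv.subtypeEquivRight (q := fun x : σ → ι → R => ∀ i, (p : R) ^ j • x i = 0) fun _ =>
      ⟨fun h0 i => congrFun h0 i, fun h0 => funext h0⟩).trans
      (Equiv.subtypePiEquivPi (p := fun _ (v : ι → R) => (p : R) ^ j • v = 0))
  rw [Nat.card_congr e, Nat.card_fun, h.card_vec_pow_mul_eq_zero hj, Nat.card_eq_fintype_card,
    ← pow_mul]
  congr 1
  ring

/-- The number of hermitian matrices annihilated by `p^j`. -/
theorem UnramifiedQuotient.card_selfAdjoint_matrix_pow_smul_eq_zero
    (h : UnramifiedQuotient R p l) {j : ℕ} (hj : j ≤ l) (ι : Type*) [Fintype ι] :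
    Nat.card {V : selfAdjoint (Matrix ι ι R) // (p : R) ^ j • (V : Matrix ι ι R) = 0} =
      p ^ (j * Fintype.card ι ^ 2) := by
  have h1 := h.card_selfAdjoint_pow_smul_eq_zero_sq (M := Matrix ι ι R) j
  rw [h.card_matrix_pow_smul_eq_zero hj, show 2 * j * (Fintype.card ι * Fintype.card ι) =
    (j * Fintype.card ι ^ 2) * 2 by ring, pow_mul] at h1
  exact Nat.pow_left_injective two_ne_zero h1

end Fibers

/-! ### The variation of representation numbers with the last exponent -/

section LastExponent

variable {R : Type*} [CommRing R] [StarRing R] {p l : ℕ} {Ψ : AddChar R ℂ}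
  {σ : Type*} [Fintype σ] {ι : Type*} [Fintype ι]

/-- Completing the square in the direction of `x c`. -/
theorem norm_add_mulVec {T : Matrix ι ι R} {x : Matrix σ ι R} (hx : xᴴ * x = T) (v : σ → R)
    (c : ι → R) : star (v + x *ᵥ c) ⬝ᵥ (v + x *ᵥ c) =
      star v ⬝ᵥ v + star c ⬝ᵥ (xᴴ *ᵥ v) + star (star c ⬝ᵥ (xᴴ *ᵥ v)) +
        star c ⬝ᵥ (T *ᵥ c) := by
  have e1 : star (x *ᵥ c) ⬝ᵥ v = star c ⬝ᵥ (xᴴ *ᵥ v) := by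
    rw [star_mulVec, ← dotProduct_mulVec]
  have e2 : star v ⬝ᵥ (x *ᵥ c) = star (star c ⬝ᵥ (xᴴ *ᵥ v)) := by
    rw [← e1, ← star_dotProduct]
  have e3 : star (x *ᵥ c) ⬝ᵥ (x *ᵥ c) = star c ⬝ᵥ (T *ᵥ c) := by
    rw [star_mulVec, ← dotProduct_mulVec, mulVec_mulVec, hx]
  rw [star_add, add_dotProduct, dotProduct_add, dotProduct_add, e1, e2, e3]
  ring

variable [Fintype R]

theorem sum_char_norm (h : UnramifiedQuotient R p l) (hs : ∀ x, Ψ (star x) = Ψ x)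
    (hΨ : Ψ.IsPrimitive) {j : ℕ} (hj : j ≤ l) {t u : R} (hts : star t = t) (hu : IsUnit u)
    (ht : t = (p : R) ^ j * u) :
    ∑ v : σ → R, Ψ (t * (star v ⬝ᵥ v)) = (-(p : ℂ)) ^ ((l + j) * Fintype.card σ) := by
  have h1 := hermGauss_diagonal (ι := σ) h hs hΨ (d := fun _ => t) (fun _ => hts)
    (b := fun _ => j) (fun _ => hj) (fun _ => ⟨u, hu, ht⟩)
  rw [Finset.sum_const, Finset.card_univ, smul_eq_mul, mul_comm (Fintype.card σ), ← add_mul] at h1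
  rw [← h1, hermGauss]
  refine Finset.sum_congr rfl fun v _ => ?_
  congr 1
  simp only [dotProduct, mulVec_diagonal, Finset.mul_sum, Pi.star_apply]
  exact Finset.sum_congr rfl fun _ _ => by ring

/-- The Gauss sum over the orthogonal complement of a system `x` of vectors with Gram matrix
`diag(p^{a_i})`. When the denominator `p^(l-j)` of the character is divisible by all `p^{a_i}`,
the vectors whose products with `x` are divisible by `p^(l-j)` split into the span of `x` and its
orthogonal complement, so that the sum does not depend on `x`. -/
theorem sum_char_norm_orthogonal (h : UnramifiedQuotient R p l) (hs : ∀ x, Ψ (star x) = Ψ x)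
    (hΨ : Ψ.IsPrimitive) {a : ι → ℕ} {j k : ℕ} (hjk : j + k = l) (ha : ∀ i, a i ≤ k)
    {t u : R} (hts : star t = t) (hu : IsUnit u) (ht : t = (p : R) ^ j * u)
    {x : Matrix σ ι R} (hx : xᴴ * x = diagonal fun i => (p : R) ^ a i) :
    (p : ℂ) ^ (2 * (l + j) * Fintype.card ι) *
        ∑ v : σ → R with xᴴ *ᵥ v = 0, Ψ (t * (star v ⬝ᵥ v)) =
      (-(p : ℂ)) ^ ((l + j) * (Fintype.card σ + Fintype.card ι) + ∑ i, a i) := by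
  set r := Fintype.card ι with hr
  set S := ∑ v : σ → R with xᴴ *ᵥ v = 0, Ψ (t * (star v ⬝ᵥ v)) with hS
  have htk : t * (p : R) ^ k = 0 := by
    rw [ht, mul_right_comm, ← pow_add, hjk, h.pow_eq_zero, zero_mul]
  have hcard : (Nat.card R : ℂ) ^ r = (p : ℂ) ^ (2 * l * r) := by
    rw [h.card_eq, pow_mul _ (2 * l) r]; push_cast; rfl
  -- translating `v` by a vector in the span of `x`
  have hA : ∀ w : ι → R, ∑ v : σ → R,
      (if xᴴ *ᵥ v - (p : R) ^ k • w = 0 then Ψ (t * (star v ⬝ᵥ v)) else 0) = S := by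
    intro w
    set c : ι → R := fun i => (p : R) ^ (k - a i) * w i with hc
    have hTc : (diagonal fun i => (p : R) ^ a i) *ᵥ c = (p : R) ^ k • w := by
      ext i
      rw [mulVec_diagonal, hc, Pi.smul_apply, smul_eq_mul, ← mul_assoc, ← pow_add,
        Nat.add_sub_cancel' (ha i)]
    rw [hS, Finset.sum_filter]
    refine (Fintype.sum_equiv (Equiv.addRight (x *ᵥ c)) _ _ fun v => ?_).symm
    have e1 : xᴴ *ᵥ (v + x *ᵥ c) - (p : R) ^ k • w = xᴴ *ᵥ v := by
      rw [mulVec_add, mulVec_mulVec, hx, hTc, add_sub_cancel_right]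
    rw [Equiv.coe_addRight, e1]
    split_ifs with h0
    · rw [norm_add_mulVec hx, h0, hTc, dotProduct_zero, star_zero, add_zero, add_zero, mul_add,
        dotProduct_smul, smul_eq_mul, ← mul_assoc t, htk, zero_mul, add_zero]
    · rfl
  -- detecting the congruence by characters
  have hB : (p : ℂ) ^ (2 * l * r) * S = ∑ c : ι → R with (p : R) ^ k • c = 0,
      ∑ v : σ → R, Ψ (t * (star v ⬝ᵥ v)) * Ψ (c ⬝ᵥ xᴴ *ᵥ v) := by
    have hp0 : (p : ℂ) ^ (2 * l * r) ≠ 0 :=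
      pow_ne_zero _ (Nat.cast_ne_zero.2 h.prime.ne_zero)
    refine mul_left_cancel₀ hp0 ?_
    have e1 : (p : ℂ) ^ (2 * l * r) * S = ∑ w : ι → R, ∑ v : σ → R,
        (if xᴴ *ᵥ v - (p : R) ^ k • w = 0 then Ψ (t * (star v ⬝ᵥ v)) else 0) := by
      rw [Finset.sum_congr rfl fun w _ => hA w, Finset.sum_const, Finset.card_univ, nsmul_eq_mul,
        ← Nat.card_eq_fintype_card, Nat.card_fun, Nat.card_eq_fintype_card (α := ι), ← hr,
        Nat.cast_pow, hcard]
    have e2 : ∀ (w : ι → R) (v : σ → R), (p : ℂ) ^ (2 * l * r) *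
        (if xᴴ *ᵥ v - (p : R) ^ k • w = 0 then Ψ (t * (star v ⬝ᵥ v)) else 0) =
        ∑ c : ι → R, Ψ (w ⬝ᵥ -((p : R) ^ k • c)) *
          (Ψ (t * (star v ⬝ᵥ v)) * Ψ (c ⬝ᵥ xᴴ *ᵥ v)) := by
      intro w v
      have e3 := sum_char_dotProduct hΨ (xᴴ *ᵥ v - (p : R) ^ k • w)
      rw [← hr, hcard] at e3
      have e4 : ∀ c : ι → R, Ψ (w ⬝ᵥ -((p : R) ^ k • c)) *
          (Ψ (t * (star v ⬝ᵥ v)) * Ψ (c ⬝ᵥ xᴴ *ᵥ v)) =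
          Ψ (t * (star v ⬝ᵥ v)) * Ψ (c ⬝ᵥ (xᴴ *ᵥ v - (p : R) ^ k • w)) := by
        intro c
        rw [mul_left_comm, ← AddChar.map_add_eq_mul, dotProduct_sub, dotProduct_neg,
          dotProduct_smul, dotProduct_smul, dotProduct_comm w c, neg_add_eq_sub]
      rw [Finset.sum_congr rfl fun c _ => e4 c, ← Finset.mul_sum, e3]
      split_ifs <;> ring
    rw [e1, Finset.mul_sum, Finset.sum_congr rfl fun w _ => by
      rw [Finset.mul_sum, Finset.sum_congr rfl fun v _ => e2 w v, Finset.sum_comm]]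
    rw [Finset.sum_comm, Finset.sum_filter, Finset.mul_sum]
    refine Finset.sum_congr rfl fun c _ => ?_
    simp_rw [← Finset.mul_sum]
    rw [← Finset.sum_mul, sum_char_dotProduct hΨ, ← hr, hcard]
    rw [if_congr (neg_eq_zero (a := (p : R) ^ k • c)) rfl rfl]
    split_ifs <;> simp
  -- completing the square
  have hC : (p : ℂ) ^ (2 * j * r) * ((p : ℂ) ^ (2 * l * r) * S) =
      (-(p : ℂ)) ^ ((l + j) * Fintype.card σ) * (-(p : ℂ)) ^ (l * r + ∑ i, (j + a i)) := by
    have hkj : l - j = k := by omega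
    have e1 := sum_comp_smul h (j := j) (by omega) (hu.mul h.isUnit_two)
      (show t * 2 = (p : R) ^ j * (u * 2) by rw [ht]; ring) (κ := ι)
      (fun c => ∑ v : σ → R, Ψ (t * (star v ⬝ᵥ v)) * Ψ (c ⬝ᵥ xᴴ *ᵥ v))
    rw [hkj, ← hB, ← hr] at e1
    have e2 : ∑ c : ι → R, ∑ v : σ → R,
        Ψ (t * (star v ⬝ᵥ v)) * Ψ (((t * 2) • star c) ⬝ᵥ xᴴ *ᵥ v) =
        ∑ c : ι → R, ∑ v : σ → R, Ψ (t * (star v ⬝ᵥ v)) *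
          Ψ (((t * 2) • c) ⬝ᵥ xᴴ *ᵥ v) :=
      Fintype.sum_equiv (Equiv.mk star star star_star star_star) _ _ fun c => rfl
    rw [← e1, ← e2]
    have e3 : ∀ (c : ι → R) (v : σ → R),
        Ψ (t * (star v ⬝ᵥ v)) * Ψ (((t * 2) • star c) ⬝ᵥ xᴴ *ᵥ v) =
        Ψ (-(star c ⬝ᵥ (diagonal fun i => t * (p : R) ^ a i) *ᵥ c)) *
          Ψ (t * (star (v + x *ᵥ c) ⬝ᵥ (v + x *ᵥ c))) := by
      intro c v
      have e4 : star c ⬝ᵥ (diagonal fun i => t * (p : R) ^ a i) *ᵥ c =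
          t * (star c ⬝ᵥ (diagonal fun i => (p : R) ^ a i) *ᵥ c) := by
        simp only [dotProduct, mulVec_diagonal, Finset.mul_sum]
        exact Finset.sum_congr rfl fun _ _ => by ring
      rw [norm_add_mulVec hx, e4, smul_dotProduct, smul_eq_mul]
      set q := star c ⬝ᵥ xᴴ *ᵥ v
      have e5 : Ψ (t * 2 * q) = Ψ (t * q + t * star q) := by
        rw [AddChar.map_add_eq_mul, show t * star q = star (t * q) by rw [star_mul', hts], hs,
          ← AddChar.map_add_eq_mul]
        congr 1; ring
      rw [e5, ← AddChar.map_add_eq_mul, ← AddChar.map_add_eq_mul]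
      congr 1; ring
    have e6 : ∀ c : ι → R, ∑ v : σ → R,
        Ψ (t * (star v ⬝ᵥ v)) * Ψ (((t * 2) • star c) ⬝ᵥ xᴴ *ᵥ v) =
        Ψ (-(star c ⬝ᵥ (diagonal fun i => t * (p : R) ^ a i) *ᵥ c)) *
          (-(p : ℂ)) ^ ((l + j) * Fintype.card σ) := by
      intro c
      rw [Finset.sum_congr rfl fun v _ => e3 c v, ← Finset.mul_sum,
        ← sum_char_norm h hs hΨ (by omega) hts hu ht]
      congr 1
      exact Fintype.sum_equiv (Equiv.addRight (x *ᵥ c)) _ _ fun v => rfl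
    rw [Finset.sum_congr rfl fun c _ => e6 c, ← Finset.sum_mul, mul_comm]
    congr 1
    rw [hr, ← hermGauss_diagonal (d := fun i => t * (p : R) ^ a i) h hs hΨ (by simp [hts])
      (fun i => by have := ha i; omega) (fun i => ⟨u, hu, by rw [ht, pow_add]; ring⟩),
      hermGauss_eq_sum_neg h]
    refine Fintype.sum_equiv (Equiv.mk star star star_star star_star) _ _ fun c => ?_
    simp
  rw [Finset.sum_add_distrib, Finset.sum_const, Finset.card_univ, ← hr, smul_eq_mul] at hC
  calc _ = (p : ℂ) ^ (2 * j * r) * ((p : ℂ) ^ (2 * l * r) * S) := by ring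
    _ = _ := by rw [hC]; ring

/-- Orthogonality for the characters attached to the self-adjoint multiples of `p`. -/
theorem sum_char_mul_ite_dvd (h : UnramifiedQuotient R p l) (hs : ∀ x, Ψ (star x) = Ψ x)
    (hΨ : Ψ.IsPrimitive) {z : R} (hz : star z = z) (hpz : (p : R) * z ≠ 0) :
    ∑ t : selfAdjoint R, (if (p : R) ^ (l - 1) * (t : R) = 0 then Ψ (t * z) else 0) = 0 := by
  let A : AddSubgroup (selfAdjoint R) :=
    ((AddMonoidHom.mulLeft ((p : R) ^ (l - 1))).comp (selfAdjoint R).subtype).ker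
  have h1 := sum_char_comp (Ψ := Ψ) (((AddMonoidHom.mulRight z).comp (selfAdjoint R).subtype).comp
    A.subtype)
  rw [if_neg] at h1
  · rw [← Finset.sum_filter, ← h1]
    exact (Finset.sum_subtype _ (fun t => by simp [A, AddMonoidHom.mem_ker]) _)
  · intro h2
    have h3 := sum_char_mul_selfAdjoint h hs hΨ (z := (p : R) * z) (by simp [hz, mul_comm])
    rw [if_neg hpz, Finset.sum_congr rfl (g := fun _ => (1 : ℂ))] at h3
    · rw [Finset.sum_const, Finset.card_univ, nsmul_eq_mul, mul_one] at h3
      exact Fintype.card_ne_zero (Nat.cast_eq_zero.1 h3)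
    · intro t _
      have h4 : (p : R) * (t : R) ∈ selfAdjoint R := by
        change star _ = _
        have := t.2
        have h5 : star (t : R) = t := this
        simp [h5, mul_comm]
      have h6 : (⟨_, h4⟩ : selfAdjoint R) ∈ A := by
        change (p : R) ^ (l - 1) * ((p : R) * t) = 0
        rw [← mul_assoc, ← pow_succ, Nat.sub_add_cancel h.pos, h.pow_eq_zero, zero_mul]
      have h7 := h2 ⟨_, h6⟩
      change Ψ ((p : R) * t * z) = 1 at h7
      rw [← h7]
      congr 1; ring

/-- Passing from the exponent `b` to `b + 1` of the last vector changes the number of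
representations by a multiple of the number of representations of `diag(p^{a_i})`, because the
variation of the number of last vectors is the same for all systems of first vectors. The modulus
`p^(b+2)` is the smallest one that separates the two exponents from each other and from `0`. -/
theorem repNum_adjoin_succ_sub (b : ℕ) (h : UnramifiedQuotient R p (b + 2)) {a : ι → ℕ}
    (ha : ∀ i, a i ≤ b) :
    (p : ℂ) ^ (2 * (b + 3) * Fintype.card ι + 1) *
      ((repNum σ (adjoinGram (diagonal fun i => (p : R) ^ a i) 0 ((p : R) ^ (b + 1))) : ℂ) -
        repNum σ (adjoinGram (diagonal fun i => (p : R) ^ a i) 0 ((p : R) ^ b))) =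
      repNum σ (diagonal fun i => (p : R) ^ a i) *
        ((-(p : ℂ)) ^ ((b + 3) * (Fintype.card σ + Fintype.card ι) + ∑ i, a i) -
          (p : ℂ) ^ (2 * Fintype.card ι) *
            (-(p : ℂ)) ^ ((b + 2) * (Fintype.card σ + Fintype.card ι) + ∑ i, a i)) := by
  obtain ⟨Ψ, hs, hΨ⟩ := h.exists_character
  have hp0 : (p : ℂ) ≠ 0 := Nat.cast_ne_zero.2 h.prime.ne_zero
  have hstar : ∀ j : ℕ, star ((p : R) ^ j) = (p : R) ^ j := fun j => by simp
  have hpb1 : (p : R) ^ (b + 1) ≠ 0 := by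
    intro h0
    have h1 := (h.pow_mul_eq_zero_iff (b + 1) (by omega) 1).1 (by rw [h0, zero_mul])
    rw [show b + 2 - (b + 1) = 1 by omega, pow_one] at h1
    exact h.not_isUnit (isUnit_of_dvd_one h1)
  have hpb : (p : R) ^ b ≠ 0 := fun h0 => hpb1 (by rw [pow_succ, h0, zero_mul])
  set r := Fintype.card ι with hr
  set s := Fintype.card σ with hs'
  set A := ∑ i, a i with hA
  set T : Matrix ι ι R := diagonal fun i => (p : R) ^ a i with hT
  set δ : selfAdjoint R → ℂ := fun t => Ψ (t * -(p : R) ^ (b + 1)) - Ψ (t * -(p : R) ^ b) with hδ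
  -- the variation for a fixed system `x`
  have hx : ∀ x : Matrix σ ι R, xᴴ * x = T →
      (p : ℂ) ^ (2 * (b + 3) * r + 1) *
        (((Finset.univ.filter fun v : σ → R => xᴴ *ᵥ v = 0 ∧
            star v ⬝ᵥ v = (p : R) ^ (b + 1)).card : ℂ) -
          (Finset.univ.filter fun v : σ → R => xᴴ *ᵥ v = 0 ∧
            star v ⬝ᵥ v = (p : R) ^ b).card) =
      (-(p : ℂ)) ^ ((b + 3) * (s + r) + A) -
        (p : ℂ) ^ (2 * r) * (-(p : ℂ)) ^ ((b + 2) * (s + r) + A) := by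
    intro x hx
    set S : R → ℂ := fun t => ∑ v : σ → R with xᴴ *ᵥ v = 0, Ψ (t * (star v ⬝ᵥ v)) with hS
    set S₀ : ℂ := (-(p : ℂ)) ^ ((b + 2) * (s + r) + A) / (p : ℂ) ^ (2 * (b + 2) * r) with hS₀
    set S₁ : ℂ := (-(p : ℂ)) ^ ((b + 3) * (s + r) + A) / (p : ℂ) ^ (2 * (b + 3) * r) with hS₁
    have hdet : ∀ j : ℕ, (p : ℂ) ^ (b + 2) * ((Finset.univ.filter fun v : σ → R =>
        xᴴ *ᵥ v = 0 ∧ star v ⬝ᵥ v = (p : R) ^ j).card : ℂ) =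
        ∑ t : selfAdjoint R, Ψ (t * -(p : R) ^ j) * S t := by
      intro j
      simp_rw [hS, Finset.mul_sum]
      rw [Finset.sum_comm, ← Finset.filter_filter, Finset.card_filter]
      push_cast
      rw [Finset.mul_sum]
      refine Finset.sum_congr rfl fun v _ => ?_
      have h1 := sum_char_mul_selfAdjoint h hs hΨ (z := star v ⬝ᵥ v - (p : R) ^ j) (by
        rw [star_sub, hstar, ← star_dotProduct])
      rw [mul_ite, mul_one, mul_zero, if_congr (sub_eq_zero (a := star v ⬝ᵥ v)).symm rfl rfl, ← h1]
      refine Finset.sum_congr rfl fun t _ => ?_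
      rw [← AddChar.map_add_eq_mul]
      congr 1; ring
    -- if `p²` divides `t`, then `δ t = 0`; otherwise `S t` is independent of `x`
    have hpt : ∀ t : selfAdjoint R, δ t * S t =
        δ t * S₀ + (if (p : R) ^ (b + 2 - 1) * (t : R) = 0 then δ t else 0) * (S₁ - S₀) := by
      intro t
      obtain ⟨j, hj, u, hu, htu⟩ := h.exists_eq_pow_mul (t : R)
      have hcase : ∀ k, j + k = b + 2 → b ≤ k →
          (p : ℂ) ^ (2 * (b + 2 + j) * r) * S t =
            (-(p : ℂ)) ^ ((b + 2 + j) * (s + r) + A) := fun k hjk hk =>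
        sum_char_norm_orthogonal h hs hΨ hjk (fun i => (ha i).trans hk) t.2 hu htu hx
      have hdiv : (p : R) ^ (b + 2 - 1) * (t : R) = 0 ↔ 1 ≤ j := by
        rw [htu, ← mul_assoc, ← pow_add]
        constructor
        · intro h0
          by_contra hj0
          rw [show b + 2 - 1 + j = b + 1 by omega, hu.mul_left_eq_zero] at h0
          exact hpb1 h0
        · intro hj1
          rw [h.pow_eq_zero_of_le (by omega), zero_mul]
      rw [if_congr hdiv rfl rfl]
      rcases Nat.lt_or_ge j 2 with hj2 | hj2
      · interval_cases j
        · have h1 := hcase (b + 2) (by omega) (by omega)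
          have h2 : S t = S₀ := by
            rw [hS₀, eq_div_iff (pow_ne_zero _ hp0), mul_comm]
            exact h1
          rw [h2, if_neg (by omega)]; ring
        · have h1 := hcase (b + 1) (by omega) (by omega)
          have h2 : S t = S₁ := by
            rw [hS₁, eq_div_iff (pow_ne_zero _ hp0), mul_comm]
            exact h1
          rw [h2, if_pos le_rfl]; ring
      · have h0 : δ t = 0 := by
          have h3 : ∀ m, b ≤ m → (t : R) * -(p : R) ^ m = 0 := fun m hm => by
            rw [htu, mul_right_comm, mul_neg, ← pow_add, h.pow_eq_zero_of_le (by omega)]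
            simp
          simp only [hδ]
          rw [h3 _ (Nat.le_succ b), h3 _ le_rfl, sub_self]
        rw [h0]; simp
    have hsum0 : ∑ t, δ t = 0 := by
      rw [hδ, Finset.sum_sub_distrib,
        sum_char_mul_selfAdjoint h hs hΨ (by rw [star_neg, hstar]),
        sum_char_mul_selfAdjoint h hs hΨ (by rw [star_neg, hstar]),
        if_neg (neg_ne_zero.2 hpb1), if_neg (neg_ne_zero.2 hpb), sub_zero]
    have hsum1 : ∑ t : selfAdjoint R,
        (if (p : R) ^ (b + 2 - 1) * (t : R) = 0 then δ t else 0) = (p : ℂ) ^ (b + 1) := by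
      have h1 := sum_char_mul_ite_dvd h hs hΨ (z := -(p : R) ^ b) (by rw [star_neg, hstar]) (by
        rw [mul_neg, ← pow_succ']; exact neg_ne_zero.2 hpb1)
      have h2 : ∑ t : selfAdjoint R, (if (p : R) ^ (b + 2 - 1) * (t : R) = 0 then
          Ψ (t * -(p : R) ^ (b + 1)) else 0) = (p : ℂ) ^ (b + 1) := by
        rw [← Finset.sum_filter, Finset.sum_congr rfl (g := fun _ => (1 : ℂ))]
        · rw [Finset.sum_const, nsmul_eq_mul, mul_one, ← Fintype.card_subtype,
            ← Nat.card_eq_fintype_card, h.card_selfAdjoint_pow_mul_eq_zero (by omega)]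
          push_cast
          rfl
        · intro t ht
          have h3 := (Finset.mem_filter.1 ht).2
          rw [show b + 2 - 1 = b + 1 by omega] at h3
          rw [mul_neg, mul_comm, h3, neg_zero, AddChar.map_zero_eq_one]
      refine Eq.trans ?_ ((congrArg₂ (· - ·) h2 h1).trans (sub_zero _))
      rw [← Finset.sum_sub_distrib]
      refine Finset.sum_congr rfl fun t _ => ?_
      split_ifs
      · rfl
      · simp
    have hfin : (p : ℂ) ^ (b + 2) * (((Finset.univ.filter fun v : σ → R => xᴴ *ᵥ v = 0 ∧
            star v ⬝ᵥ v = (p : R) ^ (b + 1)).card : ℂ) -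
          (Finset.univ.filter fun v : σ → R => xᴴ *ᵥ v = 0 ∧
            star v ⬝ᵥ v = (p : R) ^ b).card) = (p : ℂ) ^ (b + 1) * (S₁ - S₀) := by
      rw [mul_sub, hdet, hdet, ← Finset.sum_sub_distrib,
        Finset.sum_congr rfl fun t _ => (sub_mul _ _ _).symm.trans (hpt t),
        Finset.sum_add_distrib, ← Finset.sum_mul, hsum0, ← Finset.sum_mul, hsum1]
      ring
    have hfin' : (p : ℂ) * (((Finset.univ.filter fun v : σ → R => xᴴ *ᵥ v = 0 ∧
            star v ⬝ᵥ v = (p : R) ^ (b + 1)).card : ℂ) -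
          (Finset.univ.filter fun v : σ → R => xᴴ *ᵥ v = 0 ∧
            star v ⬝ᵥ v = (p : R) ^ b).card) = S₁ - S₀ := by
      refine mul_left_cancel₀ (pow_ne_zero (b + 1) hp0) ?_
      rw [← hfin]; ring
    rw [pow_succ, mul_assoc, hfin', hS₁, hS₀, mul_sub, mul_div_cancel₀ _ (pow_ne_zero _ hp0)]
    congr 1
    rw [show 2 * (b + 3) * r = 2 * (b + 2) * r + 2 * r by ring, pow_add,
      mul_comm (_ ^ _) (_ ^ (2 * r)), mul_assoc, mul_div_cancel₀ _ (pow_ne_zero _ hp0)]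
  rw [repNum_adjoinGram, repNum_adjoinGram]
  push_cast
  rw [← Finset.sum_sub_distrib, Finset.mul_sum,
    Finset.sum_congr rfl fun x hx' => hx x (Finset.mem_filter.1 hx').2, Finset.sum_const,
    nsmul_eq_mul, repNum_eq_card_filter]

end LastExponent

/-! ### Primitive vectors -/

section Primitive

variable {R : Type*} [CommRing R] [StarRing R] {p l : ℕ} {Ψ : AddChar R ℂ}
  {σ : Type*} [Fintype σ] {ι : Type*} [Fintype ι]

/-- The imprimitive vectors, those without a unit coordinate, are the ones annihilated by
`p^(l-1)`. -/
theorem UnramifiedQuotient.smul_eq_zero_iff_forall_not_isUnit (h : UnramifiedQuotient R p l)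
    {κ : Type*} (v : κ → R) :
    (p : R) ^ (l - 1) • v = 0 ↔ ∀ i, ¬ IsUnit (v i) := by
  have hl := h.pos
  rw [funext_iff]
  refine forall_congr' fun i => ?_
  change (p : R) ^ (l - 1) * v i = 0 ↔ _
  rw [h.pow_mul_eq_zero_iff _ (Nat.sub_le l 1), show l - (l - 1) = 1 by omega, pow_one]
  exact ⟨h.not_isUnit_of_dvd, fun h1 => (h.isUnit_or_dvd _).resolve_left h1⟩

theorem trace_mul_add_vecMulVec {Y : Matrix ι ι R} (hY : Yᴴ = Y) (x : Matrix σ ι R) (u : σ → R)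
    (d : ι → R) :
    (Y * ((x + vecMulVec u d)ᴴ * (x + vecMulVec u d))).trace =
      (Y * (xᴴ * x)).trace + (d ᵥ* Y) ⬝ᵥ (xᴴ *ᵥ u) + star ((d ᵥ* Y) ⬝ᵥ (xᴴ *ᵥ u)) +
        (star u ⬝ᵥ u) * (d ⬝ᵥ Y *ᵥ star d) := by
  have h1 : (Y * (xᴴ * vecMulVec u d)).trace = (d ᵥ* Y) ⬝ᵥ (xᴴ *ᵥ u) := by
    rw [mul_vecMulVec, mul_vecMulVec, trace_vecMulVec, dotProduct_comm, dotProduct_mulVec]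
  have h2 : (Y * ((vecMulVec u d)ᴴ * x)).trace = star ((d ᵥ* Y) ⬝ᵥ (xᴴ *ᵥ u)) := by
    rw [← h1, ← trace_conjTranspose, conjTranspose_mul, conjTranspose_mul,
      conjTranspose_conjTranspose, hY, trace_mul_comm]
  have h3 : (Y * ((vecMulVec u d)ᴴ * vecMulVec u d)).trace =
      (star u ⬝ᵥ u) * (d ⬝ᵥ Y *ᵥ star d) := by
    rw [conjTranspose_vecMulVec, vecMulVec_mul_vecMulVec, mul_vecMulVec, trace_vecMulVec]
    simp [dotProduct_comm]
  rw [conjTranspose_add, Matrix.add_mul, Matrix.mul_add, Matrix.mul_add, Matrix.mul_add,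
    Matrix.mul_add, Matrix.mul_add, trace_add, trace_add, trace_add, h1, h2, h3]
  ring

variable [Fintype R]

/-- The number of primitive vectors of norm `p^b`, `b ≥ 1`: in the expansion by characters only
the characters of conductor `1` and `p` contribute. -/
theorem card_primitive_norm (h : UnramifiedQuotient R p l) {b : ℕ} (hb : 1 ≤ b) :
    (p : ℂ) ^ (2 * Fintype.card σ + l) *
      ((Finset.univ.filter fun v : σ → R => (∃ i, IsUnit (v i)) ∧
        star v ⬝ᵥ v = (p : R) ^ b).card : ℂ) =
      ((p : ℂ) ^ (2 * Fintype.card σ) - 1) * (p : ℂ) ^ (2 * l * Fintype.card σ) +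
        ((p : ℂ) - 1) * ((p : ℂ) ^ (2 * Fintype.card σ) *
          (-(p : ℂ)) ^ ((2 * l - 1) * Fintype.card σ) - (p : ℂ) ^ (2 * l * Fintype.card σ)) := by
  obtain ⟨Ψ, hs, hΨ⟩ := h.exists_character
  have hl := h.pos
  have hp0 : (p : ℂ) ≠ 0 := Nat.cast_ne_zero.2 h.prime.ne_zero
  set s := Fintype.card σ with hs'
  set G : R → ℂ := fun t => ∑ v : σ → R, Ψ (t * (star v ⬝ᵥ v)) with hG
  -- the sum over the imprimitive vectors is again a Gauss sum
  have himp : ∀ t : R, (p : ℂ) ^ (2 * s) * ∑ v : σ → R with ∃ i, IsUnit (v i),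
      Ψ (t * (star v ⬝ᵥ v)) = (p : ℂ) ^ (2 * s) * G t - G ((p : R) ^ 2 * t) := by
    intro t
    have h1 := sum_comp_smul h (j := 1) hl isUnit_one (show (p : R) = (p : R) ^ 1 * 1 by ring)
      (fun v : σ → R => Ψ (t * (star v ⬝ᵥ v)))
    have h2 : ∑ w : σ → R, Ψ (t * (star ((p : R) • w) ⬝ᵥ ((p : R) • w))) = G ((p : R) ^ 2 * t) := by
      refine Finset.sum_congr rfl fun w _ => ?_
      rw [star_smul, star_natCast, smul_dotProduct, dotProduct_smul, smul_smul, smul_eq_mul]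
      congr 1; ring
    have h3 := Finset.sum_filter_add_sum_filter_not Finset.univ
      (fun v : σ → R => ∃ i, IsUnit (v i)) (fun v => Ψ (t * (star v ⬝ᵥ v)))
    rw [h2, ← hs', mul_one] at h1
    have h4 : ∑ v : σ → R with ¬ ∃ i, IsUnit (v i), Ψ (t * (star v ⬝ᵥ v)) =
        ∑ v : σ → R with (p : R) ^ (l - 1) • v = 0, Ψ (t * (star v ⬝ᵥ v)) := by
      congr 1
      ext v
      simp only [Finset.mem_filter, h.smul_eq_zero_iff_forall_not_isUnit, not_exists]
    have h5 : G t = _ := h3.symm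
    rw [h1, ← h4, h5]
    ring
  have hdet : (p : ℂ) ^ l * ((Finset.univ.filter fun v : σ → R => (∃ i, IsUnit (v i)) ∧
        star v ⬝ᵥ v = (p : R) ^ b).card : ℂ) = ∑ t : selfAdjoint R, Ψ (t * -(p : R) ^ b) *
          ∑ v : σ → R with ∃ i, IsUnit (v i), Ψ (t * (star v ⬝ᵥ v)) := by
    simp_rw [Finset.mul_sum]
    rw [Finset.sum_comm, ← Finset.filter_filter, Finset.card_filter]
    push_cast
    rw [Finset.mul_sum]
    refine Finset.sum_congr rfl fun v _ => ?_
    have h1 := sum_char_mul_selfAdjoint h hs hΨ (z := star v ⬝ᵥ v - (p : R) ^ b) (by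
      rw [star_sub, ← star_dotProduct]; simp)
    rw [mul_ite, mul_one, mul_zero, if_congr (sub_eq_zero (a := star v ⬝ᵥ v)).symm rfl rfl, ← h1]
    refine Finset.sum_congr rfl fun t _ => ?_
    rw [← AddChar.map_add_eq_mul]
    congr 1; ring
  have hGt : ∀ (j : ℕ) (t u : R), j ≤ l → star t = t → IsUnit u → t = (p : R) ^ j * u →
      G t = (-(p : ℂ)) ^ ((l + j) * s) := fun j t u hj hts hu ht =>
    sum_char_norm h hs hΨ hj hts hu ht
  have hG0 : G 0 = (p : ℂ) ^ (2 * l * s) := by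
    rw [hGt l 0 1 le_rfl (star_zero _) isUnit_one (by rw [h.pow_eq_zero, zero_mul]),
      ← two_mul, mul_assoc, pow_mul, neg_sq, ← pow_mul]
  set c : ℂ := (p : ℂ) ^ (2 * s) * (-(p : ℂ)) ^ ((2 * l - 1) * s) - (p : ℂ) ^ (2 * l * s) with hc
  have hterm : ∀ t : selfAdjoint R, Ψ (t * -(p : R) ^ b) *
      ((p : ℂ) ^ (2 * s) * G t - G ((p : R) ^ 2 * t)) =
      (if (p : R) ^ 1 * (t : R) = 0 then c else 0) +
        (if t = 0 then ((p : ℂ) ^ (2 * s) - 1) * (p : ℂ) ^ (2 * l * s) - c else 0) := by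
    intro t
    by_cases ht0 : t = 0
    · subst ht0
      simp only [ZeroMemClass.coe_zero, zero_mul, mul_zero, AddChar.map_zero_eq_one, if_true, hG0]
      ring
    rw [if_neg ht0, add_zero]
    have hstar2 : star ((p : R) ^ 2 * t) = (p : R) ^ 2 * t := by
      have h1 : star (t : R) = t := t.2
      simp [h1, mul_comm]
    obtain ⟨j, hj, u, hu, htu⟩ := h.exists_eq_pow_mul (t : R)
    have hjl : j < l := by
      rcases hj.lt_or_eq with h1 | rfl
      · exact h1
      · exact absurd (Subtype.ext (by rw [htu, h.pow_eq_zero, zero_mul]; rfl)) ht0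
    have hGj := hGt j t u hj t.2 hu htu
    rcases Nat.lt_or_ge (j + 1) l with hj1 | hj1
    · have hne : ¬ (p : R) ^ 1 * (t : R) = 0 := by
        rw [htu, ← mul_assoc, ← pow_add, hu.mul_left_eq_zero]
        intro h0
        have h1 := (h.pow_mul_eq_zero_iff (1 + j) (by omega) 1).1 (by rw [h0, zero_mul])
        obtain ⟨d, hd⟩ : ∃ d, l - (1 + j) = d + 1 := ⟨l - (1 + j) - 1, by omega⟩
        rw [hd, pow_succ'] at h1
        exact h.not_isUnit (isUnit_of_dvd_one (dvd_of_mul_right_dvd h1))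
      rw [if_neg hne, hGj, hGt (j + 2) _ u (by omega) hstar2 hu (by rw [htu]; ring)]
      rw [show (l + (j + 2)) * s = 2 * s + (l + j) * s by ring, pow_add _ (2 * s), pow_mul _ 2 s,
        pow_mul (-(p : ℂ)) 2 s, neg_sq, sub_self, mul_zero]
    · have hjl' : j = l - 1 := by omega
      have hz : (p : R) ^ 1 * (t : R) = 0 := by
        rw [htu, ← mul_assoc, ← pow_add, h.pow_eq_zero_of_le (by omega), zero_mul]
      have hz2 : (p : R) ^ 2 * (t : R) = 0 := by
        rw [pow_succ, mul_assoc, ← pow_one (p : R), ← pow_mul, mul_one, hz, mul_zero]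
      have hzb : (t : R) * -(p : R) ^ b = 0 := by
        obtain ⟨d, rfl⟩ : ∃ d, b = 1 + d := ⟨b - 1, by omega⟩
        rw [pow_add]
        linear_combination -(p : R) ^ d * hz
      rw [if_pos hz, hzb, AddChar.map_zero_eq_one, hz2, hG0, hGj, one_mul, hc,
        show l + j = 2 * l - 1 by omega]
  have hcount : ∑ t : selfAdjoint R, (if (p : R) ^ 1 * (t : R) = 0 then c else 0) = p * c := by
    rw [← Finset.sum_filter, Finset.sum_const, nsmul_eq_mul, ← Fintype.card_subtype,
      ← Nat.card_eq_fintype_card, h.card_selfAdjoint_pow_mul_eq_zero (j := 1) hl, pow_one]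
  rw [pow_add, mul_assoc, hdet, Finset.mul_sum]
  rw [Finset.sum_congr rfl fun t _ => by rw [mul_left_comm, himp, hterm],
    Finset.sum_add_distrib, hcount, Finset.sum_ite_eq' Finset.univ (0 : selfAdjoint R),
    if_pos (Finset.mem_univ _)]
  ring

/-- The Gauss sum over the systems of vectors orthogonal to a primitive vector `v`. Up to the
factor belonging to the norm of `v`, it is the Gauss sum for a space of dimension smaller by two. -/
theorem sum_char_trace_orthogonal (h : UnramifiedQuotient R p l) (hs : ∀ x, Ψ (star x) = Ψ x)
    (hΨ : Ψ.IsPrimitive) {Y : Matrix ι ι R} (hY : Yᴴ = Y) {s : ℕ} (hσ : Fintype.card σ = s + 2)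
    {v : σ → R} (hv : ∃ i, IsUnit (v i)) :
    ∑ x : Matrix σ ι R with xᴴ *ᵥ v = 0, Ψ (Y * (xᴴ * x)).trace =
      hermGauss Ψ Y ^ s * hermGauss Ψ ((star v ⬝ᵥ v) • Y) := by
  have hp0 : (p : ℂ) ≠ 0 := Nat.cast_ne_zero.2 h.prime.ne_zero
  set P : ℂ := (p : ℂ) ^ (2 * l * Fintype.card ι) with hP
  have hP0 : P ≠ 0 := pow_ne_zero _ hp0
  have hcard : (Nat.card R : ℂ) ^ Fintype.card ι = P := by
    rw [h.card_eq, hP, pow_mul _ (2 * l)]; push_cast; rfl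
  set κ : ℂ := (Nat.card {y : ι → R // Y *ᵥ y = 0} : ℂ) with hκ
  have hsq : hermGauss Ψ Y ^ 2 = P * κ := hermGauss_sq h hs hΨ hY
  set Q := ∑ x : Matrix σ ι R with xᴴ *ᵥ v = 0, Ψ (Y * (xᴴ * x)).trace with hQ
  set A : (ι → R) → ℂ := fun c => ∑ x : Matrix σ ι R, Ψ (Y * (xᴴ * x)).trace * Ψ (c ⬝ᵥ xᴴ *ᵥ v)
    with hA
  have hdet : P * Q = ∑ c, A c := by
    rw [hA, Finset.sum_comm, hQ, Finset.sum_filter, Finset.mul_sum]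
    refine Finset.sum_congr rfl fun x _ => ?_
    rw [← Finset.mul_sum, sum_char_dotProduct hΨ, hcard]
    split_ifs <;> ring
  obtain ⟨u, hu⟩ : ∃ u : σ → R, star u ⬝ᵥ v = 1 := by
    obtain ⟨i, hi⟩ := hv
    obtain ⟨w, hw⟩ := hi.exists_left_inv
    refine ⟨Pi.single i (star w), ?_⟩
    rw [← Pi.single_star, star_star, single_dotProduct, hw]
  -- `A c` vanishes unless `c` is orthogonal to the kernel of `Y`
  have hshift : ∀ (c z : ι → R), Y *ᵥ z = 0 → A c = A c * Ψ (z ⬝ᵥ c) := by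
    intro c z hz
    have hz' : star z ᵥ* Y = 0 := by
      rw [← star_star (star z ᵥ* Y), star_vecMul, star_star, hY, hz, star_zero]
    rw [hA, Finset.sum_mul]
    refine (Fintype.sum_equiv (Equiv.addRight (vecMulVec u (star z))) _ _ fun x => ?_).symm
    rw [Equiv.coe_addRight, trace_mul_add_vecMulVec hY, hz', star_star, hz, mul_assoc,
      ← AddChar.map_add_eq_mul Ψ (c ⬝ᵥ _)]
    congr 2
    · simp
    · rw [conjTranspose_add, conjTranspose_vecMulVec, star_star, add_mulVec, vecMulVec_mulVec, hu,
        dotProduct_add, dotProduct_comm z]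
      simp
  have hdual : ∀ c : ι → R, ∑ z : ι → R with Y *ᵥ z = 0, Ψ (z ⬝ᵥ c) =
      ((Finset.univ.filter fun d : ι → R => (2 : R) • (d ᵥ* Y) = c).card : ℂ) := by
    intro c
    refine mul_left_cancel₀ hP0 ?_
    obtain ⟨e, -, he⟩ := h.exists_half
    have e1 : ∀ z : ι → R, P * (if Y *ᵥ z = 0 then Ψ (z ⬝ᵥ c) else 0) =
        ∑ d : ι → R, Ψ (z ⬝ᵥ (c - (2 : R) • (d ᵥ* Y))) := by
      intro z
      have e2 : ∀ d : ι → R, Ψ (z ⬝ᵥ (c - (2 : R) • (d ᵥ* Y))) =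
          Ψ (z ⬝ᵥ c) * Ψ (d ⬝ᵥ -((2 : R) • (Y *ᵥ z))) := by
        intro d
        rw [← AddChar.map_add_eq_mul, dotProduct_sub, dotProduct_neg, dotProduct_smul,
          dotProduct_smul, dotProduct_mulVec, dotProduct_comm z (d ᵥ* Y), sub_eq_add_neg]
      have e3 : -((2 : R) • (Y *ᵥ z)) = 0 ↔ Y *ᵥ z = 0 := by
        rw [neg_eq_zero]
        constructor
        · intro h0
          have := congrArg (fun w => e • w) h0
          simpa only [smul_smul, mul_comm e 2, he, one_smul, smul_zero] using this
        · intro h0; rw [h0, smul_zero]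
      rw [Finset.sum_congr rfl fun d _ => e2 d, ← Finset.mul_sum, sum_char_dotProduct hΨ, hcard,
        if_congr e3 rfl rfl]
      split_ifs <;> ring
    rw [Finset.sum_filter, Finset.mul_sum, Finset.sum_congr rfl fun z _ => e1 z, Finset.sum_comm,
      Finset.card_filter]
    push_cast
    rw [Finset.mul_sum]
    refine Finset.sum_congr rfl fun d _ => ?_
    rw [sum_char_dotProduct hΨ, hcard, if_congr (sub_eq_zero.trans eq_comm) rfl rfl]
    split_ifs <;> ring
  have hker : ∀ c, κ * A c =
      ((Finset.univ.filter fun d : ι → R => (2 : R) • (d ᵥ* Y) = c).card : ℂ) * A c := by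
    intro c
    rw [← hdual, Finset.sum_mul, Finset.sum_congr rfl (g := fun _ => A c)
      (fun z hz => by rw [mul_comm]; exact (hshift c z (Finset.mem_filter.1 hz).2).symm),
      Finset.sum_const, nsmul_eq_mul, hκ, Nat.card_eq_fintype_card, Fintype.card_subtype]
  -- completing the square in the direction of `v`
  have hsquare : ∀ d : ι → R, A ((2 : R) • (d ᵥ* Y)) =
      hermGauss Ψ Y ^ Fintype.card σ * Ψ (-(d ⬝ᵥ ((star v ⬝ᵥ v) • Y) *ᵥ star d)) := by
    intro d
    rw [← sum_char_trace_eq_pow (σ := σ), Finset.sum_mul, hA]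
    refine Fintype.sum_equiv (Equiv.addRight (vecMulVec v d)) _ _ fun x => ?_
    rw [Equiv.coe_addRight, trace_mul_add_vecMulVec hY, smul_dotProduct, smul_mulVec,
      dotProduct_smul, smul_eq_mul, smul_eq_mul]
    set q := (d ᵥ* Y) ⬝ᵥ (xᴴ *ᵥ v)
    have e1 : Ψ (2 * q) = Ψ (q + star q) := by
      rw [AddChar.map_add_eq_mul, hs, ← AddChar.map_add_eq_mul, two_mul]
    rw [e1, ← AddChar.map_add_eq_mul, ← AddChar.map_add_eq_mul]
    congr 1; ring
  have htotal : κ * (P * Q) =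
      hermGauss Ψ Y ^ Fintype.card σ * hermGauss Ψ ((star v ⬝ᵥ v) • Y) := by
    rw [hdet, Finset.mul_sum, Finset.sum_congr rfl fun c _ => hker c]
    have e1 : ∀ c, ((Finset.univ.filter fun d : ι → R => (2 : R) • (d ᵥ* Y) = c).card : ℂ) * A c =
        ∑ d : ι → R with (2 : R) • (d ᵥ* Y) = c, A ((2 : R) • (d ᵥ* Y)) := by
      intro c
      rw [Finset.sum_congr rfl (g := fun _ => A c) (fun d hd => by
        rw [(Finset.mem_filter.1 hd).2]), Finset.sum_const, nsmul_eq_mul]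
    rw [Finset.sum_congr rfl fun c _ => e1 c, Finset.sum_fiberwise,
      Finset.sum_congr rfl fun d _ => hsquare d, ← Finset.mul_sum, ← hermGauss_eq_sum_neg h]
  have hg0 : hermGauss Ψ Y ≠ 0 := by
    obtain ⟨c, -, hc, -⟩ := exists_hermGauss_eq h hs hΨ hY
    rw [hc]
    exact pow_ne_zero _ (neg_ne_zero.2 hp0)
  refine mul_left_cancel₀ (pow_ne_zero 2 hg0) ?_
  calc hermGauss Ψ Y ^ 2 * Q = κ * (P * Q) := by rw [hsq]; ring
    _ = _ := by rw [htotal, hσ]; ring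

/-- The number of systems with Gram matrix `T = diag(p^{a_i})` in the orthogonal complement of a
primitive vector whose norm is `p^b` with `b` large. In the Fourier expansion the norm of the vector
only has the effect that `T` is replaced by `T - p^b z̄ ᵗz`, which is equivalent to `T`. -/
theorem card_orthogonal_primitive (h : UnramifiedQuotient R p l) {σ' : Type*} [Fintype σ']
    (hσ : Fintype.card σ = Fintype.card σ' + 2) {a : ι → ℕ} {b : ℕ} (hab : ∀ i, a i < b)
    {v : σ → R} (hv : ∃ i, IsUnit (v i)) (hvb : star v ⬝ᵥ v = (p : R) ^ b) :
    (Finset.univ.filter fun x : Matrix σ ι R =>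
      xᴴ *ᵥ v = 0 ∧ xᴴ * x = diagonal fun i => (p : R) ^ a i).card =
      p ^ (2 * l * Fintype.card ι) * repNum σ' (diagonal fun i : ι => (p : R) ^ a i) := by
  obtain ⟨Ψ, hs, hΨ⟩ := h.exists_character
  have hp0 : (p : ℂ) ≠ 0 := Nat.cast_ne_zero.2 h.prime.ne_zero
  set T : Matrix ι ι R := diagonal fun i => (p : R) ^ a i with hT
  have hTs : Tᴴ = T := by
    rw [hT, diagonal_conjTranspose]
    congr 1
    ext i; simp
  have hps : star ((p : R) ^ b) = (p : R) ^ b := by simp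
  have h1 := card_filter_conjTranspose_mul h hs hΨ hTs
    (Finset.univ.filter fun x : Matrix σ ι R => xᴴ *ᵥ v = 0)
  rw [Finset.filter_filter] at h1
  set W : (ι → R) → Matrix ι ι R := fun z => T - (p : R) ^ b • vecMulVec (star z) z with hW
  have hWs : ∀ z, (W z)ᴴ = W z := fun z => by
    rw [hW, conjTranspose_sub, hTs, conjTranspose_smul, hps, conjTranspose_vecMulVec, star_star]
  have hWT : ∀ z, repNum σ' (W z) = repNum σ' T := fun z =>
    repNum_eq_of_close h hab (hWs z) (fun i j => by
      rw [hW, sub_sub_cancel_left, Matrix.neg_apply, Matrix.smul_apply, smul_eq_mul, dvd_neg]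
      exact dvd_mul_right _ _)
  have h2 : (p : ℂ) ^ (l * Fintype.card ι ^ 2) * ((Finset.univ.filter fun x : Matrix σ ι R =>
      xᴴ *ᵥ v = 0 ∧ xᴴ * x = T).card : ℂ) =
      ∑ z : ι → R, (p : ℂ) ^ (l * Fintype.card ι ^ 2) * (repNum σ' (W z) : ℂ) := by
    rw [h1, Finset.sum_congr rfl fun z _ => repNum_fourier h hs hΨ (hWs z), Finset.sum_comm]
    refine Finset.sum_congr rfl fun Y _ => ?_
    have e : hermGauss Ψ ((p : R) ^ b • (Y : Matrix ι ι R)) =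
      ∑ z : ι → R, Ψ (z ⬝ᵥ ((p : R) ^ b • (Y : Matrix ι ι R)) *ᵥ star z) := rfl
    rw [sum_char_trace_orthogonal h hs hΨ Y.2 hσ hv, hvb, ← Finset.sum_mul, e,
      mul_left_comm, mul_comm, Finset.mul_sum]
    congr 1
    refine Finset.sum_congr rfl fun z _ => ?_
    rw [← AddChar.map_add_eq_mul]
    congr 1
    rw [hW, Matrix.mul_sub, trace_sub, Matrix.mul_smul, trace_smul, mul_vecMulVec,
      trace_vecMulVec, smul_mulVec, dotProduct_smul, dotProduct_comm z, neg_sub, sub_eq_neg_add]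
  simp_rw [hWT] at h2
  rw [Finset.sum_const, Finset.card_univ, nsmul_eq_mul, ← Nat.card_eq_fintype_card (α := ι → R),
    Nat.card_fun, h.card_eq, Nat.card_eq_fintype_card, mul_left_comm] at h2
  have h3 := mul_left_cancel₀ (pow_ne_zero _ hp0) h2
  rw [pow_mul _ (2 * l)]
  exact_mod_cast h3

theorem card_selfAdjoint_sq_mul_eq (h : UnramifiedQuotient R p l) (hl : 2 ≤ l) (b : ℕ) :
    (Finset.univ.filter fun τ : R => star τ = τ ∧ (p : R) ^ 2 * τ = (p : R) ^ (b + 2)).card =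
      p ^ 2 := by
  rw [← h.card_selfAdjoint_pow_mul_eq_zero hl, ← Fintype.card_subtype, ← Nat.card_eq_fintype_card]
  have hb : star ((p : R) ^ b) = (p : R) ^ b := by simp
  refine Nat.card_congr ⟨fun τ => ⟨⟨τ.1 - (p : R) ^ b, ?_⟩, ?_⟩,
    fun t => ⟨t.1.1 + (p : R) ^ b, ?_, ?_⟩, fun τ => ?_, fun t => ?_⟩
  · change star _ = _
    rw [star_sub, τ.2.1, hb]
  · change (p : R) ^ 2 * (τ.1 - (p : R) ^ b) = 0
    rw [mul_sub, τ.2.2]; ring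
  · have := t.1.2
    rw [star_add, hb]
    congr 1
  · rw [mul_add, t.2]; ring
  · simp
  · simp

theorem sum_sum_ite_and {α β : Type*} (A : Finset α) (B : Finset β) (P : Prop) (y : α) (z : β)
    [∀ i j, Decidable (P ∧ y = i ∧ z = j)] [Decidable (z ∈ B ∧ (y ∈ A ∧ P))] :
    ∑ i ∈ A, ∑ j ∈ B, (if P ∧ y = i ∧ z = j then 1 else 0) =
      if z ∈ B ∧ (y ∈ A ∧ P) then 1 else 0 := by
  have h1 : ∀ i j, (if P ∧ y = i ∧ z = j then 1 else 0) =
      if y = i then (if z = j then (if P then 1 else 0) else 0) else 0 := fun i j => by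
    split_ifs <;> simp_all
  simp_rw [h1]
  rw [Finset.sum_congr rfl (g := fun i => if y = i then
    (∑ j ∈ B, if z = j then (if P then 1 else 0) else 0) else 0) (fun i _ => by
      split_ifs <;> simp), Finset.sum_ite_eq, Finset.sum_ite_eq]
  split_ifs <;> simp_all

/-- The systems whose last vector is imprimitive: dividing this vector by `p` lowers its exponent
by two. The division determines the Gram matrix only up to a small hermitian error, which does not
affect the number of representations. -/
theorem sum_imprimitive (h : UnramifiedQuotient R p l) {a : ι → ℕ} {b : ℕ} (hbl : b + 3 ≤ l)
    (hab : ∀ i, a i ≤ b) :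
    p ^ (2 * Fintype.card σ) * ∑ v : σ → R with (¬ ∃ i, IsUnit (v i)) ∧
        star v ⬝ᵥ v = (p : R) ^ (b + 2),
      (Finset.univ.filter fun x : Matrix σ ι R =>
        xᴴ *ᵥ v = 0 ∧ xᴴ * x = diagonal fun i => (p : R) ^ a i).card =
      p ^ (2 * Fintype.card ι + 2) *
        repNum σ (adjoinGram (diagonal fun i : ι => (p : R) ^ a i) 0 ((p : R) ^ b)) := by
  set T : Matrix ι ι R := diagonal fun i => (p : R) ^ a i with hT
  have hTs : Tᴴ = T := by
    rw [hT, diagonal_conjTranspose]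
    congr 1
    ext i; simp
  set G : (σ → R) → ℕ := fun v => if star v ⬝ᵥ v = (p : R) ^ (b + 2) then
    (Finset.univ.filter fun x : Matrix σ ι R => xᴴ *ᵥ v = 0 ∧ xᴴ * x = T).card else 0 with hG
  set Ys : Finset (ι → R) := Finset.univ.filter fun y => (p : R) ^ 1 • y = 0 with hYs
  set Ts : Finset R := Finset.univ.filter fun τ => star τ = τ ∧
    (p : R) ^ 2 * τ = (p : R) ^ (b + 2) with hTs'
  have h1 := sum_comp_smul h (j := 1) h.pos isUnit_one (show (p : R) = (p : R) ^ 1 * 1 by ring)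
    (fun v : σ → R => (G v : ℂ))
  rw [mul_one] at h1
  have h1' : ∑ w : σ → R, G ((p : R) • w) = p ^ (2 * Fintype.card σ) *
      ∑ v : σ → R with (p : R) ^ (l - 1) • v = 0, G v := by exact_mod_cast h1
  have h2 : ∑ v : σ → R with (p : R) ^ (l - 1) • v = 0, G v =
      ∑ v : σ → R with (¬ ∃ i, IsUnit (v i)) ∧ star v ⬝ᵥ v = (p : R) ^ (b + 2),
      (Finset.univ.filter fun x : Matrix σ ι R => xᴴ *ᵥ v = 0 ∧ xᴴ * x = T).card := by
    rw [← Finset.filter_filter, Finset.sum_filter (fun v : σ → R => star v ⬝ᵥ v = _)]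
    refine Finset.sum_congr ?_ fun v _ => rfl
    ext v
    simp only [Finset.mem_filter, h.smul_eq_zero_iff_forall_not_isUnit, not_exists]
  have h3 : ∑ w : σ → R, G ((p : R) • w) =
      ∑ y ∈ Ys, ∑ τ ∈ Ts, repNum σ (adjoinGram T y τ) := by
    have e1 : ∀ w : σ → R, G ((p : R) • w) = ∑ y ∈ Ys, ∑ τ ∈ Ts, ∑ x : Matrix σ ι R,
        if xᴴ * x = T ∧ xᴴ *ᵥ w = y ∧ star w ⬝ᵥ w = τ then 1 else 0 := by
      intro w
      have e2 : ∀ x : Matrix σ ι R, ∑ y ∈ Ys, ∑ τ ∈ Ts,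
          (if xᴴ * x = T ∧ xᴴ *ᵥ w = y ∧ star w ⬝ᵥ w = τ then 1 else 0) =
          if star ((p : R) • w) ⬝ᵥ ((p : R) • w) = (p : R) ^ (b + 2) ∧
            (xᴴ *ᵥ ((p : R) • w) = 0 ∧ xᴴ * x = T) then 1 else 0 := by
        intro x
        have e3 : star ((p : R) • w) ⬝ᵥ ((p : R) • w) = (p : R) ^ 2 * (star w ⬝ᵥ w) := by
          rw [star_smul, star_natCast, smul_dotProduct, dotProduct_smul, smul_smul, smul_eq_mul,
            pow_two]
        have e4 : xᴴ *ᵥ w ∈ Ys ↔ xᴴ *ᵥ ((p : R) • w) = 0 := by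
          rw [hYs, Finset.mem_filter, mulVec_smul, pow_one]
          simp
        have e5 : star w ⬝ᵥ w ∈ Ts ↔ (p : R) ^ 2 * (star w ⬝ᵥ w) = (p : R) ^ (b + 2) := by
          rw [hTs', Finset.mem_filter, ← star_dotProduct]
          simp
        have e7 : (if star ((p : R) • w) ⬝ᵥ ((p : R) • w) = (p : R) ^ (b + 2) ∧
            (xᴴ *ᵥ ((p : R) • w) = 0 ∧ xᴴ * x = T) then 1 else 0) =
            if star w ⬝ᵥ w ∈ Ts ∧ (xᴴ *ᵥ w ∈ Ys ∧ xᴴ * x = T) then 1 else 0 :=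
          if_congr (by rw [e3, e4, e5]) rfl rfl
        rw [e7]
        exact sum_sum_ite_and Ys Ts _ _ _
      rw [Finset.sum_congr rfl fun y _ => Finset.sum_comm, Finset.sum_comm,
        Finset.sum_congr rfl fun x _ => e2 x, hG]
      simp only
      split_ifs with h0
      · rw [Finset.card_filter]
        exact Finset.sum_congr rfl fun x _ => if_congr (by tauto) rfl rfl
      · exact (Finset.sum_eq_zero fun x _ => if_neg fun hx => h0 hx.1).symm
    rw [Finset.sum_congr rfl fun w _ => e1 w, Finset.sum_comm]
    refine Finset.sum_congr rfl fun y _ => ?_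
    rw [Finset.sum_comm]
    refine Finset.sum_congr rfl fun τ _ => ?_
    rw [repNum_adjoinGram_eq_card, Fintype.sum_prod_type_right]
  have h4 : ∀ y ∈ Ys, ∀ τ ∈ Ts, repNum σ (adjoinGram T y τ) =
      repNum σ (adjoinGram T 0 ((p : R) ^ b)) := by
    intro y hy τ hτ
    rw [hYs, Finset.mem_filter] at hy
    rw [hTs', Finset.mem_filter] at hτ
    have hd := adjoinGram_diagonal (R := R) fun o : Option ι => (p : R) ^ (o.elim b a)
    have hd' : adjoinGram T 0 ((p : R) ^ b) =
        diagonal fun o : Option ι => (p : R) ^ (o.elim b a) := hd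
    rw [hd']
    have hy1 : ∀ i, (p : R) ^ (b + 1) ∣ y i := fun i => by
      have h5 : (p : R) ^ 1 * y i = 0 := congrFun hy.2 i
      rw [h.pow_mul_eq_zero_iff 1 (by omega)] at h5
      exact (pow_dvd_pow _ (by omega)).trans h5
    have hτ1 : (p : R) ^ (b + 1) ∣ τ - (p : R) ^ b := by
      have h5 : (p : R) ^ 2 * (τ - (p : R) ^ b) = 0 := by rw [mul_sub, hτ.2.2]; ring
      rw [h.pow_mul_eq_zero_iff 2 (by omega)] at h5
      exact (pow_dvd_pow _ (by omega)).trans h5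
    refine repNum_eq_of_close h (k := b + 1) (fun o => ?_) (adjoinGram_isHermitian hTs hτ.2.1 y)
      (fun i j => ?_)
    · rcases o with _ | i
      · exact Nat.lt_succ_self b
      · exact Nat.lt_succ_of_le (hab i)
    · rw [← hd', Matrix.sub_apply]
      rcases i with _ | i <;> rcases j with _ | j
      · exact hτ1
      · change _ ∣ star (y j) - star 0
        obtain ⟨z, hz⟩ := hy1 j
        refine ⟨star z, ?_⟩
        rw [hz]; simp [mul_comm]
      · change _ ∣ y i - 0
        rw [sub_zero]; exact hy1 i
      · change _ ∣ T i j - T i j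
        rw [sub_self]; exact dvd_zero _
  have hYcard : Ys.card = p ^ (2 * Fintype.card ι) := by
    rw [hYs, ← Fintype.card_subtype, ← Nat.card_eq_fintype_card,
      h.card_vec_pow_mul_eq_zero h.pos]
  have hTcard : Ts.card = p ^ 2 := card_selfAdjoint_sq_mul_eq h (by omega) b
  rw [← h2, ← h1', h3, Finset.sum_congr rfl fun y hy => Finset.sum_congr rfl (h4 y hy)]
  rw [Finset.sum_const, Finset.sum_const, hYcard, hTcard, smul_eq_mul, smul_eq_mul, pow_add,
    mul_assoc]

/-- The number of representations of `diag(p^{a_i})` enlarged by `p^(b+2)`, split according to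
whether the last vector is primitive. -/
theorem repNum_adjoin_add_two (h : UnramifiedQuotient R p l) {σ' : Type*} [Fintype σ']
    (hσ : Fintype.card σ = Fintype.card σ' + 2) {a : ι → ℕ} {b : ℕ} (hbl : b + 3 ≤ l)
    (hab : ∀ i, a i ≤ b) :
    (p : ℂ) ^ (2 * Fintype.card σ + l) *
        (repNum σ (adjoinGram (diagonal fun i : ι => (p : R) ^ a i) 0 ((p : R) ^ (b + 2))) : ℂ) =
      (p : ℂ) ^ (l + 2 * Fintype.card ι + 2) *
        repNum σ (adjoinGram (diagonal fun i : ι => (p : R) ^ a i) 0 ((p : R) ^ b)) +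
      (p : ℂ) ^ (2 * l * Fintype.card ι) * repNum σ' (diagonal fun i : ι => (p : R) ^ a i) *
        (((p : ℂ) ^ (2 * Fintype.card σ) - 1) * (p : ℂ) ^ (2 * l * Fintype.card σ) +
          ((p : ℂ) - 1) * ((p : ℂ) ^ (2 * Fintype.card σ) *
            (-(p : ℂ)) ^ ((2 * l - 1) * Fintype.card σ) -
              (p : ℂ) ^ (2 * l * Fintype.card σ))) := by
  have h1 := sum_imprimitive (σ := σ) h hbl hab
  have h2 := card_primitive_norm (σ := σ) h (b := b + 2) (by omega)
  rw [repNum_adjoinGram', ← Finset.sum_filter_add_sum_filter_not _ (fun v : σ → R =>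
    ∃ i, IsUnit (v i)), Finset.filter_filter, Finset.filter_filter]
  rw [Finset.sum_congr rfl (g := fun _ => p ^ (2 * l * Fintype.card ι) *
    repNum σ' (diagonal fun i : ι => (p : R) ^ a i)) (fun v hv => by
      have hv' := (Finset.mem_filter.1 hv).2
      exact card_orthogonal_primitive h hσ (fun i => by have := hab i; omega) hv'.2 hv'.1),
    Finset.sum_const, smul_eq_mul]
  simp_rw [and_comm (a := (star _ ⬝ᵥ _ = (p : R) ^ (b + 2)))]
  have h1' := congrArg (Nat.cast : ℕ → ℂ) h1
  rw [← h2]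
  push_cast at h1' ⊢
  rw [mul_add, pow_add _ (2 * Fintype.card σ) l, mul_right_comm _ _ (∑ v with _, _), h1']
  ring

end Primitive

/-! ### Change of the modulus -/

section Modulus

theorem map_eq_zero_iff_smul_eq_zero {R R' : Type*} [CommRing R] [CommRing R'] {p : ℕ}
    {κ ι : Type*} (π : R →+* R')
    (hker : ∀ x, π x = 0 ↔ (p : R) * x = 0) (W : Matrix κ ι R) :
    W.map π = 0 ↔ (p : R) ^ 1 • W = 0 := by
  rw [← Matrix.ext_iff, ← Matrix.ext_iff]
  refine forall_congr' fun i => forall_congr' fun j => ?_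
  rw [pow_one, Matrix.smul_apply, smul_eq_mul]
  exact hker _

variable {R R' : Type*} [CommRing R] [StarRing R] [Fintype R] [CommRing R'] [StarRing R']
  [Fintype R'] {p l : ℕ} {σ : Type*} [Fintype σ] {ι : Type*} [Fintype ι]

/-- The normalised number of representations of `diag(p^{a_i})` modulo `p^l` does not change when
`l` is increased, as soon as `l` exceeds all `a_i`. -/
theorem repNum_succ (h : UnramifiedQuotient R p (l + 1)) {a : ι → ℕ}
    (ha : ∀ i, a i < l)
    (π : R →+* R') (hπ : Function.Surjective π) (hstar : ∀ x, π (star x) = star (π x))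
    (hker : ∀ x, π x = 0 ↔ (p : R) * x = 0) :
    p ^ (Fintype.card ι ^ 2) * repNum σ (diagonal fun i : ι => (p : R) ^ a i) =
      p ^ (2 * (Fintype.card σ * Fintype.card ι)) *
        repNum σ (diagonal fun i : ι => (p : R') ^ a i) := by
  set T : Matrix ι ι R := diagonal fun i => (p : R) ^ a i with hT
  set T' : Matrix ι ι R' := diagonal fun i => (p : R') ^ a i with hT'
  have hTs : Tᴴ = T := by
    rw [hT, diagonal_conjTranspose]
    congr 1
    ext i; simp
  have hTT' : T.map π = T' := by
    rw [hT, hT', diagonal_map (map_zero π)]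
    congr 1
    ext i; simp
  have hmap0 : ∀ W : Matrix σ ι R, W.map π = 0 ↔ (p : R) ^ 1 • W = 0 :=
    fun W => map_eq_zero_iff_smul_eq_zero π hker W
  let f : Matrix σ ι R →+ Matrix σ ι R' :=
    AddMonoidHom.mk' (fun x => x.map π) fun x y => Matrix.map_add π (map_add π) x y
  have hf : Function.Surjective f := fun y => by
    choose x hx using fun i j => hπ (y i j)
    exact ⟨of x, by ext i j; exact hx i j⟩
  -- count the solutions modulo the smaller power in two ways
  have h1 := sum_comp_eq_card_ker_mul f (fun y => if yᴴ * y = T' then 1 else 0)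
  have h2 : Nat.card {x : Matrix σ ι R // f x = 0} =
      p ^ (2 * (Fintype.card σ * Fintype.card ι)) := by
    have h3 := h.card_matrix_pow_smul_eq_zero (j := 1) (by omega) σ ι
    rw [mul_one] at h3
    rw [← h3]
    exact Nat.card_congr (Equiv.subtypeEquivRight fun x => hmap0 x)
  have h3 : ∀ y, (y ∈ f.range) = True := fun y => eq_true (hf y)
  simp only [h3, Finset.filter_true] at h1
  have h0 : (∑ y : Matrix σ ι R', if yᴴ * y = T' then 1 else 0) = repNum σ T' := by
    rw [repNum_eq_card_filter, Finset.card_filter]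

  rw [h2, h0, Nat.cast_id] at h1
  rw [← h1]
  set Vs : Finset (Matrix ι ι R) :=
    Finset.univ.filter fun V => Vᴴ = V ∧ (p : R) ^ 1 • V = 0 with hVs
  have h4 : ∀ x : Matrix σ ι R, (if (f x)ᴴ * f x = T' then 1 else 0) =
      ∑ V ∈ Vs, if xᴴ * x = T + V then 1 else 0 := by
    intro x
    have e1 : (f x)ᴴ * f x = (xᴴ * x).map π := by
      rw [Matrix.map_mul]
      congr 1
      ext i j
      exact (hstar _).symm
    have e2 : (f x)ᴴ * f x = T' ↔ xᴴ * x - T ∈ Vs := by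
      rw [e1, ← hTT', ← sub_eq_zero, ← Matrix.map_sub π (map_sub π),
        map_eq_zero_iff_smul_eq_zero π hker, hVs,
        Finset.mem_filter, conjTranspose_sub, hTs, conjTranspose_mul, conjTranspose_conjTranspose]
      simp
    rw [if_congr e2 rfl rfl, Finset.sum_congr rfl (g := fun V => if xᴴ * x - T = V then 1 else 0)
      (fun V _ => if_congr (by rw [sub_eq_iff_eq_add']) rfl rfl), Finset.sum_ite_eq]
  rw [Finset.sum_congr rfl fun x _ => h4 x, Finset.sum_comm]
  have h5 : ∀ V ∈ Vs, (∑ x : Matrix σ ι R, if xᴴ * x = T + V then 1 else 0) = repNum σ T := by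
    intro V hV
    rw [hVs, Finset.mem_filter] at hV
    rw [← Finset.card_filter, ← repNum_eq_card_filter]
    refine repNum_eq_of_close h ha ?_ fun i j => ?_
    · change (T + V)ᴴ = T + V
      rw [conjTranspose_add, hTs, hV.2.1]
    · rw [← hT, add_sub_cancel_left]
      have h6 : (p : R) ^ 1 * V i j = 0 := congrFun (congrFun hV.2.2 i) j
      rw [h.pow_mul_eq_zero_iff 1 (by omega)] at h6
      simpa using h6
  have h7 : Vs.card = p ^ (Fintype.card ι ^ 2) := by
    have h8 := h.card_selfAdjoint_matrix_pow_smul_eq_zero (j := 1) (by omega) ι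
    rw [one_mul] at h8
    rw [← h8, hVs, ← Fintype.card_subtype, ← Nat.card_eq_fintype_card]
    exact Nat.card_congr ⟨fun V => ⟨⟨V.1, V.2.1⟩, V.2.2⟩, fun V => ⟨V.1.1, V.1.2, V.2⟩,
      fun V => rfl, fun V => rfl⟩
  rw [Finset.sum_congr rfl h5, Finset.sum_const, h7, smul_eq_mul]

end Modulus

/-! ### The rings `ℤ_{p²} / p^l` -/

section Quotient

variable (p : ℕ) [Fact p.Prime]

/-- The involution of `ℤ_{p²} / p^l` induced by `σ`. -/
instance starRingQuotient (l : ℕ) : StarRing (Zp2 p ⧸ Zp2.powIdeal p l) where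
  star := Zp2.conjMod p l
  star_involutive x := by
    obtain ⟨x, rfl⟩ := Ideal.Quotient.mk_surjective x
    change Ideal.Quotient.mk _ (Zp2.conj p (Zp2.conj p x)) = _
    rw [Zp2.conj_conj]
  star_mul x y := by rw [map_mul, mul_comm]
  star_add := map_add _

theorem star_mk (l : ℕ) (x : Zp2 p) : star (Ideal.Quotient.mk (Zp2.powIdeal p l) x) =
    Ideal.Quotient.mk (Zp2.powIdeal p l) (Zp2.conj p x) := rfl

theorem natCard_quotient_powIdeal (l : ℕ) :
    Nat.card (Zp2 p ⧸ Zp2.powIdeal p l) = p ^ (2 * l) := by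
  have h1 : Zp2.powIdeal p l = Ideal.span {(p : Zp2 p)} ^ l := by
    rw [Zp2.powIdeal, Ideal.span_singleton_pow]
  have hirr := WittVector.irreducible (p := p) (k := GaloisField p 2)
  have hprime : (Ideal.span {(p : Zp2 p)}).IsPrime :=
    (Ideal.span_singleton_prime hirr.ne_zero).2 hirr.prime
  have h2 := cardQuot_pow_of_prime (P := Ideal.span {(p : Zp2 p)})
    (by rw [Ne, Ideal.span_singleton_eq_bot]; exact hirr.ne_zero) (i := l)
  rw [Submodule.cardQuot_apply, Submodule.cardQuot_apply] at h2
  have h3 : Nat.card (Zp2 p ⧸ Ideal.span {(p : Zp2 p)}) = p ^ 2 := by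
    rw [← GaloisField.card p 2 two_ne_zero]
    exact Nat.card_congr (WittVector.quotientPEquiv (p := p) (k := GaloisField p 2)).toEquiv
  rw [h1, h2, h3, pow_mul]

theorem conj_teichmuller (x : GaloisField p 2) :
    Zp2.conj p (WittVector.teichmuller p x) = WittVector.teichmuller p x ^ p := by
  rw [← map_pow]
  ext i
  rw [Zp2.conj, WittVector.coeff_frobenius_charP]
  rcases Nat.eq_zero_or_pos i with rfl | hi
  · rw [WittVector.teichmuller_coeff_zero, WittVector.teichmuller_coeff_zero]
  · rw [WittVector.teichmuller_coeff_pos _ _ _ hi, WittVector.teichmuller_coeff_pos _ _ _ hi,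
      zero_pow (Fact.out : p.Prime).ne_zero]

/-- The root required in `exists_root` is the Teichmüller lift of a generator of the multiplicative
group of the residue field. -/
theorem unramifiedQuotient (hp : 2 < p) {l : ℕ} (hl : 0 < l) :
    UnramifiedQuotient (Zp2 p ⧸ Zp2.powIdeal p l) p l where
  prime := Fact.out
  two_lt := hp
  pos := hl
  card_eq := natCard_quotient_powIdeal p l
  pow_mul_eq_zero_iff j hj x := by
    obtain ⟨x, rfl⟩ := Ideal.Quotient.mk_surjective x
    have hp0 : (p : Zp2 p) ≠ 0 := WittVector.p_nonzero p _
    have h1 : ∀ y : Zp2 p, Ideal.Quotient.mk (Zp2.powIdeal p l) y = 0 ↔ (p : Zp2 p) ^ l ∣ y :=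
      fun y => by rw [Ideal.Quotient.eq_zero_iff_mem, Zp2.powIdeal, Ideal.mem_span_singleton]
    have hsplit : (p : Zp2 p) ^ l = (p : Zp2 p) ^ j * (p : Zp2 p) ^ (l - j) := by
      rw [← pow_add, Nat.add_sub_cancel' hj]
    have h2 : (p : Zp2 p ⧸ Zp2.powIdeal p l) = Ideal.Quotient.mk _ (p : Zp2 p) := by simp
    rw [h2, ← map_pow, ← map_pow, ← map_mul, h1, hsplit, mul_dvd_mul_iff_left (pow_ne_zero _ hp0)]
    constructor
    · exact map_dvd _
    · rintro ⟨z, hz⟩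
      obtain ⟨z, rfl⟩ := Ideal.Quotient.mk_surjective z
      rw [← map_mul, ← sub_eq_zero, ← map_sub, h1, hsplit] at hz
      have h3 := dvd_of_mul_left_dvd hz
      rwa [dvd_sub_left (dvd_mul_right _ _)] at h3
  isUnit_or_dvd x := by
    obtain ⟨x, rfl⟩ := Ideal.Quotient.mk_surjective x
    by_cases hx : x.coeff 0 = 0
    · right
      rw [← WittVector.mem_span_p_iff_coeff_zero_eq_zero, Ideal.mem_span_singleton] at hx
      simpa using map_dvd (Ideal.Quotient.mk (Zp2.powIdeal p l)) hx
    · exact Or.inl ((WittVector.isUnit_of_coeff_zero_ne_zero x hx).map _)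
  exists_root := by
    let _ : Fintype (GaloisField p 2) := Fintype.ofFinite _
    obtain ⟨g, hg⟩ := IsCyclic.exists_generator (α := (GaloisField p 2)ˣ)
    have hord : orderOf g = p ^ 2 - 1 := by
      rw [orderOf_eq_card_of_forall_mem_zpowers hg, Nat.card_units,
        GaloisField.card p 2 two_ne_zero]
    have hne : ∀ i, 0 < i → i < p ^ 2 - 1 → (g : GaloisField p 2) ^ i ≠ 1 := by
      intro i hi hip h1
      refine pow_ne_one_of_lt_orderOf hi.ne' (by rwa [hord]) (Units.ext ?_)
      simpa using h1
    have hone : (g : GaloisField p 2) ^ (p ^ 2 - 1) = 1 := by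
      rw [← hord, ← Units.val_pow_eq_pow_val, pow_orderOf_eq_one, Units.val_one]
    set τ := WittVector.teichmuller p (g : GaloisField p 2) with hτ
    have hcoeff : ∀ i, (τ ^ i).coeff 0 = (g : GaloisField p 2) ^ i := fun i => by
      rw [hτ, ← map_pow, WittVector.teichmuller_coeff_zero]
    have hodd : Odd p := (Fact.out : p.Prime).odd_of_ne_two hp.ne'
    obtain ⟨m, hm⟩ : ∃ m, p ^ 2 - 1 = 2 * m := by
      obtain ⟨k, hk⟩ := hodd.pow (n := 2)
      exact ⟨k, by omega⟩
    have hp4 : 2 < p ^ 2 - 1 := by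
      have : 3 ^ 2 ≤ p ^ 2 := Nat.pow_le_pow_left hp 2
      omega
    refine ⟨Ideal.Quotient.mk _ τ, ?_, ?_, fun i hi hip => ?_⟩
    · rw [star_mk, hτ, conj_teichmuller, map_pow]
    · rw [hm, Nat.mul_div_cancel_left _ two_pos, ← map_pow]
      have h1 : τ ^ m * τ ^ m = 1 := by
        rw [← pow_add, ← two_mul, ← hm, hτ, ← map_pow, hone, map_one]
      rcases mul_self_eq_one_iff.1 h1 with h2 | h2
      · exfalso
        have h3 := hcoeff m
        rw [h2, WittVector.one_coeff_zero] at h3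
        exact hne m (by omega) (by omega) h3.symm
      · rw [h2, map_neg, map_one]
    · rw [← map_pow, ← map_one (Ideal.Quotient.mk (Zp2.powIdeal p l)), ← map_sub]
      refine (WittVector.isUnit_of_coeff_zero_ne_zero _ ?_).map _
      rw [← WittVector.constantCoeff_apply, map_sub, map_one, WittVector.constantCoeff_apply,
        hcoeff, sub_ne_zero]
      exact hne i hi hip

variable {p}

/-- `diag(p^{a_i})` over an arbitrary commutative ring, whose ring structure also provides the zeros
off the diagonal. -/
abbrev powDiagonal (R : Type*) [CommRing R] (p : ℕ) {ι : Type*} [DecidableEq ι] (a : ι → ℕ) :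
    Matrix ι ι R :=
  diagonal fun i => (p : R) ^ a i

/-- As `T` is diagonal, `ᵗx σ(x) = T` is equivalent to its transpose `xᴴ x = T`. -/
theorem repCount_diagPow {s n : ℕ} (a : Fin n → ℕ) (l : ℕ) :
    repCount (1 : Matrix (Fin s) (Fin s) (Zp2 p)) (diagPow p a) l =
      repNum (Fin s) (powDiagonal (Zp2 p ⧸ Zp2.powIdeal p l) p a) := by
  refine Nat.card_congr (Equiv.subtypeEquivRight fun x => ?_)
  have h1 : (1 : Matrix (Fin s) (Fin s) (Zp2 p)).map (Ideal.Quotient.mk (Zp2.powIdeal p l)) = 1 :=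
    Matrix.map_one _ (map_zero _) (map_one _)
  have h2 : (diagPow p a).map (Ideal.Quotient.mk (Zp2.powIdeal p l)) =
      powDiagonal (Zp2 p ⧸ Zp2.powIdeal p l) p a := by
    rw [diagPow, diagonal_map (map_zero _), powDiagonal]
    congr 1
  rw [h1, h2, Matrix.mul_one, ← transpose_inj, transpose_mul, transpose_transpose,
    diagonal_transpose]
  rfl

theorem repCount_congr {s n : ℕ} {T T' : Matrix (Fin n) (Fin n) (Zp2 p)}
    (h : IsEquivalentZp2 T T') (l : ℕ) :
    repCount (1 : Matrix (Fin s) (Fin s) (Zp2 p)) T l =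
      repCount (1 : Matrix (Fin s) (Fin s) (Zp2 p)) T' l := by
  obtain ⟨g, rfl⟩ := h
  set φ := Ideal.Quotient.mk (Zp2.powIdeal p l) with hφ
  set ψ := Zp2.conjMod p l with hψ
  have hφψ : ∀ M : Matrix (Fin n) (Fin n) (Zp2 p), (M.map (Zp2.conj p)).map φ = (M.map φ).map ψ :=
    fun M => rfl
  set G : Matrix (Fin n) (Fin n) (Zp2 p ⧸ Zp2.powIdeal p l) :=
    (g : Matrix (Fin n) (Fin n) (Zp2 p)).map φ with hG
  set G' : Matrix (Fin n) (Fin n) (Zp2 p ⧸ Zp2.powIdeal p l) :=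
    ((g⁻¹ : GL (Fin n) (Zp2 p)) : Matrix (Fin n) (Fin n) (Zp2 p)).map φ with hG'
  have h1 : G * G' = 1 := by
    rw [hG, hG', ← Matrix.map_mul, ← Units.val_mul, mul_inv_cancel, Units.val_one,
      Matrix.map_one _ (map_zero _) (map_one _)]
  have h2 : G' * G = 1 := by
    rw [hG, hG', ← Matrix.map_mul, ← Units.val_mul, inv_mul_cancel, Units.val_one,
      Matrix.map_one _ (map_zero _) (map_one _)]
  have h1t : G'.transpose * G.transpose = 1 := by rw [← transpose_mul, h1, transpose_one]
  have h1c : G.map ψ * G'.map ψ = 1 := by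
    rw [← Matrix.map_mul, h1, Matrix.map_one _ (map_zero _) (map_one _)]
  have hS : (1 : Matrix (Fin s) (Fin s) (Zp2 p)).map φ = 1 :=
    Matrix.map_one _ (map_zero _) (map_one _)
  have hT' : ((g : Matrix (Fin n) (Fin n) (Zp2 p)).transpose * T *
      (g : Matrix (Fin n) (Fin n) (Zp2 p)).map (Zp2.conj p)).map φ =
      G.transpose * T.map φ * G.map ψ := by
    rw [Matrix.map_mul, Matrix.map_mul, hφψ]
    rfl
  refine Nat.card_congr ⟨fun x => ⟨x.1 * G, ?_⟩, fun x => ⟨x.1 * G', ?_⟩,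
    fun x => Subtype.ext ?_, fun x => Subtype.ext ?_⟩
  · obtain ⟨x, hx⟩ := x
    change (x * G).transpose * (1 : Matrix (Fin s) (Fin s) (Zp2 p)).map φ * (x * G).map ψ = _
    change x.transpose * (1 : Matrix (Fin s) (Fin s) (Zp2 p)).map φ * x.map ψ = T.map φ at hx
    rw [hS, Matrix.mul_one] at hx ⊢
    rw [hT', ← hx, transpose_mul, Matrix.map_mul]
    simp only [Matrix.mul_assoc]
  · obtain ⟨x, hx⟩ := x
    change (x * G').transpose * (1 : Matrix (Fin s) (Fin s) (Zp2 p)).map φ * (x * G').map ψ = _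
    rw [hS, Matrix.mul_one] at hx ⊢
    rw [hT'] at hx
    rw [transpose_mul, Matrix.map_mul]
    calc _ = G'.transpose * (x.transpose * x.map ψ) * G'.map ψ := by
          simp only [Matrix.mul_assoc]
      _ = (G'.transpose * G.transpose) * T.map φ * (G.map ψ * G'.map ψ) := by
          rw [hx]; simp only [Matrix.mul_assoc]
      _ = T.map φ := by rw [h1t, h1c, Matrix.one_mul, Matrix.mul_one]
  · change x.1 * G * G' = x.1
    rw [Matrix.mul_assoc, h1, Matrix.mul_one]
  · change x.1 * G' * G = x.1
    rw [Matrix.mul_assoc, h2, Matrix.mul_one]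

theorem factor_star {l : ℕ} (hle : Zp2.powIdeal p (l + 1) ≤ Zp2.powIdeal p l)
    (x : Zp2 p ⧸ Zp2.powIdeal p (l + 1)) :
    Ideal.Quotient.factor hle (star x) = star (Ideal.Quotient.factor hle x) := by
  obtain ⟨x, rfl⟩ := Ideal.Quotient.mk_surjective x
  rw [star_mk, Ideal.Quotient.factor_mk, Ideal.Quotient.factor_mk, star_mk]

theorem factor_eq_zero_iff (hp : 2 < p) {l : ℕ} (hl : 0 < l)
    (hle : Zp2.powIdeal p (l + 1) ≤ Zp2.powIdeal p l) (x : Zp2 p ⧸ Zp2.powIdeal p (l + 1)) :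
    Ideal.Quotient.factor hle x = 0 ↔ (p : Zp2 p ⧸ Zp2.powIdeal p (l + 1)) * x = 0 := by
  have h2 := (unramifiedQuotient p hp (Nat.succ_pos l)).pow_mul_eq_zero_iff 1 (by omega) x
  rw [pow_one, Nat.succ_sub_one] at h2
  rw [h2]
  constructor
  · intro h3
    obtain ⟨x, rfl⟩ := Ideal.Quotient.mk_surjective x
    rw [Ideal.Quotient.factor_mk, Ideal.Quotient.eq_zero_iff_mem, Zp2.powIdeal,
      Ideal.mem_span_singleton] at h3
    simpa using map_dvd (Ideal.Quotient.mk (Zp2.powIdeal p (l + 1))) h3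
  · rintro ⟨z, rfl⟩
    rw [map_mul, map_pow, map_natCast, (unramifiedQuotient p hp hl).pow_eq_zero, zero_mul]

theorem repCount_diagPow_succ (hp : 2 < p) {s n l : ℕ} {a : Fin n → ℕ} (hl : 0 < l)
    (ha : ∀ i, a i < l) :
    p ^ (n ^ 2) * repCount (1 : Matrix (Fin s) (Fin s) (Zp2 p)) (diagPow p a) (l + 1) =
      p ^ (2 * (s * n)) * repCount (1 : Matrix (Fin s) (Fin s) (Zp2 p)) (diagPow p a) l := by
  have h := unramifiedQuotient p hp (Nat.succ_pos l)
  have h' := unramifiedQuotient p hp hl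
  have := h.finite
  have := h'.finite
  let _ := Fintype.ofFinite (Zp2 p ⧸ Zp2.powIdeal p (l + 1))
  let _ := Fintype.ofFinite (Zp2 p ⧸ Zp2.powIdeal p l)
  have hle : Zp2.powIdeal p (l + 1) ≤ Zp2.powIdeal p l := by
    rw [Zp2.powIdeal, Zp2.powIdeal, Ideal.span_singleton_le_span_singleton]
    exact pow_dvd_pow _ (Nat.le_succ l)
  have h1 := repNum_succ (σ := Fin s) h ha (Ideal.Quotient.factor hle)
    (Ideal.Quotient.factor_surjective hle) (factor_star hle) (factor_eq_zero_iff hp hl hle)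
  rw [Fintype.card_fin, Fintype.card_fin] at h1
  rw [repCount_diagPow, repCount_diagPow]
  convert h1

end Quotient

/-! ### Polynomials determined by their values at the powers of `(-p)⁻¹` -/

section Points

variable {p : ℕ}

theorem inv_neg_pow_injective {K : Type*} [Field K] [LinearOrder K] [IsStrictOrderedRing K]
    (hp : 2 < p) : Function.Injective fun s : ℕ => (-(p : K))⁻¹ ^ s := by
  intro s t hst
  have h1 := congrArg abs hst
  simp only [abs_pow, abs_inv, abs_neg, Nat.abs_cast] at h1
  have hp1 : (1 : K) < p := by exact_mod_cast (by omega : 1 < p)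
  exact pow_right_injective₀ (inv_pos.2 (zero_lt_one.trans hp1)) (inv_lt_one_of_one_lt₀ hp1).ne h1

theorem eq_of_eval_inv_neg_pow_eq {K : Type*} [Field K] [LinearOrder K] [IsStrictOrderedRing K]
    (hp : 2 < p) {F G : K[X]} (N : ℕ)
    (h : ∀ s, N ≤ s → F.eval ((-(p : K))⁻¹ ^ s) = G.eval ((-(p : K))⁻¹ ^ s)) : F = G := by
  refine Polynomial.eq_of_infinite_eval_eq F G
    (((Set.Ici_infinite N).image (inv_neg_pow_injective hp).injOn).mono ?_)
  rintro _ ⟨s, hs, rfl⟩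
  exact h s hs

/-- A complex polynomial with rational values at all powers of `(-p)⁻¹` is given there by a
rational polynomial. -/
theorem exists_rat_polynomial (hp : 2 < p) (P : ℂ[X]) (r : ℕ → ℚ)
    (h : ∀ s, P.eval ((-(p : ℂ))⁻¹ ^ s) = r s) :
    ∃ F : ℚ[X], ∀ s, F.eval ((-(p : ℚ))⁻¹ ^ s) = r s := by
  set N := Finset.range (P.natDegree + 1) with hN
  set v : ℕ → ℚ := fun s => (-(p : ℚ))⁻¹ ^ s with hv
  have hinj : Function.Injective v := inv_neg_pow_injective hp
  have hvC : ∀ s, (-(p : ℂ))⁻¹ ^ s = algebraMap ℚ ℂ (v s) := fun s => by simp [hv]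
  set F := Lagrange.interpolate N v r with hF
  have hmap : ∀ s, (F.map (algebraMap ℚ ℂ)).eval ((-(p : ℂ))⁻¹ ^ s) =
      algebraMap ℚ ℂ (F.eval (v s)) := fun s => by rw [hvC, Polynomial.eval_map_apply]
  have hFP : F.map (algebraMap ℚ ℂ) = P := by
    refine Polynomial.eq_of_degrees_lt_of_eval_index_eq (v := fun s : ℕ => (-(p : ℂ))⁻¹ ^ s) N
      ?_ ?_ ?_ ?_
    · intro s _ t _ hst
      simp only [hvC] at hst
      exact hinj ((algebraMap ℚ ℂ).injective hst)
    · exact (Polynomial.degree_map_le).trans_lt (Lagrange.degree_interpolate_lt r hinj.injOn)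
    · rw [hN, Finset.card_range]
      exact P.degree_le_natDegree.trans_lt (by exact_mod_cast Nat.lt_succ_self _)
    · intro s hs
      rw [hmap, hF, Lagrange.eval_interpolate_at_node r hinj.injOn hs, h]
      simp
  refine ⟨F, fun s => (algebraMap ℚ ℂ).injective ?_⟩
  rw [← hmap, hFP, h]
  simp

theorem neg_zpow_neg_natCast {K : Type*} [Field K] (x : K) (s : ℕ) :
    (-x) ^ (-(s : ℤ)) = (-x)⁻¹ ^ s := by
  rw [_root_.zpow_neg, zpow_natCast, inv_pow]

theorem aeval_inv_neg_pow (F : ℚ[X]) (s : ℕ) :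
    aeval ((-(p : ℝ)) ^ (-(s : ℤ))) F = ((F.eval ((-(p : ℚ))⁻¹ ^ s) : ℚ) : ℝ) := by
  have h1 : (-(p : ℝ)) ^ (-(s : ℤ)) = algebraMap ℚ ℝ ((-(p : ℚ))⁻¹ ^ s) := by
    rw [neg_zpow_neg_natCast]; simp
  rw [h1, Polynomial.aeval_algebraMap_apply]
  simp

end Points

/-! ### The density polynomial -/

section Density

variable {p : ℕ}

theorem diagonal_pow_conjTranspose {R ι : Type*} [CommRing R] [StarRing R] [DecidableEq ι]
    (a : ι → ℕ) :
    (diagonal fun i => (p : R) ^ a i)ᴴ = diagonal fun i => (p : R) ^ a i := by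
  rw [diagonal_conjTranspose]
  congr 1
  ext i; simp

variable [Fact p.Prime]

/-- One rational polynomial gives the normalised representation numbers for all sufficiently large
moduli at once. -/
theorem exists_polynomial_repCount (hp : 2 < p) {n : ℕ} (a : Fin n → ℕ) :
    ∃ F : ℚ[X], ∀ s l : ℕ, 0 < l → (∀ i, a i < l) →
      (p : ℚ) ^ (l * n ^ 2) * repCount (1 : Matrix (Fin s) (Fin s) (Zp2 p)) (diagPow p a) l =
        (p : ℚ) ^ (2 * l * n * s) * F.eval ((-(p : ℚ))⁻¹ ^ s) := by
  have hp0 : (p : ℚ) ≠ 0 := by exact_mod_cast (by omega : p ≠ 0)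
  have hp0' : (p : ℂ) ≠ 0 := by exact_mod_cast (by omega : p ≠ 0)
  -- the smallest admissible modulus; all others are reached by increasing the exponent
  set m := Finset.univ.sup a with hm
  have ham : ∀ i, a i < m + 1 := fun i =>
    Nat.lt_succ_of_le (Finset.le_sup (f := a) (Finset.mem_univ i))
  have h := unramifiedQuotient p hp (Nat.succ_pos m)
  have := h.finite
  let _ := Fintype.ofFinite (Zp2 p ⧸ Zp2.powIdeal p (m + 1))
  obtain ⟨P, hP⟩ := exists_polynomial_repNum (T :=
    powDiagonal (Zp2 p ⧸ Zp2.powIdeal p (m + 1)) p a) h (diagonal_pow_conjTranspose a)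
  obtain ⟨F, hF⟩ := exists_rat_polynomial hp P (fun s => (p : ℚ) ^ ((m + 1) * n ^ 2) *
      repCount (1 : Matrix (Fin s) (Fin s) (Zp2 p)) (diagPow p a) (m + 1) /
        (p : ℚ) ^ (2 * (m + 1) * n * s)) fun s => by
    have h1 := hP s
    rw [Fintype.card_fin] at h1
    push_cast
    rw [eq_div_iff (pow_ne_zero _ hp0'), mul_comm, ← h1, repCount_diagPow]
  refine ⟨F, fun s l hl hal => ?_⟩
  have hml : m + 1 ≤ l := Nat.succ_le_of_lt ((Finset.sup_lt_iff hl).2 fun i _ => hal i)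
  clear hl hal
  induction l, hml using Nat.le_induction with
  | base => rw [hF s, mul_div_cancel₀ _ (pow_ne_zero _ hp0)]
  | succ l hml ih =>
    have h2 : ((p ^ (n ^ 2) * repCount (1 : Matrix (Fin s) (Fin s) (Zp2 p)) (diagPow p a) (l + 1) :
        ℕ) : ℚ) = _ := congrArg Nat.cast (repCount_diagPow_succ hp (by omega)
          fun i => (ham i).trans_le hml)
    push_cast at h2
    have e1 : (p : ℚ) ^ ((l + 1) * n ^ 2) = (p : ℚ) ^ (l * n ^ 2) * (p : ℚ) ^ (n ^ 2) := by
      rw [← pow_add]; ring_nf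
    have e2 : (p : ℚ) ^ (2 * (l + 1) * n * s) =
        (p : ℚ) ^ (2 * l * n * s) * (p : ℚ) ^ (2 * (s * n)) := by
      rw [← pow_add]; ring_nf
    rw [e1, e2]
    linear_combination (p : ℚ) ^ (l * n ^ 2) * h2 + (p : ℚ) ^ (2 * (s * n)) * ih

/-- The sequence defining the density is eventually constant. -/
theorem isDensityPolynomial_diagPow (hp : 2 < p) {n : ℕ} {a : Fin n → ℕ} {F : ℚ[X]}
    (hF : ∀ s l : ℕ, 0 < l → (∀ i, a i < l) →
      (p : ℚ) ^ (l * n ^ 2) * repCount (1 : Matrix (Fin s) (Fin s) (Zp2 p)) (diagPow p a) l =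
        (p : ℚ) ^ (2 * l * n * s) * F.eval ((-(p : ℚ))⁻¹ ^ s)) :
    IsDensityPolynomial (diagPow p a) F := by
  intro s _
  refine tendsto_const_nhds.congr' ?_
  filter_upwards [eventually_gt_atTop 0, eventually_gt_atTop (Finset.univ.sup a)] with l hl hal
  have h1 := hF s l hl fun i => (Finset.le_sup (f := a) (Finset.mem_univ i)).trans_lt hal
  have h2 := congrArg (Rat.cast : ℚ → ℝ) h1
  push_cast at h2
  have hp0 : (p : ℝ) ≠ 0 := by exact_mod_cast (by omega : p ≠ 0)
  have h3 : (p : ℝ) ^ (-((l : ℤ) * n * (2 * s - n))) =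
      (p : ℝ) ^ (l * n ^ 2) / (p : ℝ) ^ (2 * l * n * s) := by
    rw [← zpow_natCast, ← zpow_natCast, ← zpow_sub₀ hp0]
    congr 1
    push_cast
    ring
  rw [h3, aeval_inv_neg_pow, div_mul_eq_mul_div, eq_div_iff (pow_ne_zero _ hp0), h2, mul_comm]

theorem isDensityPolynomial_unique (hp : 2 < p) {n : ℕ} {T : Matrix (Fin n) (Fin n) (Zp2 p)}
    {F G : ℚ[X]} (hF : IsDensityPolynomial T F) (hG : IsDensityPolynomial T G) : F = G := by
  refine eq_of_eval_inv_neg_pow_eq hp n fun s hs => ?_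
  have h1 := tendsto_nhds_unique (hF s hs) (hG s hs)
  rw [aeval_inv_neg_pow, aeval_inv_neg_pow] at h1
  exact_mod_cast h1

theorem isDensityPolynomial_densityPolynomial_of {n : ℕ}
    {T : Matrix (Fin n) (Fin n) (Zp2 p)} {F : ℚ[X]} (hF : IsDensityPolynomial T F) :
    IsDensityPolynomial T (densityPolynomial T) := by
  have h : ∃ F : ℚ[X], IsDensityPolynomial T F := ⟨F, hF⟩
  rw [densityPolynomial, dif_pos h]
  exact h.choose_spec

theorem repCount_eq_eval_densityPolynomial (hp : 2 < p) {n : ℕ} (a : Fin n → ℕ) {s l : ℕ}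
    (hl : 0 < l) (ha : ∀ i, a i < l) :
    (p : ℚ) ^ (l * n ^ 2) * repCount (1 : Matrix (Fin s) (Fin s) (Zp2 p)) (diagPow p a) l =
      (p : ℚ) ^ (2 * l * n * s) *
        (densityPolynomial (diagPow p a)).eval ((-(p : ℚ))⁻¹ ^ s) := by
  obtain ⟨F, hF⟩ := exists_polynomial_repCount hp a
  have h1 := isDensityPolynomial_diagPow hp hF
  rw [← isDensityPolynomial_unique hp h1 (isDensityPolynomial_densityPolynomial_of h1)]
  exact hF s l hl ha

theorem isDensityPolynomial_densityPolynomial (hp : 2 < p) {n : ℕ} (a : Fin n → ℕ) :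
    IsDensityPolynomial (diagPow p a) (densityPolynomial (diagPow p a)) := by
  obtain ⟨F, hF⟩ := exists_polynomial_repCount hp a
  exact isDensityPolynomial_densityPolynomial_of (isDensityPolynomial_diagPow hp hF)

theorem isDensityPolynomial_congr {n : ℕ} {T T' : Matrix (Fin n) (Fin n) (Zp2 p)}
    (h : IsEquivalentZp2 T T') (F : ℚ[X]) :
    IsDensityPolynomial T F ↔ IsDensityPolynomial T' F := by
  simp only [IsDensityPolynomial, HasRepDensity, repCount_congr h]

theorem densityPolynomial_congr {n : ℕ} {T T' : Matrix (Fin n) (Fin n) (Zp2 p)}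
    (h : IsEquivalentZp2 T T') : densityPolynomial T = densityPolynomial T' := by
  have h1 : IsDensityPolynomial T = IsDensityPolynomial T' :=
    funext fun F => propext (isDensityPolynomial_congr h F)
  simp only [densityPolynomial, h1]

/-- There is exactly one matrix with no columns. -/
theorem densityPolynomial_diagPow_zero (hp : 2 < p) (a : Fin 0 → ℕ) :
    densityPolynomial (diagPow p a) = 1 := by
  refine eq_of_eval_inv_neg_pow_eq hp 0 fun s _ => ?_
  have h1 := repCount_eq_eval_densityPolynomial hp a (s := s) one_pos (fun i => i.elim0)
  have h2 : repCount (1 : Matrix (Fin s) (Fin s) (Zp2 p)) (diagPow p a) 1 = 1 := by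
    rw [repCount, Nat.card_eq_one_iff_unique]
    exact ⟨⟨fun x y => Subtype.ext (by ext i j; exact j.elim0)⟩,
      ⟨⟨0, by ext i; exact i.elim0⟩⟩⟩
  rw [h2] at h1
  simpa using h1.symm

end Density

/-! ### Recursion in the last exponent -/

section Recursion

variable {p : ℕ}

/-- The relation between counts with last exponents `b` and `b + 1` modulo `p^(b+2)`, rewritten for
the normalised counts `F₀`, `F₁`, `F` with `X = (-p)^{-s}`. -/
theorem eval_succ_sub_of_card {p N₀ N₁ N F₀ F₁ F : ℚ} (hp0 : p ≠ 0) {r s b A : ℕ}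
    (h : p ^ (2 * (b + 3) * r + 1) * (N₁ - N₀) =
      N * ((-p) ^ ((b + 3) * (s + r) + A) - p ^ (2 * r) * (-p) ^ ((b + 2) * (s + r) + A)))
    (h₁ : p ^ ((b + 2) * (r + 1) ^ 2) * N₁ = p ^ (2 * (b + 2) * (r + 1) * s) * F₁)
    (h₀ : p ^ ((b + 2) * (r + 1) ^ 2) * N₀ = p ^ (2 * (b + 2) * (r + 1) * s) * F₀)
    (h' : p ^ ((b + 2) * r ^ 2) * N = p ^ (2 * (b + 2) * r * s) * F) :
    F₁ - F₀ = (-p) ^ A * (1 - (-p) ^ r * (-p)⁻¹ ^ s) * (p * (-p) ^ r * (-p)⁻¹ ^ s) ^ (b + 1) *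
      F := by
  have hq0 : -p ≠ 0 := neg_ne_zero.2 hp0
  have hx : (-p)⁻¹ ^ s * (-p) ^ s = 1 := by rw [← mul_pow, inv_mul_cancel₀ hq0, one_pow]
  have heven : ∀ k, p ^ (2 * k) = (-p) ^ (2 * k) := fun k => ((even_two_mul k).neg_pow p).symm
  have e1 : p ^ ((b + 2) * (r + 1) ^ 2) =
      p ^ ((b + 2) * r ^ 2) * p ^ (2 * (b + 2) * r) * (p ^ (b + 1) * p) := by
    rw [← pow_add, ← pow_succ, ← pow_add]; ring_nf
  have e2 : p ^ (2 * (b + 2) * (r + 1) * s) =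
      p ^ (2 * (b + 2) * r * s) * (((-p) ^ s) ^ (b + 2) * ((-p) ^ s) ^ (b + 2)) := by
    rw [show 2 * (b + 2) * (r + 1) * s = 2 * (b + 2) * r * s + 2 * ((b + 2) * s) by ring, pow_add,
      heven, ← pow_mul, ← pow_add]
    ring_nf
  have e3 : p ^ (2 * (b + 3) * r + 1) = p ^ (2 * (b + 2) * r) * p ^ (2 * r) * p := by
    rw [← pow_add, ← pow_succ]; ring_nf
  have e4 : (-p) ^ ((b + 3) * (s + r) + A) = ((-p) ^ s) ^ (b + 2) * (-p) ^ s *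
      ((-p) ^ r) ^ (b + 1) * p ^ (2 * r) * (-p) ^ A := by
    rw [heven, ← pow_mul, ← pow_mul, ← pow_add, ← pow_add, ← pow_add, ← pow_add]; ring_nf
  have e5 : (-p) ^ ((b + 2) * (s + r) + A) = ((-p) ^ s) ^ (b + 2) *
      ((-p) ^ r) ^ (b + 1) * (-p) ^ r * (-p) ^ A := by
    rw [← pow_mul, ← pow_mul, ← pow_add, ← pow_add, ← pow_add]; ring_nf
  rw [e3, e4, e5] at h
  rw [e1, e2] at h₁ h₀
  rw [mul_pow, mul_pow]
  set x := (-p)⁻¹ ^ s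
  set Q := (-p) ^ s
  set R := (-p) ^ r
  have hxb : x ^ (b + 2) * Q ^ (b + 2) = 1 := by rw [← mul_pow, hx, one_pow]
  have hQ0 : Q ≠ 0 := pow_ne_zero _ hq0
  have hmain : Q ^ (b + 2) * (F₁ - F₀) =
      p ^ (b + 1) * F * (-p) ^ A * R ^ (b + 1) * (Q - R) := by
    refine mul_left_cancel₀ (mul_ne_zero (mul_ne_zero (mul_ne_zero
      (pow_ne_zero (2 * (b + 2) * r * s) hp0) (pow_ne_zero (2 * r) hp0)) hp0)
      (pow_ne_zero (b + 2) hQ0)) ?_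
    linear_combination p ^ ((b + 2) * r ^ 2) * (p ^ (b + 1) * p) * h -
      p ^ (2 * r) * p * (h₁ - h₀) + (p ^ (b + 1) * p) * (Q ^ (b + 2) * Q * R ^ (b + 1) *
        p ^ (2 * r) * (-p) ^ A - p ^ (2 * r) * (Q ^ (b + 2) * R ^ (b + 1) * R * (-p) ^ A)) * h'
  linear_combination x ^ (b + 2) * hmain - (F₁ - F₀) * hxb +
    x ^ (b + 1) * p ^ (b + 1) * F * (-p) ^ A * R ^ (b + 1) * hx

/-- The relation between counts with last exponents `b` and `b + 2` modulo `p^(b+3)`, rewritten for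
the normalised counts `F₀`, `F₂` at rank `t + 2` and `F` at rank `t`. -/
theorem eval_add_two_of_card {p N₀ N₂ N F₀ F₂ F : ℚ} (hp0 : p ≠ 0) {r t b : ℕ}
    (h : p ^ (2 * (t + 2) + (b + 3)) * N₂ = p ^ (b + 3 + 2 * r + 2) * N₀ +
      p ^ (2 * (b + 3) * r) * N * ((p ^ (2 * (t + 2)) - 1) * p ^ (2 * (b + 3) * (t + 2)) +
        (p - 1) * (p ^ (2 * (t + 2)) * (-p) ^ ((2 * (b + 3) - 1) * (t + 2)) -
          p ^ (2 * (b + 3) * (t + 2)))))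
    (h₂ : p ^ ((b + 3) * (r + 1) ^ 2) * N₂ = p ^ (2 * (b + 3) * (r + 1) * (t + 2)) * F₂)
    (h₀ : p ^ ((b + 3) * (r + 1) ^ 2) * N₀ = p ^ (2 * (b + 3) * (r + 1) * (t + 2)) * F₀)
    (h' : p ^ ((b + 3) * r ^ 2) * N = p ^ (2 * (b + 3) * r * t) * F) :
    F₂ = p ^ (2 * (r + 1)) * ((-p)⁻¹ ^ (t + 2)) ^ 2 * F₀ +
      (1 - (-p)⁻¹ ^ (t + 2)) * (1 + p * (-p)⁻¹ ^ (t + 2)) * F := by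
  have hq0 : -p ≠ 0 := neg_ne_zero.2 hp0
  have hx : (-p)⁻¹ ^ (t + 2) * (-p) ^ (t + 2) = 1 := by
    rw [← mul_pow, inv_mul_cancel₀ hq0, one_pow]
  have heven : ∀ k, p ^ (2 * k) = (-p) ^ (2 * k) := fun k => ((even_two_mul k).neg_pow p).symm
  have e1 : p ^ ((b + 3) * (r + 1) ^ 2) =
      p ^ ((b + 3) * r ^ 2) * p ^ (2 * (b + 3) * r) * p ^ (b + 3) := by
    rw [← pow_add, ← pow_add]; ring_nf
  have e2 : p ^ (2 * (b + 3) * (r + 1) * (t + 2)) = p ^ (2 * (b + 3) * r * t) *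
      (p ^ (2 * (b + 3) * r) * p ^ (2 * (b + 3) * r)) * p ^ (2 * (b + 3) * (t + 2)) := by
    rw [← pow_add, ← pow_add, ← pow_add]; ring_nf
  have e3 : p ^ (2 * (b + 3) * (t + 2)) =
      (-p) ^ ((2 * (b + 3) - 1) * (t + 2)) * (-p) ^ (t + 2) := by
    rw [mul_assoc, heven, ← pow_add, show 2 * (b + 3) - 1 = 2 * b + 5 by omega]; ring_nf
  have e4 : p ^ (2 * (t + 2)) = (-p) ^ (t + 2) * (-p) ^ (t + 2) := by
    rw [heven, ← pow_add]; ring_nf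
  have e5 : p ^ (b + 3 + 2 * r + 2) = p ^ (b + 3) * p ^ (2 * (r + 1)) := by
    rw [← pow_add]; ring_nf
  rw [pow_add p (2 * (t + 2)) (b + 3), e5, e3, e4] at h
  rw [e1, e2, e3] at h₂ h₀
  have hV0 : (-p) ^ ((2 * (b + 3) - 1) * (t + 2)) ≠ 0 := pow_ne_zero _ hq0
  set x := (-p)⁻¹ ^ (t + 2)
  set Q := (-p) ^ (t + 2)
  set V := (-p) ^ ((2 * (b + 3) - 1) * (t + 2))
  have hmain : Q ^ 3 * F₂ = p ^ (2 * (r + 1)) * Q * F₀ +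
      F * ((Q ^ 2 - 1) * Q + (p - 1) * (Q ^ 2 - Q)) := by
    refine mul_left_cancel₀ (mul_ne_zero (mul_ne_zero (mul_ne_zero (mul_ne_zero
      (pow_ne_zero (2 * (b + 3) * r * t) hp0) (pow_ne_zero (2 * (b + 3) * r) hp0))
      (pow_ne_zero (2 * (b + 3) * r) hp0)) (pow_ne_zero (b + 3) hp0)) hV0) ?_
    linear_combination p ^ ((b + 3) * r ^ 2) * p ^ (2 * (b + 3) * r) * p ^ (b + 3) * h -
      Q * Q * p ^ (b + 3) * h₂ + p ^ (b + 3) * p ^ (2 * (r + 1)) * h₀ +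
      p ^ (2 * (b + 3) * r) * p ^ (2 * (b + 3) * r) * p ^ (b + 3) *
        ((Q * Q - 1) * (V * Q) + (p - 1) * (Q * Q * V - V * Q)) * h'
  have hx3 : x ^ 3 * Q ^ 3 = 1 := by rw [← mul_pow, hx, one_pow]
  have hx2 : x ^ 2 * Q ^ 2 = 1 := by rw [← mul_pow, hx, one_pow]
  linear_combination x ^ 3 * hmain - F₂ * hx3 + p ^ (2 * (r + 1)) * x ^ 2 * F₀ * hx +
    F * (hx3 - x ^ 2 * hx + (p - 1) * (x * hx2 - x ^ 2 * hx))

theorem repNum_submatrix {R : Type*} [CommRing R] [StarRing R] {σ ι κ : Type*} [Fintype σ]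
    (e : ι ≃ κ) (T : Matrix κ κ R) : repNum σ (T.submatrix e e) = repNum σ T := by
  refine Nat.card_congr ((Matrix.reindex (Equiv.refl σ) e).subtypeEquiv fun x => ?_)
  have h1 : (Matrix.reindex (Equiv.refl σ) e x)ᴴ * Matrix.reindex (Equiv.refl σ) e x =
      (xᴴ * x).submatrix e.symm e.symm := rfl
  rw [h1]
  constructor
  · intro h
    rw [h, submatrix_submatrix]
    simp
  · intro h
    rw [← h, submatrix_submatrix]
    simp

theorem repNum_snoc {R : Type*} [CommRing R] [StarRing R] {σ : Type*} [Fintype σ] {r : ℕ}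
    (a : Fin r → ℕ) (b : ℕ) :
    repNum σ (powDiagonal R p (Fin.snoc a b : Fin (r + 1) → ℕ)) =
      repNum σ (adjoinGram (powDiagonal R p a) 0 ((p : R) ^ b)) := by
  have h1 := adjoinGram_diagonal (fun i : Option (Fin r) => (p : R) ^
    (Fin.snoc a b : Fin (r + 1) → ℕ) (finSuccEquivLast.symm i))
  simp only [finSuccEquivLast_symm_none, finSuccEquivLast_symm_some, Fin.snoc_castSucc,
    Fin.snoc_last] at h1
  rw [h1, ← repNum_submatrix finSuccEquivLast, submatrix_diagonal_equiv]
  congr 2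
  ext i
  simp

theorem snoc_lt {r k c : ℕ} {a : Fin r → ℕ} (hc : c < k) (ha : ∀ i, a i < k) (i : Fin (r + 1)) :
    (Fin.snoc a c : Fin (r + 1) → ℕ) i < k := by
  refine Fin.lastCases ?_ (fun j => ?_) i
  · rwa [Fin.snoc_last]
  · rw [Fin.snoc_castSucc]
    exact ha j

theorem snoc_dropLastExp {n : ℕ} (a : Fin (n + 1) → ℕ) :
    (Fin.snoc (dropLastExp a : Fin n → ℕ) (a (Fin.last n)) : Fin (n + 1) → ℕ) = a := by
  ext i
  refine Fin.lastCases ?_ (fun j => ?_) i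
  · rw [Fin.snoc_last]
  · rw [Fin.snoc_castSucc]
    rfl

theorem one_sub_pow_mul_X_sq_ne_zero (m : ℕ) :
    (1 - (p : ℚ[X]) ^ m * Polynomial.X ^ 2 : ℚ[X]) ≠ 0 := by
  intro h
  have h1 := congrArg (Polynomial.eval 0) h
  simp at h1

/-- In terms of `Y = p (-p)^r X`, where `n = r + 1`, one has `p^n X = (-1)^r Y` and
`(-p)^n X = -Y`; all signs in the definition of `AFactor` cancel. -/
theorem AFactor_eq (hp : 2 < p) {r : ℕ} (hr : 1 ≤ r + 1) (a : Fin (r + 1) → ℕ) :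
    AFactor p hr a =
      algebraMap ℚ[X] (RatFunc ℚ)
        ((-(p : ℚ[X])) ^ (∑ i, dropLastExp a i) * (1 - (-(p : ℚ[X])) ^ r * Polynomial.X) *
        ((p : ℚ[X]) * (-(p : ℚ[X])) ^ r * Polynomial.X) ^ (a (Fin.last r) + 1) *
        (1 + (p : ℚ[X]) * (-(p : ℚ[X])) ^ r * Polynomial.X)) := by
  have hp0 : (p : RatFunc ℚ) ≠ 0 := by exact_mod_cast (by omega : p ≠ 0)
  have hX : (RatFunc.X : RatFunc ℚ) ≠ 0 := RatFunc.X_ne_zero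
  have hA : AFactor p hr a = (1 - (-(p : RatFunc ℚ)) ^ r * RatFunc.X) *
      (1 - (-(p : RatFunc ℚ)) ^ (-((r + 1 : ℕ) : ℤ)) * RatFunc.X⁻¹) *
      (-(p : RatFunc ℚ)) ^ (∑ i, dropLastExp a i) * (-1) ^ ((r + 1 + 1) * a (Fin.last r)) *
      ((p : RatFunc ℚ) ^ (r + 1) * RatFunc.X) ^ (a (Fin.last r) + 2) := rfl
  set Y : RatFunc ℚ := (p : RatFunc ℚ) * (-(p : RatFunc ℚ)) ^ r * RatFunc.X with hY
  have hY0 : Y ≠ 0 := mul_ne_zero (mul_ne_zero hp0 (pow_ne_zero _ (neg_ne_zero.2 hp0))) hX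
  have h1 : (-(p : RatFunc ℚ)) ^ (-((r + 1 : ℕ) : ℤ)) * RatFunc.X⁻¹ = -Y⁻¹ := by
    rw [_root_.zpow_neg, zpow_natCast, ← mul_inv, ← inv_neg, hY]
    congr 1
    ring
  have h2 : (p : RatFunc ℚ) ^ (r + 1) * RatFunc.X = (-1) ^ r * Y := by
    rw [hY, neg_pow]
    have : ((-1 : RatFunc ℚ) ^ r) * (-1) ^ r = 1 := by rw [← mul_pow]; simp
    linear_combination -(p : RatFunc ℚ) ^ (r + 1) * RatFunc.X * this
  have h3 : ((-1 : RatFunc ℚ)) ^ ((r + 1 + 1) * a (Fin.last r)) *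
      ((-1) ^ r) ^ (a (Fin.last r) + 2) = 1 := by
    rw [← pow_mul, ← pow_add]
    refine Even.neg_one_pow ⟨(r + 1) * a (Fin.last r) + r, ?_⟩
    ring
  have e : algebraMap ℚ[X] (RatFunc ℚ)
        ((-(p : ℚ[X])) ^ (∑ i, dropLastExp a i) * (1 - (-(p : ℚ[X])) ^ r * Polynomial.X) *
        ((p : ℚ[X]) * (-(p : ℚ[X])) ^ r * Polynomial.X) ^ (a (Fin.last r) + 1) *
        (1 + (p : ℚ[X]) * (-(p : ℚ[X])) ^ r * Polynomial.X)) =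
      (-(p : RatFunc ℚ)) ^ (∑ i, dropLastExp a i) * (1 - (-(p : RatFunc ℚ)) ^ r * RatFunc.X) *
        Y ^ (a (Fin.last r) + 1) * (1 + Y) := by
    simp only [map_mul, map_pow, map_neg, map_sub, map_add, map_one, map_natCast,
      RatFunc.algebraMap_X, hY]
  rw [e, hA, h1, h2, mul_pow]
  have h4 : Y ^ (a (Fin.last r) + 2) * (1 - -Y⁻¹) = Y ^ (a (Fin.last r) + 1) * (1 + Y) := by
    field_simp
    ring
  linear_combination (1 - (-(p : RatFunc ℚ)) ^ r * RatFunc.X) *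
    (-(p : RatFunc ℚ)) ^ (∑ i, dropLastExp a i) * (h4 + (1 - -Y⁻¹) *
      Y ^ (a (Fin.last r) + 2) * h3)

variable [Fact p.Prime]

theorem densityPolynomial_snoc_succ_sub (hp : 2 < p) {r : ℕ} {a : Fin r → ℕ} {b : ℕ}
    (hab : ∀ i, a i ≤ b) :
    densityPolynomial (diagPow p (Fin.snoc a (b + 1) : Fin (r + 1) → ℕ)) -
        densityPolynomial (diagPow p (Fin.snoc a b : Fin (r + 1) → ℕ)) =
      (-(p : ℚ[X])) ^ (∑ i, a i) * (1 - (-(p : ℚ[X])) ^ r * Polynomial.X) *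
        ((p : ℚ[X]) * (-(p : ℚ[X])) ^ r * Polynomial.X) ^ (b + 1) *
        densityPolynomial (diagPow p a) := by
  have hp0 : (p : ℚ) ≠ 0 := by exact_mod_cast (by omega : p ≠ 0)
  refine eq_of_eval_inv_neg_pow_eq hp 0 fun s _ => ?_
  have h := unramifiedQuotient p hp (Nat.succ_pos (b + 1))
  have := h.finite
  let _ := Fintype.ofFinite (Zp2 p ⧸ Zp2.powIdeal p (b + 2))
  have hlt : ∀ c, c < b + 2 → ∀ i, (Fin.snoc a c : Fin (r + 1) → ℕ) i < b + 2 :=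
    fun c hc => snoc_lt hc fun i => (hab i).trans_lt (by omega)
  have h0 := repNum_adjoin_succ_sub (σ := Fin s) b h hab
  have h1 := repCount_eq_eval_densityPolynomial hp (s := s) _ (Nat.succ_pos (b + 1))
    (hlt (b + 1) (by omega))
  have h2 := repCount_eq_eval_densityPolynomial hp (s := s) _ (Nat.succ_pos (b + 1))
    (hlt b (by omega))
  have h3 := repCount_eq_eval_densityPolynomial hp (s := s) (l := b + 2) a (by omega)
    fun i => (hab i).trans_lt (by omega)
  rw [repCount_diagPow, repNum_snoc] at h1 h2
  rw [repCount_diagPow] at h3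
  rw [Fintype.card_fin, Fintype.card_fin] at h0
  have hcast : ∀ N₁ N₀ N A : ℕ, (p : ℂ) ^ (2 * (b + 3) * r + 1) * ((N₁ : ℂ) - N₀) =
      N * ((-(p : ℂ)) ^ ((b + 3) * (s + r) + A) -
        (p : ℂ) ^ (2 * r) * (-(p : ℂ)) ^ ((b + 2) * (s + r) + A)) →
      (p : ℚ) ^ (2 * (b + 3) * r + 1) * ((N₁ : ℚ) - N₀) =
      N * ((-(p : ℚ)) ^ ((b + 3) * (s + r) + A) -
        (p : ℚ) ^ (2 * r) * (-(p : ℚ)) ^ ((b + 2) * (s + r) + A)) :=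
    fun N₁ N₀ N A h => by exact_mod_cast h
  have h4 := eval_succ_sub_of_card hp0 (hcast _ _ _ (∑ i, a i) (by convert h0)) h1 h2 h3
  simpa using h4

theorem densityPolynomial_snoc_add_two (hp : 2 < p) {r : ℕ} {a : Fin r → ℕ} {b : ℕ}
    (hab : ∀ i, a i ≤ b) :
    densityPolynomial (diagPow p (Fin.snoc a (b + 2) : Fin (r + 1) → ℕ)) =
      (p : ℚ[X]) ^ (2 * (r + 1)) * Polynomial.X ^ 2 *
        densityPolynomial (diagPow p (Fin.snoc a b : Fin (r + 1) → ℕ)) +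
      (1 - Polynomial.X) * (1 + (p : ℚ[X]) * Polynomial.X) *
        (densityPolynomial (diagPow p a)).comp ((p : ℚ[X]) ^ 2 * Polynomial.X) := by
  have hp0 : (p : ℚ) ≠ 0 := by exact_mod_cast (by omega : p ≠ 0)
  refine eq_of_eval_inv_neg_pow_eq hp 2 fun s hs => ?_
  obtain ⟨t, rfl⟩ := Nat.exists_eq_add_of_le' hs
  have h := unramifiedQuotient p hp (Nat.succ_pos (b + 2))
  have := h.finite
  let _ := Fintype.ofFinite (Zp2 p ⧸ Zp2.powIdeal p (b + 3))
  have hlt : ∀ c, c < b + 3 → ∀ i, (Fin.snoc a c : Fin (r + 1) → ℕ) i < b + 3 :=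
    fun c hc => snoc_lt hc fun i => (hab i).trans_lt (by omega)
  have h0 := repNum_adjoin_add_two (σ := Fin (t + 2)) (σ' := Fin t) h (by simp) le_rfl hab
  have h1 := repCount_eq_eval_densityPolynomial hp (s := t + 2) _ (Nat.succ_pos (b + 2))
    (hlt (b + 2) (by omega))
  have h2 := repCount_eq_eval_densityPolynomial hp (s := t + 2) _ (Nat.succ_pos (b + 2))
    (hlt b (by omega))
  have h3 := repCount_eq_eval_densityPolynomial hp (s := t) (l := b + 3) a (by omega)
    fun i => (hab i).trans_lt (by omega)
  rw [repCount_diagPow, repNum_snoc] at h1 h2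
  rw [repCount_diagPow] at h3
  rw [Fintype.card_fin, Fintype.card_fin] at h0
  have hcast : ∀ N₂ N₀ N : ℕ, (p : ℂ) ^ (2 * (t + 2) + (b + 3)) * (N₂ : ℂ) =
      (p : ℂ) ^ (b + 3 + 2 * r + 2) * N₀ + (p : ℂ) ^ (2 * (b + 3) * r) * N *
        (((p : ℂ) ^ (2 * (t + 2)) - 1) * (p : ℂ) ^ (2 * (b + 3) * (t + 2)) +
        ((p : ℂ) - 1) * ((p : ℂ) ^ (2 * (t + 2)) * (-(p : ℂ)) ^ ((2 * (b + 3) - 1) * (t + 2)) -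
          (p : ℂ) ^ (2 * (b + 3) * (t + 2)))) →
      (p : ℚ) ^ (2 * (t + 2) + (b + 3)) * (N₂ : ℚ) =
      (p : ℚ) ^ (b + 3 + 2 * r + 2) * N₀ + (p : ℚ) ^ (2 * (b + 3) * r) * N *
        (((p : ℚ) ^ (2 * (t + 2)) - 1) * (p : ℚ) ^ (2 * (b + 3) * (t + 2)) +
        ((p : ℚ) - 1) * ((p : ℚ) ^ (2 * (t + 2)) * (-(p : ℚ)) ^ ((2 * (b + 3) - 1) * (t + 2)) -
          (p : ℚ) ^ (2 * (b + 3) * (t + 2)))) :=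
    fun N₂ N₀ N h => by exact_mod_cast h
  have h4 := eval_add_two_of_card hp0 (hcast _ _ _ (by convert h0)) h1 h2 h3
  -- replacing `s` by `s - 2` multiplies `X` by `p²`
  have h5 : (p : ℚ) ^ 2 * (-(p : ℚ))⁻¹ ^ (t + 2) = (-(p : ℚ))⁻¹ ^ t := by
    rw [pow_add, inv_pow _ 2, neg_sq, mul_comm, mul_assoc, inv_mul_cancel₀ (pow_ne_zero 2 hp0),
      mul_one]
  simp only [Polynomial.eval_add, Polynomial.eval_mul, Polynomial.eval_sub, Polynomial.eval_one,
    Polynomial.eval_pow, Polynomial.eval_natCast, Polynomial.eval_X, Polynomial.eval_comp, h5]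
  exact h4

/-- Eliminating the polynomials for the exponents `b + 1` and `b + 2`. -/
theorem densityPolynomial_snoc (hp : 2 < p) {r : ℕ} {a : Fin r → ℕ} {b : ℕ}
    (hab : ∀ i, a i ≤ b) :
    (1 - (p : ℚ[X]) ^ (2 * (r + 1)) * Polynomial.X ^ 2) *
        densityPolynomial (diagPow p (Fin.snoc a b : Fin (r + 1) → ℕ)) =
      (1 - Polynomial.X) * (1 + (p : ℚ[X]) * Polynomial.X) *
        (densityPolynomial (diagPow p a)).comp ((p : ℚ[X]) ^ 2 * Polynomial.X) -
      (-(p : ℚ[X])) ^ (∑ i, a i) * (1 - (-(p : ℚ[X])) ^ r * Polynomial.X) *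
        ((p : ℚ[X]) * (-(p : ℚ[X])) ^ r * Polynomial.X) ^ (b + 1) *
        (1 + (p : ℚ[X]) * (-(p : ℚ[X])) ^ r * Polynomial.X) *
        densityPolynomial (diagPow p a) := by
  have h0 := densityPolynomial_snoc_succ_sub hp hab
  have h1 := densityPolynomial_snoc_succ_sub hp (b := b + 1) fun i => (hab i).trans b.le_succ
  have h2 := densityPolynomial_snoc_add_two hp hab
  rw [pow_succ _ (b + 1)] at h1
  linear_combination h2 - h0 - h1

theorem densityPolynomial_diagPow_one (hp : 2 < p) (a : Fin 1 → ℕ) :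
    densityPolynomial (diagPow p a) = (1 - Polynomial.X) * ∑ l ∈ Finset.range (a 0 + 1),
      ((p : ℚ[X]) * Polynomial.X) ^ l := by
  have h1 := densityPolynomial_snoc hp (a := (Fin.elim0 : Fin 0 → ℕ)) (b := a 0)
    (fun i => i.elim0)
  have h2 : (Fin.snoc (Fin.elim0 : Fin 0 → ℕ) (a 0) : Fin 1 → ℕ) = a := by
    ext i
    obtain rfl : i = Fin.last 0 := Subsingleton.elim (α := Fin 1) _ _
    rw [Fin.snoc_last]
    rfl
  have h3 := mul_neg_geom_sum ((p : ℚ[X]) * Polynomial.X) (a 0 + 1)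
  rw [h2, densityPolynomial_diagPow_zero hp, Polynomial.one_comp] at h1
  simp only [Finset.univ_eq_empty, Finset.sum_empty, pow_zero, zero_add, mul_one, one_mul] at h1
  refine mul_left_cancel₀ (one_sub_pow_mul_X_sq_ne_zero (p := p) 2) (h1.trans ?_)
  linear_combination -(1 - Polynomial.X) * (1 + (p : ℚ[X]) * Polynomial.X) * h3

end Recursion

end HermDensity

end

theorem mainTheorem4 (p : ℕ) [Fact p.Prime] (hp : 2 < p) (n : ℕ) (hn : 1 ≤ n)
    (a : Fin n → ℕ) (ha : Monotone a) (T : Matrix (Fin n) (Fin n) (Zp2 p))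
    (hT : IsHermitianZp2 T) (hTa : IsEquivalentZp2 T (diagPow p a)) :
    IsDensityPolynomial T (densityPolynomial T) ∧
    (∀ G : Polynomial ℚ, IsDensityPolynomial T G → G = densityPolynomial T) ∧
    (n = 1 →
      densityPolynomial T =
        (1 - Polynomial.X) * ∑ l ∈ Finset.range (a ⟨0, hn⟩ + 1),
          ((p : Polynomial ℚ) * Polynomial.X) ^ l) ∧
    (2 ≤ n →
      algebraMap (Polynomial ℚ) (RatFunc ℚ) (densityPolynomial T) =
        (HFactor p *
            algebraMap (Polynomial ℚ) (RatFunc ℚ)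
              ((densityPolynomial (diagPow p (dropLastExp a))).comp
                ((p : Polynomial ℚ) ^ 2 * Polynomial.X)) -
          AFactor p hn a *
            algebraMap (Polynomial ℚ) (RatFunc ℚ)
              (densityPolynomial (diagPow p (dropLastExp a)))) /
          (1 - (p : RatFunc ℚ) ^ (2 * n) * RatFunc.X ^ 2)) := by
  rw [HermDensity.densityPolynomial_congr hTa]
  have h1 := HermDensity.isDensityPolynomial_densityPolynomial hp a
  refine ⟨(HermDensity.isDensityPolynomial_congr hTa _).2 h1,
    fun G hG => HermDensity.isDensityPolynomial_unique hp
      ((HermDensity.isDensityPolynomial_congr hTa _).1 hG) h1,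
    ?_, fun _ => ?_⟩
  · rintro rfl
    exact HermDensity.densityPolynomial_diagPow_one hp a
  · obtain ⟨r, rfl⟩ := Nat.exists_eq_add_of_le' hn
    have h2 := HermDensity.densityPolynomial_snoc hp (r := r) (a := (dropLastExp a : Fin r → ℕ))
      (b := a (Fin.last r)) fun i => ha (Fin.le_last _)
    rw [HermDensity.snoc_dropLastExp] at h2
    have h4 : algebraMap (Polynomial ℚ) (RatFunc ℚ)
        (1 - (p : Polynomial ℚ) ^ (2 * (r + 1)) * Polynomial.X ^ 2) =
        1 - (p : RatFunc ℚ) ^ (2 * (r + 1)) * RatFunc.X ^ 2 := by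
      simp only [map_mul, map_pow, map_sub, map_one, map_natCast, RatFunc.algebraMap_X]
    have h5 : algebraMap (Polynomial ℚ) (RatFunc ℚ)
        ((1 - Polynomial.X) * (1 + (p : Polynomial ℚ) * Polynomial.X)) = HFactor p := by
      simp only [map_mul, map_sub, map_add, map_one, map_natCast, RatFunc.algebraMap_X, HFactor]
    have h6 : 1 - (p : RatFunc ℚ) ^ (2 * (r + 1)) * RatFunc.X ^ 2 ≠ 0 := by
      rw [← h4]
      exact (map_ne_zero_iff _ (RatFunc.algebraMap_injective ℚ)).2
        (HermDensity.one_sub_pow_mul_X_sq_ne_zero _)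
    rw [eq_div_iff h6, HermDensity.AFactor_eq hp hn, ← h4, ← h5,
      ← map_mul (algebraMap (Polynomial ℚ) (RatFunc ℚ)),
      ← map_mul (algebraMap (Polynomial ℚ) (RatFunc ℚ)),
      ← map_mul (algebraMap (Polynomial ℚ) (RatFunc ℚ)),
      ← map_sub (algebraMap (Polynomial ℚ) (RatFunc ℚ)), mul_comm, h2]
    rfl
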